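/- Fix a real queue factor $c>1$ and an integer $d\ge 2$. Consider a MultiQueue with $m=cp$ internal sequential priority queues (with $m$ an integer), each protected by a lock, that is accessed by $p$ threads. To insert, a thread repeatedly draws an internal queue uniformly at random and tries to lock it until this succeeds; it then inserts the element into the locked queue and unlocks it. To delete, a thread repeatedly draws $d$ internal queues independently and uniformly at random, reads their minima and tries to lock the queue with the smallest one (an empty queue counts as having minimum $\bot$, greater than all elements), until locking succeeds; it then deletes and returns the minimum of the locked queue ($\bot$ if that queue is empty) and unlocks it. All draws are independent. Threads run asynchronously: a scheduler decides which thread performs the next atomic step (drawing one candidate, including reading its minimum in a deletion; one lock attempt; the operation on the locked queue; unlocking). The scheduler may depend on the entire history except the random choices of attempts whose lock attempt has not been made yet. The time of an operation is the total cost of the steps that its thread performs for it. An access to an internal queue costs the number of elementary steps of the sequential data structure; drawing costs $O(1)$; a write to a lock costs $1$ plus the number of other threads with a pending write to the same lock, counted both when the write is issued and when it is performed. Initially the MultiQueue is empty. Each thread executes a finite sequence of operations fixed in advance. There are constants $C_1,C_2,C_3>0$ depending only on $c$ and $d$ such that the following hold for all $p$ and $m=cp$. 1. (Binary heaps, average insertion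 time.) Let the internal queues be binary heaps over a set of elements with a strict weak order. Suppose that each thread performs an arbitrary number of insertions and no deletions, that the (arbitrary) elements to be inserted are assigned to the insertions by a uniformly random permutation, and that the scheduler sees only the control states of the threads and the locks but not the elements. Then each insertion takes expected time at most $C_1$. 2. (Binary heaps, worst case.) Let the internal queues be binary heaps over a set of elements with a strict weak order. For all sequences of insertions and deletions and every scheduler as above, the time $T$ of each operation satisfies $\mathbb E[T]\le C_2\,\mathbb E[\log_2(n+2)]$, where $n$ is the number of elements in the MultiQueue at the time when the operation accesses the internal queue that it has locked ($n=0$ if this never happens). In particular, the expected time is $O(\log n)$ per operation if the MultiQueue never holds more than $n\ge 2$ elements. 3. (Van Emde Boas trees.) Let the elements have integer keys in $\{0,\dots,U-1\}$ with $U\ge 4$, be ordered by their keys, and let the internal queues be van Emde Boas trees (with a list of elements for each key). For all sequences of insertions and deletions and every scheduler as above, each operation takes expected time at most $C_3\log_2\log_2 U$. -/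

import Mathlib

open MeasureTheory
open scoped ENNReal

universe u

/-! ### Sequential priority queues with step counts -/

/-- `optLt lt` extends the order `lt` to `E ∪ {⊥}`, where the special element `⊥` (here `none`)
is greater than all elements of `E`. -/
def optLt {E : Type u} (lt : E → E → Prop) : Option E → Option E → Prop
  | some a, some b => lt a b
  | some _, none => True
  | none, _ => False

instance optLt.decidableRel {E : Type u} (lt : E → E → Prop) [DecidableRel lt] :
    DecidableRel (optLt lt)
  | some a, some b => inferInstanceAs (Decidable (lt a b))
  | some _, none => isTrue trivial
  | none, some _ => isFalse id
  | none, none => isFalse id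

/-- The operations of a sequential priority queue. The natural number returned by an operation is
the number of elementary steps that it takes. `size` is the number of stored elements; it is not
an operation of the queue and is only used to speak about executions. -/
structure InternalPQ (E : Type u) where
  State : Type u
  empty : State
  size : State → ℕ
  insert : E → State → State × ℕ
  deleteMin : State → (State × Option E) × ℕ
  findMin : State → Option E × ℕ

/-! #### Binary heaps -/

/-- An implicit binary heap: the children of cell `i` are the cells `2 * i + 1` and `2 * i + 2`.
The cells `0, …, size - 1` hold the elements, all other cells hold `⊥`. -/
structure BinaryHeap (E : Type u) where
  size : ℕ
  cell : ℕ → Option E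

namespace BinaryHeap

variable {E : Type u}

def swapCells (a : ℕ → Option E) (i j : ℕ) : ℕ → Option E :=
  Function.update (Function.update a i (a j)) j (a i)

/-- Move the element in cell `i` up while it is smaller than its parent. Each visited cell costs
one step (one comparison and one swap). -/
def siftUp (lt : E → E → Prop) [DecidableRel lt] (a : ℕ → Option E) (i : ℕ) :
    (ℕ → Option E) × ℕ :=
  if h : i = 0 then (a, 1)
  else
    if optLt lt (a i) (a ((i - 1) / 2)) then
      let r := siftUp lt (swapCells a i ((i - 1) / 2)) ((i - 1) / 2)
      (r.1, r.2 + 1)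
    else (a, 1)
termination_by i
decreasing_by omega

/-- The cell of the smaller child of `i`. -/
def minChild (lt : E → E → Prop) [DecidableRel lt] (a : ℕ → Option E) (i : ℕ) : ℕ :=
  if optLt lt (a (2 * i + 2)) (a (2 * i + 1)) then 2 * i + 2 else 2 * i + 1

/-- Move the element in cell `i` of a heap with `n` cells down while it is larger than its smaller
child. Each visited cell costs one step (at most two comparisons and one swap). -/
def siftDown (lt : E → E → Prop) [DecidableRel lt] (n : ℕ) (a : ℕ → Option E) (i : ℕ) :
    (ℕ → Option E) × ℕ :=
  if h : 2 * i + 1 < n then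
    if optLt lt (a (minChild lt a i)) (a i) then
      let r := siftDown lt n (swapCells a i (minChild lt a i)) (minChild lt a i)
      (r.1, r.2 + 1)
    else (a, 1)
  else (a, 1)
termination_by n - i
decreasing_by
  unfold minChild
  split <;> omega

/-- Append the new element as the last cell and sift it up. -/
def insert (lt : E → E → Prop) [DecidableRel lt] (e : E) (q : BinaryHeap E) : BinaryHeap E × ℕ :=
  let r := siftUp lt (Function.update q.cell q.size (some e)) q.size
  (⟨q.size + 1, r.1⟩, r.2 + 1)

/-- Remove the root, move the last cell to the root and sift it down. -/
def deleteMin (lt : E → E → Prop) [DecidableRel lt] (q : BinaryHeap E) :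
    (BinaryHeap E × Option E) × ℕ :=
  if q.size = 0 then ((q, none), 1)
  else
    let n := q.size - 1
    let a := Function.update (Function.update q.cell 0 (q.cell n)) n none
    let r := siftDown lt n a 0
    ((⟨n, r.1⟩, q.cell 0), r.2 + 1)

/-- Binary heaps as internal priority queues. -/
def pq (lt : E → E → Prop) [DecidableRel lt] : InternalPQ E where
  State := BinaryHeap E
  empty := ⟨0, fun _ => none⟩
  size := BinaryHeap.size
  insert := insert lt
  deleteMin := deleteMin lt
  findMin q := (q.cell 0, 1)

end BinaryHeap

/-! #### Van Emde Boas trees -/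

/-- A van Emde Boas tree `VEB k` over the universe `{0, …, 2 ^ 2 ^ k - 1}`. A nonempty tree stores
its minimum and its maximum. For `k = 0` these determine the set; otherwise every element `x`
except the minimum is stored as `x % 2 ^ 2 ^ (k - 1)` in the cluster with index
`x / 2 ^ 2 ^ (k - 1)`, and the summary stores the indices of the nonempty clusters. -/
inductive VEB : ℕ → Type
  | leaf (minMax : Option (ℕ × ℕ)) : VEB 0
  | node {k : ℕ} (minMax : Option (ℕ × ℕ)) (summary : VEB k) (cluster : ℕ → VEB k) : VEB (k + 1)

namespace VEB

/-- The minimum and the maximum, `none` if the tree is empty. -/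
def minMax : {k : ℕ} → VEB k → Option (ℕ × ℕ)
  | _, leaf mm => mm
  | _, node mm _ _ => mm

def empty : (k : ℕ) → VEB k
  | 0 => leaf none
  | k + 1 => node none (empty k) (fun _ => empty k)

/-- Insertion. Each recursive call costs one step (a constant number of comparisons, arithmetic
operations and memory accesses) in addition to the steps of the calls that it makes. -/
def insert : {k : ℕ} → ℕ → VEB k → VEB k × ℕ
  | _, x, leaf none => (leaf (some (x, x)), 1)
  | _, x, leaf (some (lo, hi)) => (leaf (some (min lo x, max hi x)), 1)
  | _, x, node none s c => (node (some (x, x)) s c, 1)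
  | _, x, node (k := k) (some (lo, hi)) s c =>
    if x = lo then (node (some (lo, hi)) s c, 1)
    else
      let y := max lo x
      let h := y / 2 ^ 2 ^ k
      let rc := insert (y % 2 ^ 2 ^ k) (c h)
      let rs := if (c h).minMax = none then insert h s else (s, 0)
      (node (some (min lo x, max hi x)) rs.1 (Function.update c h rc.1), rc.2 + rs.2 + 1)

/-- Removal of the minimum, with the same cost convention. -/
def deleteMin : {k : ℕ} → VEB k → VEB k × ℕ
  | _, leaf none => (leaf none, 1)
  | _, leaf (some (lo, hi)) => (leaf (if lo = hi then none else some (hi, hi)), 1)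
  | _, node none s c => (node none s c, 1)
  | _, node (k := k) (some (_, hi)) s c =>
    match s.minMax with
    | none => (node none s c, 1)
    | some (h, _) =>
      match (c h).minMax with
      | none => (node none s c, 1)
      | some (l, _) =>
        let rc := deleteMin (c h)
        let rs := if rc.1.minMax = none then deleteMin s else (s, 0)
        (node (some (h * 2 ^ 2 ^ k + l, hi)) rs.1 (Function.update c h rc.1), rc.2 + rs.2 + 1)

/-- The least `k` with `U ≤ 2 ^ 2 ^ k`. -/
def height (U : ℕ) : ℕ := Nat.clog 2 (Nat.clog 2 U)

/-- A priority queue for elements with keys in `{0, …, U - 1}`: a van Emde Boas tree that stores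
the set of keys present, and for every key the list of the stored elements with this key. -/
structure Queue (E : Type u) (U : ℕ) where
  tree : VEB (height U)
  bucket : ℕ → List E

variable {E : Type u} {U : ℕ}

def Queue.insert (key : E → Fin U) (e : E) (q : Queue E U) : Queue E U × ℕ :=
  let x : ℕ := key e
  let r := if q.bucket x = [] then VEB.insert x q.tree else (q.tree, 0)
  (⟨r.1, Function.update q.bucket x (e :: q.bucket x)⟩, r.2 + 1)

def Queue.deleteMin (q : Queue E U) : (Queue E U × Option E) × ℕ :=
  match q.tree.minMax with
  | none => ((q, none), 1)
  | some (x, _) =>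
    match q.bucket x with
    | [] => ((q, none), 1)
    | e :: l =>
      let r := if l = [] then VEB.deleteMin q.tree else (q.tree, 0)
      ((⟨r.1, Function.update q.bucket x l⟩, some e), r.2 + 1)

def Queue.findMin (q : Queue E U) : Option E × ℕ :=
  match q.tree.minMax with
  | none => (none, 1)
  | some (x, _) => ((q.bucket x).head?, 1)

/-- Van Emde Boas trees as internal priority queues, for elements with integer keys. -/
def pq (key : E → Fin U) : InternalPQ E where
  State := Queue E U
  empty := ⟨VEB.empty _, fun _ => []⟩
  size q := ∑ x ∈ Finset.range U, (q.bucket x).length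
  insert := Queue.insert key
  deleteMin := Queue.deleteMin
  findMin := Queue.findMin

end VEB

/-! ### The MultiQueue as an asynchronous shared-memory algorithm -/

namespace MultiQueue

/-- An operation that a thread invokes. -/
inductive Op (E : Type u)
  | insert (e : E)
  | delete

/-- What a thread does next within its current operation; `m` is the number of internal queues.
* `select a j best`: in attempt `a`, draw the `j`-th candidate (and, for deletions, read its
  minimum); `best` is the best candidate so far and the minimum that was read there.
* `tryLock a i`: in attempt `a`, try to lock queue `i`.
* `critical i`: holding the lock, perform the operation on queue `i`.
* `unlock i`: release the lock of queue `i`; this completes the operation. -/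
inductive Phase (E : Type u) (m : ℕ)
  | select (a j : ℕ) (best : Option (Fin m × Option E))
  | tryLock (a : ℕ) (i : Fin m)
  | critical (i : Fin m)
  | unlock (i : Fin m)

/-- The part of a phase that does not reveal the random choices of an unfinished attempt. -/
inductive PhaseView (m : ℕ)
  | select (a j : ℕ)
  | tryLock (a : ℕ)
  | critical (i : Fin m)
  | unlock (i : Fin m)

def Phase.view {E : Type u} {m : ℕ} : Phase E m → PhaseView m
  | .select a j _ => .select a j
  | .tryLock a _ => .tryLock a
  | .critical i => .critical i
  | .unlock i => .unlock i

/-- The local state of a thread: the number of completed operations, the phase of the current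
operation, and the results of its deletions (latest first, `none` for a failed deletion). -/
structure Thread (E : Type u) (m : ℕ) where
  done : ℕ
  phase : Phase E m
  out : List (Option E)

/-- A configuration of a MultiQueue with `m` internal queues that is accessed by `p` threads. -/
structure Config {E : Type u} (Q : InternalPQ E) (p m : ℕ) where
  queue : Fin m → Q.State
  locked : Fin m → Bool
  thread : Fin p → Thread E m

/-- The control state of all threads and the state of the locks, without the contents of the
queues and without the random choices of unfinished attempts. -/
structure ControlView (p m : ℕ) where
  locked : Fin m → Bool
  thread : Fin p → ℕ × PhaseView m

/-- Everything except the random choices of unfinished attempts. -/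
structure FullView {E : Type u} (Q : InternalPQ E) (p m : ℕ) where
  control : ControlView p m
  queue : Fin m → Q.State
  out : Fin p → List (Option E)

def Config.view {E : Type u} {Q : InternalPQ E} {p m : ℕ} (c : Config Q p m) :
    FullView Q p m where
  control := ⟨c.locked, fun t => ((c.thread t).done, (c.thread t).phase.view)⟩
  queue := c.queue
  out t := (c.thread t).out

/-- A MultiQueue with internal queues `Q`, the element order `lt` and `d` deletion candidates, the
sequence of operations that each thread executes, and the scheduler, which chooses the thread that
performs the next atomic step from the history (latest entry first) of the views. -/
structure System (E : Type u) (p m : ℕ) where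
  Q : InternalPQ E
  lt : E → E → Prop
  decLt : DecidableRel lt
  d : ℕ
  ops : Fin p → List (Op E)
  sched : List (FullView Q p m) → Fin p

/-- The random choices: `ω (t, k, a, j)` is the `j`-th candidate queue that thread `t` draws in
attempt `a` of its `k`-th operation. -/
abbrev Draws (p m : ℕ) : Type := Fin p × ℕ × ℕ × ℕ → Fin m

/-- All choices are independent and uniform on the `m` internal queues. -/
noncomputable def drawLaw (p m : ℕ) [NeZero m] : Measure (Draws p m) :=
  Measure.infinitePi fun _ => (PMF.uniformOfFintype (Fin m)).toMeasure

variable {E : Type u} {p m : ℕ}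

/-- The thread is about to write to the lock of queue `i`. -/
def Phase.writesLock (i : Fin m) : Phase E m → Bool
  | .tryLock _ i' => i' == i
  | .unlock i' => i' == i
  | _ => false

/-- The number of threads other than `t` with a pending write to the lock of queue `i`. -/
def contention {Q : InternalPQ E} (c : Config Q p m) (t : Fin p) (i : Fin m) : ℕ :=
  (Finset.univ.filter fun t' => t' ≠ t ∧ (c.thread t').phase.writesLock i = true).card

def Config.setThread {Q : InternalPQ E} (c : Config Q p m) (t : Fin p) (s : Thread E m) :
    Config Q p m :=
  { c with thread := Function.update c.thread t s }

def Config.setPhase {Q : InternalPQ E} (c : Config Q p m) (t : Fin p) (ph : Phase E m) :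
    Config Q p m :=
  c.setThread t { c.thread t with phase := ph }

namespace System

variable (S : System E p m)

/-- One atomic step of thread `t`, and its cost. A write to a lock (`tryLock`, `unlock`) costs one
plus the number of other threads that have a pending write to the same lock; it pays for those
present when the write is issued (at the end of the preceding step) and for those present when it
is performed. A step of a thread that has completed all its operations does nothing. -/
def step (ω : Draws p m) (t : Fin p) (c : Config S.Q p m) : Config S.Q p m × ℕ :=
  let th := c.thread t
  match (S.ops t)[th.done]? with
  | none => (c, 0)
  | some op =>
    match th.phase with
    | .select a j best =>
      let i := ω (t, th.done, a, j)
      match op with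
      | .insert _ => (c.setPhase t (.tryLock a i), 1 + contention c t i)
      | .delete =>
        let r := S.Q.findMin (c.queue i)
        let new : Fin m × Option E :=
          match best with
          | none => (i, r.1)
          | some (i', v) =>
            haveI := S.decLt
            if optLt S.lt r.1 v then (i, r.1) else (i', v)
        if j + 1 < S.d then (c.setPhase t (.select a (j + 1) (some new)), 1 + r.2)
        else (c.setPhase t (.tryLock a new.1), 1 + r.2 + contention c t new.1)
    | .tryLock a i =>
      if c.locked i = true then
        (c.setPhase t (.select (a + 1) 0 none), 1 + contention c t i)
      else
        ({ c.setPhase t (.critical i) with locked := Function.update c.locked i true },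
          1 + contention c t i)
    | .critical i =>
      match op with
      | .insert e =>
        let r := S.Q.insert e (c.queue i)
        ({ c.setPhase t (.unlock i) with queue := Function.update c.queue i r.1 },
          r.2 + contention c t i)
      | .delete =>
        let r := S.Q.deleteMin (c.queue i)
        ({ c.setThread t ⟨th.done, .unlock i, r.1.2 :: th.out⟩ with
            queue := Function.update c.queue i r.1.1 },
          r.2 + contention c t i)
    | .unlock i =>
      ({ c.setThread t ⟨th.done + 1, .select 0 0 none, th.out⟩ with
          locked := Function.update c.locked i false },
        1 + contention c t i)

/-- All internal queues are empty and unlocked, and no thread has started. -/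
def init : Config S.Q p m where
  queue _ := S.Q.empty
  locked _ := false
  thread _ := ⟨0, .select 0 0 none, []⟩

/-- The configuration after `n` steps, and the views of the configurations `n, n - 1, …, 0`. -/
def exec (ω : Draws p m) : ℕ → Config S.Q p m × List (FullView S.Q p m)
  | 0 => (S.init, [S.init.view])
  | n + 1 =>
    let r := exec ω n
    let c := (S.step ω (S.sched r.2) r.1).1
    (c, c.view :: r.2)

/-- The configuration after `n` steps. -/
def config (ω : Draws p m) (n : ℕ) : Config S.Q p m := (S.exec ω n).1

/-- The thread that performs step `n`. -/
def actor (ω : Draws p m) (n : ℕ) : Fin p := S.sched (S.exec ω n).2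

/-- The cost of step `n`. -/
def cost (ω : Draws p m) (n : ℕ) : ℕ := (S.step ω (S.actor ω n) (S.config ω n)).2

/-- Step `n` is a step of thread `t` within its `k`-th operation. -/
def StepOf (ω : Draws p m) (t : Fin p) (k n : ℕ) : Prop :=
  S.actor ω n = t ∧ ((S.config ω n).thread t).done = k

open Classical in
/-- The time that thread `t` spends on its `k`-th operation (counting from `0`). -/
noncomputable def opTime (t : Fin p) (k : ℕ) (ω : Draws p m) : ℝ≥0∞ :=
  ∑' n, if S.StepOf ω t k n then (S.cost ω n : ℝ≥0∞) else 0

/-- The number of elements in the MultiQueue. -/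
def numElements (c : Config S.Q p m) : ℕ := ∑ i, S.Q.size (c.queue i)

/-- In step `n`, the `k`-th operation of thread `t` accesses the internal queue it has locked. -/
def AccessAt (ω : Draws p m) (t : Fin p) (k n : ℕ) : Prop :=
  S.StepOf ω t k n ∧ ∃ i, ((S.config ω n).thread t).phase = .critical i

open Classical in
/-- The number of elements in the MultiQueue when the `k`-th operation of thread `t` accesses the
internal queue it has locked (`0` if this never happens). -/
noncomputable def sizeAtAccess (t : Fin p) (k : ℕ) (ω : Draws p m) : ℕ :=
  if h : ∃ n, S.AccessAt ω t k n then S.numElements (S.config ω (Nat.find h)) else 0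

end System

/-- The MultiQueue with binary heaps. -/
def heapSystem (lt : E → E → Prop) [dec : DecidableRel lt] (d : ℕ) (ops : Fin p → List (Op E))
    (sched : List (FullView (BinaryHeap.pq lt) p m) → Fin p) : System E p m :=
  ⟨BinaryHeap.pq lt, lt, dec, d, ops, sched⟩

/-- The MultiQueue with van Emde Boas trees; elements are ordered by their integer keys. -/
def vebSystem {U : ℕ} (key : E → Fin U) (d : ℕ) (ops : Fin p → List (Op E))
    (sched : List (FullView (VEB.pq key) p m) → Fin p) : System E p m :=
  ⟨VEB.pq key, fun a b => key a < key b, fun a b => inferInstanceAs (Decidable (key a < key b)),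
    d, ops, sched⟩

/-- The insertion-only operation sequences in which thread `t` performs `q t` insertions and the
`k`-th insertion of thread `t` inserts the element `x (t, k)`. -/
def insertions {q : Fin p → ℕ} (x : (Σ t, Fin (q t)) → E) (t : Fin p) : List (Op E) :=
  List.ofFn fun k => Op.insert (x ⟨t, k⟩)

end MultiQueue

/-! The expected time of an operation splits into the access to the internal queue and everything
else. The rest is bounded by a constant that depends only on `c` and `d`
(`System.lintegral_opTime_le`), whatever the internal queues do; the three claims differ only in the
bound for the access.

The source of all randomness used for the overhead is that the candidates of an attempt stay
invisible until its lock attempt is made. `System.agreeOff_config` shows that redrawing them changes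
nothing except the hidden part of the local state of that thread, and `lintegral_draw` then permits
averaging over a candidate as if it were drawn at the moment of interest. A deletion prefers queues
with small minima, so its chosen queue is not uniform; the argument only uses that it is one of the
`d` candidates, each of which is uniform.

Three estimates follow. At most `p` of the `m` queues are locked, so all `d` candidates are free
with probability at least `(1 - p/m)^d`, and the number of attempts has a geometric tail
(`System.lintegral_reach_le`). All queues together have at most `p` pending writes, so the expected
contention at one candidate is at most `p/m`, and at the chosen queue at most `d * p/m`
(`System.lintegral_att_contention_le`). For a lock that is already held the roles are exchanged: the
competing writes are lock attempts of other threads, and each of these has one of its `d` hidden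
candidates at the held queue with probability at most `d/m` (`System.lintegral_own_contention_le`).
Strict monotonicity of `viewRank` ensures that each control state of an operation is executed at
most once, which turns sums over time into sums over attempts.

For worst-case heap accesses the cost is the depth of the heap, and for van Emde Boas trees one of
two recursive calls is always trivial, which leaves one nontrivial recursion of depth `height U`.

For heap insertions in random order, the scheduler does not see the elements, so for fixed draws the
sequence of insertions into every queue is the same for all permutations. This is made precise by a
simulation with queues that merely record indices (`simulates_config`). It remains to treat one heap
that receives distinct indices in a fixed order with randomly permuted elements
(`BinaryHeap.sum_insert_cost_le`). If an element rises more than `j` levels, it beats an ancestor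
cell. By `BinaryHeap.filled_of_twoSmall` that cell would hold an element at most as large if certain
earlier blocks of `2^(j+g)` insertions each contained two such elements. So some block contains at
most one, which has probability at most `2 / (2^(j+g) + 1)` by exchangeability, and the sum over `j`
and `g` converges. -/

namespace MultiQueue

/-! ### Functions of finitely many draws, and averaging over a single draw. -/

variable {p m : ℕ}

/-- `f` depends on finitely many draws. -/
def FinDep {X : Type*} (f : Draws p m → X) : Prop :=
  ∃ s : Finset (Fin p × ℕ × ℕ × ℕ), ∀ ω ω' : Draws p m, (∀ z ∈ s, ω z = ω' z) → f ω = f ω'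

namespace FinDep

variable {X Y Z : Type*} {f : Draws p m → X} {g : Draws p m → Y}

theorem const (x : X) : FinDep (fun _ : Draws p m => x) := ⟨∅, fun _ _ _ => rfl⟩

theorem draw (z : Fin p × ℕ × ℕ × ℕ) : FinDep (fun ω : Draws p m => ω z) :=
  ⟨{z}, fun _ _ h => h z (by simp)⟩

theorem comp (hf : FinDep f) (F : X → Y) : FinDep (fun ω => F (f ω)) := by
  obtain ⟨s, hs⟩ := hf
  exact ⟨s, fun ω ω' h => congrArg F (hs ω ω' h)⟩

theorem comp₂ (hf : FinDep f) (hg : FinDep g) (F : X → Y → Z) :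
    FinDep (fun ω => F (f ω) (g ω)) := by
  classical
  obtain ⟨s, hs⟩ := hf
  obtain ⟨s', hs'⟩ := hg
  refine ⟨s ∪ s', fun ω ω' h => ?_⟩
  simp only
  rw [hs ω ω' fun z hz => h z (by simp [hz]), hs' ω ω' fun z hz => h z (by simp [hz])]

theorem finite_range [NeZero m] (hf : FinDep f) : (Set.range f).Finite := by
  obtain ⟨s, hs⟩ := hf
  classical
  have : Set.range f ⊆ Set.range fun r : s → Fin m =>
      f fun z => if h : z ∈ s then r ⟨z, h⟩ else 0 := by
    rintro _ ⟨ω, rfl⟩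
    exact ⟨fun z => ω z, hs _ _ fun z hz => by simp [hz]⟩
  exact (Set.finite_range _).subset this

/-- Whatever depends on finitely many draws once the value of `f` is given depends on finitely many
draws, since `f` takes finitely many values. -/
theorem bind [NeZero m] (hf : FinDep f) {F : X → Draws p m → Y} (hF : ∀ x, FinDep (F x)) :
    FinDep (fun ω => F (f ω) ω) := by
  classical
  have hfin := hf.finite_range
  obtain ⟨s, hs⟩ := hf
  choose s' hs' using hF
  refine ⟨s ∪ hfin.toFinset.biUnion s', fun ω ω' h => ?_⟩
  have h1 : f ω = f ω' := hs ω ω' fun z hz => h z (by simp [hz])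
  simp only
  rw [← h1]
  refine hs' _ _ _ fun z hz => h z ?_
  simp only [Finset.mem_union, Finset.mem_biUnion, Set.Finite.mem_toFinset, Set.mem_range]
  exact Or.inr ⟨f ω, ⟨ω, rfl⟩, hz⟩

theorem measurable [NeZero m] [MeasurableSpace X] (hf : FinDep f) : Measurable f := by
  classical
  obtain ⟨s, hs⟩ := hf
  have : f = (fun r : s → Fin m => f fun z => if h : z ∈ s then r ⟨z, h⟩ else 0) ∘
      (fun ω (z : s) => ω z) := by
    funext ω
    exact hs _ _ fun z hz => by simp [hz]
  rw [this]
  refine Measurable.comp (measurable_of_finite _) ?_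
  exact measurable_pi_lambda _ fun z => measurable_pi_apply _

end FinDep

instance [NeZero m] : IsProbabilityMeasure (drawLaw p m) := by
  unfold drawLaw; infer_instance

theorem map_add_uniform [NeZero m] (s : Fin m) :
    ((PMF.uniformOfFintype (Fin m)).toMeasure).map (· + s)
      = (PMF.uniformOfFintype (Fin m)).toMeasure := by
  classical
  ext t ht
  rw [Measure.map_apply (measurable_of_finite _) ht,
    PMF.toMeasure_uniformOfFintype_apply _ (Set.toFinite _).measurableSet,
    PMF.toMeasure_uniformOfFintype_apply _ ht]
  congr 2
  exact Fintype.card_congr ((Equiv.addRight s).subtypeEquiv fun a => by simp)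

/-- Translation preserves the uniform law of one factor. This invariance takes the place of
conditioning on all other draws. -/
theorem map_shift_drawLaw [NeZero m] (z : Fin p × ℕ × ℕ × ℕ) (s : Fin m) :
    (drawLaw p m).map (fun ω => Function.update ω z (ω z + s)) = drawLaw p m := by
  classical
  unfold drawLaw
  have h := Measure.infinitePi_map_pi
    (μ := fun _ : Fin p × ℕ × ℕ × ℕ => (PMF.uniformOfFintype (Fin m)).toMeasure)
    (f := fun y x => if y = z then x + s else x)
    (fun _ => measurable_of_finite _)
  have e : (fun (ω : Draws p m) (y : Fin p × ℕ × ℕ × ℕ) => if y = z then ω y + s else ω y)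
      = fun ω => Function.update ω z (ω z + s) := by
    funext ω y
    by_cases hy : y = z
    · subst hy; simp
    · simp [hy]
  rw [e] at h
  rw [h]
  congr 1
  funext y
  by_cases hy : y = z
  · simp only [hy, if_true]; exact map_add_uniform s
  · simp only [hy, if_false]; exact Measure.map_id

/-- Averaging over a draw that the integrand does not otherwise depend on. -/
theorem lintegral_draw [NeZero m] (z : Fin p × ℕ × ℕ × ℕ) (F : Fin m → Draws p m → ℝ≥0∞)
    (hF : ∀ i, Measurable (F i)) (hinv : ∀ i i' ω, F i (Function.update ω z i') = F i ω) :
    ∫⁻ ω, F (ω z) ω ∂(drawLaw p m)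
      = ∫⁻ ω, (m : ℝ≥0∞)⁻¹ * ∑ i, F i ω ∂(drawLaw p m) := by
  classical
  have hm : (m : ℝ≥0∞) ≠ 0 := by exact_mod_cast NeZero.ne m
  have hg : Measurable fun ω : Draws p m => F (ω z) ω := by
    have : (fun ω : Draws p m => F (ω z) ω)
        = fun ω => ∑ i, if ω z = i then F i ω else 0 := by
      funext ω; simp
    rw [this]
    refine Finset.measurable_sum _ fun i _ => ?_
    exact Measurable.ite ((measurable_pi_apply (X := fun _ => Fin m) z)
      (measurableSet_singleton i)) (hF i) measurable_const
  have hs (s : Fin m) : Measurable fun ω : Draws p m => Function.update ω z (ω z + s) := by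
    refine measurable_pi_lambda _ fun y => ?_
    by_cases hy : y = z
    · subst hy
      simp only [Function.update_self]
      exact (measurable_of_finite (· + s)).comp (measurable_pi_apply y)
    · simp only [Function.update_of_ne hy]
      exact measurable_pi_apply y
  -- The translation by `s` leaves every `F i` unchanged and moves only the index. Summing over all
  -- `s` lets the index run through all queues.
  have key (s : Fin m) : ∫⁻ ω, F (ω z + s) ω ∂(drawLaw p m)
      = ∫⁻ ω, F (ω z) ω ∂(drawLaw p m) := by
    conv_rhs => rw [← map_shift_drawLaw z s, lintegral_map hg (hs s)]
    simp [hinv]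
  have hms (s : Fin m) : Measurable fun ω : Draws p m => F (ω z + s) ω := by
    have := hg.comp (hs s)
    convert this using 2 with ω
    simp [hinv]
  have h1 : ∑ s : Fin m, ∫⁻ ω, F (ω z + s) ω ∂(drawLaw p m)
      = m * ∫⁻ ω, F (ω z) ω ∂(drawLaw p m) := by simp [key]
  have h2 : ∑ s : Fin m, ∫⁻ ω, F (ω z + s) ω ∂(drawLaw p m)
      = ∫⁻ ω, ∑ i, F i ω ∂(drawLaw p m) := by
    rw [← lintegral_finsetSum _ fun s _ => hms s]
    refine lintegral_congr fun ω => ?_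
    exact Equiv.sum_comp (Equiv.addLeft (ω z)) fun i => F i ω
  rw [lintegral_const_mul _ (Finset.measurable_sum _ fun i _ => hF i), ← h2, h1, ← mul_assoc,
    ENNReal.inv_mul_cancel hm (by simp), one_mul]

end MultiQueue

/-! ### Progress of a thread, and independence of the visible execution from hidden choices. -/

namespace MultiQueue

variable {E : Type u} {p m : ℕ}

/-- The progress of a thread: completed operations, stage within the operation, attempt and
candidate. -/
def viewRank : ℕ × PhaseView m → ℕ ×ₗ ℕ ×ₗ ℕ ×ₗ ℕ
  | (k, .select a j) => toLex (k, toLex (0, toLex (2 * a, j)))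
  | (k, .tryLock a) => toLex (k, toLex (0, toLex (2 * a + 1, 0)))
  | (k, .critical _) => toLex (k, toLex (1, toLex (0, 0)))
  | (k, .unlock _) => toLex (k, toLex (2, toLex (0, 0)))

def Thread.view (th : Thread E m) : ℕ × PhaseView m := (th.done, th.phase.view)

namespace System

variable (S : System E p m)

theorem config_succ (ω : Draws p m) (n : ℕ) :
    S.config ω (n + 1) = (S.step ω (S.actor ω n) (S.config ω n)).1 := rfl

theorem step_of_none {ω : Draws p m} {t : Fin p} {c : Config S.Q p m}
    (h : (S.ops t)[(c.thread t).done]? = none) : S.step ω t c = (c, 0) := by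
  unfold step
  simp only [h]

theorem step_thread_of_ne {ω : Draws p m} {t t' : Fin p} (h : t' ≠ t) (c : Config S.Q p m) :
    (S.step ω t c).1.thread t' = c.thread t' := by
  unfold step
  simp only
  repeat' split
  all_goals simp [Config.setPhase, Config.setThread, Function.update_of_ne h]

/-- Attempt `a` occupies the values `2 * a` (selection) and `2 * a + 1` (lock attempt), and a
failure leads to `2 * (a + 1)`; success, access and completion raise an earlier coordinate. -/
theorem viewRank_lt_step {ω : Draws p m} {t : Fin p} {c : Config S.Q p m}
    (h : (S.ops t)[(c.thread t).done]? ≠ none) :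
    viewRank (c.thread t).view < viewRank ((S.step ω t c).1.thread t).view := by
  unfold step Thread.view
  simp only
  split
  · exact absurd ‹_› h
  · rename_i op _
    cases hph : (c.thread t).phase <;> cases op <;> simp only
    all_goals repeat' split
    all_goals simp [Config.setPhase, Config.setThread, Phase.view, viewRank,
      Prod.Lex.toLex_lt_toLex]
    all_goals omega

theorem viewRank_le_step {ω : Draws p m} (t t' : Fin p) (c : Config S.Q p m) :
    viewRank (c.thread t').view ≤ viewRank ((S.step ω t c).1.thread t').view := by
  by_cases ht : t' = t
  · subst ht
    by_cases h : (S.ops t')[(c.thread t').done]? = none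
    · rw [S.step_of_none h]
    · exact (S.viewRank_lt_step h).le
  · rw [S.step_thread_of_ne ht]

theorem viewRank_mono (ω : Draws p m) (t : Fin p) :
    Monotone fun n => viewRank ((S.config ω n).thread t).view :=
  monotone_nat_of_le_succ fun n => by
    rw [config_succ]
    exact S.viewRank_le_step _ _ _

/-- Thread `t` executes a step of its `k`-th operation at time `n`. -/
def Active (ω : Draws p m) (t : Fin p) (k n : ℕ) : Prop :=
  S.StepOf ω t k n ∧ (S.ops t)[k]? ≠ none

/-- The rank never decreases and strictly increases at every active step. Hence sums over time of
indicators of a fixed control state are at most one. -/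
theorem active_unique {ω : Draws p m} {t : Fin p} {k n n' : ℕ} (h : S.Active ω t k n)
    (h' : S.Active ω t k n')
    (hv : viewRank ((S.config ω n).thread t).view = viewRank ((S.config ω n').thread t).view) :
    n = n' := by
  wlog hlt : n < n' generalizing n n'
  · rcases lt_trichotomy n n' with h1 | h1 | h1
    · exact absurd h1 hlt
    · exact h1
    · exact (this h' h hv.symm h1).symm
  exfalso
  have h1 : viewRank ((S.config ω n).thread t).view
      < viewRank ((S.config ω (n + 1)).thread t).view := by
    rw [config_succ, h.1.1]
    exact S.viewRank_lt_step (by rw [h.1.2]; exact h.2)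
  exact absurd hv (h1.trans_le (S.viewRank_mono ω t hlt)).ne

theorem cost_eq_zero {ω : Draws p m} {t : Fin p} {k n : ℕ} (h : S.StepOf ω t k n)
    (h' : ¬ S.Active ω t k n) : S.cost ω n = 0 := by
  have : (S.ops t)[k]? = none := by
    by_contra h2
    exact h' ⟨h, h2⟩
  unfold cost
  rw [h.1, S.step_of_none (by rw [h.2]; exact this)]

/-! ### Dependence on the draws -/

/-- A step reads at most one draw, at an index fixed by the preceding execution, and that execution
takes only finitely many values. -/
theorem finDep_exec [NeZero m] (n : ℕ) : FinDep fun ω : Draws p m => S.exec ω n := by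
  induction n with
  | zero => exact FinDep.const _
  | succ n ih =>
    refine FinDep.bind (F := fun (r : Config S.Q p m × List (FullView S.Q p m)) ω =>
      ((S.step ω (S.sched r.2) r.1).1, (S.step ω (S.sched r.2) r.1).1.view :: r.2)) ih
      fun r => ?_
    refine FinDep.comp (f := fun ω => (S.step ω (S.sched r.2) r.1).1) ?_
      (fun c => (c, c.view :: r.2))
    cases hph : (r.1.thread (S.sched r.2)).phase with
    | select a j b =>
      refine ⟨{(S.sched r.2, (r.1.thread (S.sched r.2)).done, a, j)}, fun ω ω' h => ?_⟩
      simp only [Finset.mem_singleton, forall_eq] at h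
      simp only [step, hph]
      rw [h]
    | _ => exact ⟨∅, fun ω ω' h => by simp only [step, hph]⟩

theorem finDep_exec_comp [NeZero m] {X : Type*} (n : ℕ)
    (F : Config S.Q p m × List (FullView S.Q p m) → X) :
    FinDep fun ω : Draws p m => F (S.exec ω n) := (S.finDep_exec n).comp F

/-- Attempt `a` of the `k`-th operation is under way. -/
def Attempting (k a : ℕ) (v : ℕ × PhaseView m) : Prop :=
  v.1 = k ∧ ((∃ j, v.2 = .select a j) ∨ v.2 = .tryLock a)

/-- The configurations agree except for the hidden choices of attempt `a` of the `k`-th operation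
of thread `t`. -/
structure AgreeOff (t : Fin p) (k a : ℕ) (c c' : Config S.Q p m) : Prop where
  queue : c.queue = c'.queue
  locked : c.locked = c'.locked
  thread : ∀ t', t' ≠ t → c.thread t' = c'.thread t'
  out : (c.thread t).out = (c'.thread t).out
  view : (c.thread t).view = (c'.thread t).view
  self : ¬ Attempting k a (c.thread t).view → c.thread t = c'.thread t

-- The scheduler sees only views, so it cannot distinguish the two configurations and acts alike on
-- both.
variable {S} in
theorem AgreeOff.view_eq {t : Fin p} {k a : ℕ} {c c' : Config S.Q p m}
    (h : S.AgreeOff t k a c c') : c.view = c'.view := by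
  unfold Config.view
  rw [h.queue, h.locked]
  congr 1
  · congr 1
    funext t'
    by_cases ht : t' = t
    · subst ht; exact h.view
    · rw [h.thread t' ht]
  · funext t'
    by_cases ht : t' = t
    · subst ht; exact h.out
    · rw [h.thread t' ht]

/-- The effect of a step of thread `t` with local state `th` on the queues, the locks and its
local state. -/
def localStep (ω : Draws p m) (t : Fin p) (queue : Fin m → S.Q.State) (locked : Fin m → Bool)
    (th : Thread E m) : (Fin m → S.Q.State) × (Fin m → Bool) × Thread E m :=
  match (S.ops t)[th.done]? with
  | none => (queue, locked, th)
  | some op =>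
    match th.phase with
    | .select a j best =>
      let i := ω (t, th.done, a, j)
      match op with
      | .insert _ => (queue, locked, { th with phase := .tryLock a i })
      | .delete =>
        let r := S.Q.findMin (queue i)
        let new : Fin m × Option E :=
          match best with
          | none => (i, r.1)
          | some (i', v) =>
            haveI := S.decLt
            if optLt S.lt r.1 v then (i, r.1) else (i', v)
        if j + 1 < S.d then (queue, locked, { th with phase := .select a (j + 1) (some new) })
        else (queue, locked, { th with phase := .tryLock a new.1 })
    | .tryLock a i =>
      if locked i = true then (queue, locked, { th with phase := .select (a + 1) 0 none })
      else (queue, Function.update locked i true, { th with phase := .critical i })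
    | .critical i =>
      match op with
      | .insert e =>
        (Function.update queue i (S.Q.insert e (queue i)).1, locked, { th with phase := .unlock i })
      | .delete =>
        (Function.update queue i (S.Q.deleteMin (queue i)).1.1, locked,
          ⟨th.done, .unlock i, (S.Q.deleteMin (queue i)).1.2 :: th.out⟩)
    | .unlock i =>
      (queue, Function.update locked i false, ⟨th.done + 1, .select 0 0 none, th.out⟩)

/-- The form used for comparing executions: a step reads the queues, the locks and the local state
of its own thread, but not the other threads. -/
theorem step_fst (ω : Draws p m) (t : Fin p) (c : Config S.Q p m) :
    (S.step ω t c).1 =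
      { queue := (S.localStep ω t c.queue c.locked (c.thread t)).1
        locked := (S.localStep ω t c.queue c.locked (c.thread t)).2.1
        thread := Function.update c.thread t
          (S.localStep ω t c.queue c.locked (c.thread t)).2.2 } := by
  unfold step localStep
  simp only
  split
  · simp
  · rename_i op h
    cases hph : (c.thread t).phase <;> cases op <;> simp only
    all_goals repeat' split
    all_goals simp_all [Config.setPhase, Config.setThread]

/-- Only a selection step reads a draw, and this draw belongs to the attempt under way. -/
theorem localStep_congr {ω ω' : Draws p m} {t : Fin p} {k a : ℕ}
    (hω : ∀ z, (∀ j, z ≠ (t, k, a, j)) → ω z = ω' z) {th : Thread E m} {s : Fin p}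
    (h : s ≠ t ∨ ¬ Attempting k a th.view) (queue : Fin m → S.Q.State) (locked : Fin m → Bool) :
    S.localStep ω s queue locked th = S.localStep ω' s queue locked th := by
  cases hph : th.phase with
  | select a' j b =>
    have : ω (s, th.done, a', j) = ω' (s, th.done, a', j) := by
      refine hω _ fun j' hj => ?_
      simp only [Prod.mk.injEq] at hj
      rcases h with h | h
      · exact h hj.1
      · exact h ⟨hj.2.1, Or.inl ⟨j, by simp [Thread.view, hph, Phase.view, hj.2.2.1]⟩⟩
    simp only [localStep, hph]
    rw [this]
  | _ => simp only [localStep, hph]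

/-- Selection steps alter nothing but the thread's own phase, so differing draws and differing best
candidates remain hidden. The rank bound excludes the lock attempt, which reveals the choice. -/
theorem AgreeOff.step {ω ω' : Draws p m} {t : Fin p} {k a : ℕ}
    (hω : ∀ z, (∀ j, z ≠ (t, k, a, j)) → ω z = ω' z) {c c' : Config S.Q p m}
    (h : S.AgreeOff t k a c c') (s : Fin p)
    (hr : viewRank ((S.step ω s c).1.thread t).view ≤ viewRank (k, (.tryLock a : PhaseView m))) :
    S.AgreeOff t k a (S.step ω s c).1 (S.step ω' s c').1 := by
  -- Either the acting thread has the same local state on both sides and reads no redrawn candidate,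
  -- or it is `t` within the attempt.
  by_cases hloc : c.thread s = c'.thread s ∧ (s ≠ t ∨ ¬ Attempting k a (c.thread s).view)
  · have e : S.localStep ω s c.queue c.locked (c.thread s)
        = S.localStep ω' s c'.queue c'.locked (c'.thread s) := by
      rw [S.localStep_congr hω hloc.2, h.queue, h.locked, hloc.1]
    rw [step_fst, step_fst, ← e]
    set r := S.localStep ω s c.queue c.locked (c.thread s)
    have hth : ∀ t', c.thread t' = c'.thread t' →
        Function.update c.thread s r.2.2 t' = Function.update c'.thread s r.2.2 t' := by
      intro t' ht
      by_cases hs : t' = s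
      · subst hs; simp
      · simp [Function.update_of_ne hs, ht]
    by_cases hs : s = t
    · subst hs
      exact ⟨rfl, rfl, fun t' ht => hth t' (h.thread t' ht), by simp, by simp, by simp⟩
    · have hs' : t ≠ s := Ne.symm hs
      exact ⟨rfl, rfl, fun t' ht => hth t' (h.thread t' ht),
        by simpa [Function.update_of_ne hs'] using h.out,
        by simpa [Function.update_of_ne hs'] using h.view,
        by simpa [Function.update_of_ne hs'] using h.self⟩
  · have hs : s = t := by
      by_contra hs
      exact hloc ⟨h.thread s hs, Or.inl hs⟩
    subst hs
    have hA : Attempting k a (c.thread s).view := by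
      by_contra hA
      exact hloc ⟨h.self hA, Or.inr hA⟩
    have hdone : (c.thread s).done = (c'.thread s).done := congrArg Prod.fst h.view
    have hview : (c.thread s).phase.view = (c'.thread s).phase.view := congrArg Prod.snd h.view
    by_cases hop : (S.ops s)[(c.thread s).done]? = none
    · rw [S.step_of_none hop, S.step_of_none (by rw [← hdone]; exact hop)]
      exact h
    obtain ⟨hk, ⟨j, hj⟩ | hj⟩ := hA
    · have hk' : (c.thread s).done = k := hk
      have hj' : (c.thread s).phase.view = .select a j := hj
      cases hph : (c.thread s).phase <;> simp only [hph, Phase.view, reduceCtorEq] at hj'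
      rename_i a1 j1 b1
      rw [hph] at hview
      cases hph' : (c'.thread s).phase <;> simp only [hph', Phase.view, reduceCtorEq] at hview
      rename_i a2 j2 b2
      simp only [PhaseView.select.injEq] at hj' hview
      obtain ⟨rfl, rfl⟩ := hj'
      obtain ⟨rfl, rfl⟩ := hview
      obtain ⟨op, hop'⟩ := Option.ne_none_iff_exists'.1 hop
      have hop2 := hop'
      rw [hdone] at hop2
      rw [step_fst, step_fst]
      have hout := h.out
      have hth := h.thread
      cases op with
      | insert e =>
        simp only [localStep, hop', hop2, hph, hph']
        refine ⟨h.queue, h.locked, fun t' ht => ?_, ?_, ?_, ?_⟩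
        · simpa [Function.update_of_ne ht] using hth t' ht
        · simpa using hout
        · simpa [Thread.view, Phase.view] using hdone
        · simp [Thread.view, Phase.view, Attempting, hk']
      | delete =>
        simp only [localStep, hop', hop2, hph, hph']
        by_cases hjd : j1 + 1 < S.d
        all_goals simp only [hjd, if_true, if_false]
        all_goals refine ⟨h.queue, h.locked, fun t' ht => ?_, ?_, ?_, ?_⟩
        all_goals first
          | simpa [Function.update_of_ne ht] using hth t' ht
          | simpa using hout
          | simpa [Thread.view, Phase.view] using hdone
          | simp [Thread.view, Phase.view, Attempting, hk']
    -- Performing the lock attempt would raise the rank above the bound.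
    · exfalso
      have h1 := S.viewRank_lt_step (ω := ω) hop
      have : (c.thread s).view = (k, .tryLock a) := Prod.ext hk hj
      rw [this] at h1
      exact absurd hr (not_le.2 h1)

/-- Equal histories give equal actors, so the relation is inherited from step to step up to the lock
attempt. The histories are carried through the induction for this reason. -/
theorem agreeOff_config {ω ω' : Draws p m} {t : Fin p} {k a : ℕ}
    (hω : ∀ z, (∀ j, z ≠ (t, k, a, j)) → ω z = ω' z) (n : ℕ)
    (hr : viewRank ((S.config ω n).thread t).view ≤ viewRank (k, (.tryLock a : PhaseView m))) :
    S.AgreeOff t k a (S.config ω n) (S.config ω' n) ∧ (S.exec ω n).2 = (S.exec ω' n).2 := by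
  induction n with
  | zero => exact ⟨⟨rfl, rfl, fun _ _ => rfl, rfl, rfl, fun _ => rfl⟩, rfl⟩
  | succ n ih =>
    obtain ⟨h1, h2⟩ := ih ((S.viewRank_mono ω t n.le_succ).trans hr)
    have h3 : S.actor ω n = S.actor ω' n := congrArg S.sched h2
    have h4 : S.AgreeOff t k a (S.config ω (n + 1)) (S.config ω' (n + 1)) := by
      rw [config_succ] at hr ⊢
      rw [config_succ, ← h3]
      exact AgreeOff.step S hω h1 _ hr
    refine ⟨h4, ?_⟩
    change (S.config ω (n + 1)).view :: (S.exec ω n).2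
      = (S.config ω' (n + 1)).view :: (S.exec ω' n).2
    rw [h4.view_eq, h2]

/-- A quantity that is determined by the history and by the configuration up to the hidden choices
of an attempt does not change when these choices are drawn again before the lock attempt. -/
theorem update_congr {X : Type*} {t : Fin p} {k a n : ℕ}
    (F : Config S.Q p m → List (FullView S.Q p m) → X) (x : X)
    (hF : ∀ c c' h, S.AgreeOff t k a c c' → F c h = F c' h)
    (hx : ∀ c h, viewRank (k, (.tryLock a : PhaseView m)) < viewRank (c.thread t).view →
      F c h = x) (ω : Draws p m) (j : ℕ) (i : Fin m) :
    F (S.config (Function.update ω (t, k, a, j) i) n)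
      (S.exec (Function.update ω (t, k, a, j) i) n).2 = F (S.config ω n) (S.exec ω n).2 := by
  set ω' := Function.update ω (t, k, a, j) i with hω'
  have hω : ∀ z, (∀ j, z ≠ (t, k, a, j)) → ω z = ω' z := fun z hz => by
    rw [hω', Function.update_of_ne (hz j)]
  by_cases h1 : viewRank ((S.config ω n).thread t).view ≤ viewRank (k, (.tryLock a : PhaseView m))
  · obtain ⟨h2, h3⟩ := S.agreeOff_config hω n h1
    rw [← h3]
    exact (hF _ _ _ h2).symm
  by_cases h1' : viewRank ((S.config ω' n).thread t).view
      ≤ viewRank (k, (.tryLock a : PhaseView m))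
  · obtain ⟨h2, h3⟩ := S.agreeOff_config (fun z hz => (hω z hz).symm) n h1'
    rw [← h3]
    exact hF _ _ _ h2
  -- Both executions are past the lock attempt, where `F` takes its default value.
  rw [hx _ _ (not_le.1 h1), hx _ _ (not_le.1 h1')]

end System

end MultiQueue

/-! ### Lock invariant, candidates, and the cost of single steps. -/

namespace MultiQueue

variable {E : Type u} {p m : ℕ}

/-- The thread holds the lock of queue `i`. -/
def Phase.Holds (i : Fin m) : Phase E m → Prop
  | .critical i' => i' = i
  | .unlock i' => i' = i
  | _ => False

namespace System

variable (S : System E p m)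

/-- Every locked queue is held by exactly one thread. -/
structure LockInv (c : Config S.Q p m) : Prop where
  locked : ∀ t i, (c.thread t).phase.Holds i → c.locked i = true
  unique : ∀ t t' i, (c.thread t).phase.Holds i → (c.thread t').phase.Holds i → t = t'
  holder : ∀ i, c.locked i = true → ∃ t, (c.thread t).phase.Holds i

/-- A step of a thread that does not change locks and held queues preserves the lock invariant. -/
theorem LockInv.congr {c c' : Config S.Q p m} (h : S.LockInv c) (hl : c'.locked = c.locked)
    (hh : ∀ t i, (c'.thread t).phase.Holds i ↔ (c.thread t).phase.Holds i) : S.LockInv c' := by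
  refine ⟨fun t i => ?_, fun t t' i => ?_, fun i => ?_⟩
  · rw [hh, hl]; exact h.locked t i
  · rw [hh, hh]; exact h.unique t t' i
  · simp only [hh, hl]; exact h.holder i

theorem lockInv_step (ω : Draws p m) (s : Fin p) {c : Config S.Q p m} (h : S.LockInv c) :
    S.LockInv (S.step ω s c).1 := by
  by_cases hop : (S.ops s)[(c.thread s).done]? = none
  · rw [S.step_of_none hop]; exact h
  obtain ⟨op, hop⟩ := Option.ne_none_iff_exists'.1 hop
  have hsame : ∀ th : Thread E m, (∀ i, th.phase.Holds i ↔ (c.thread s).phase.Holds i) →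
      ∀ t i, (Function.update c.thread s th t).phase.Holds i ↔ (c.thread t).phase.Holds i := by
    intro th hth t i
    by_cases ht : t = s
    · subst ht; simpa using hth i
    · simp [Function.update_of_ne ht]
  rw [step_fst]
  cases hph : (c.thread s).phase with
  | select a j b =>
    cases op <;> simp only [localStep, hop, hph]
    · exact h.congr S rfl (hsame _ fun i => by simp [Phase.Holds, hph])
    · split
      · exact h.congr S rfl (hsame _ fun i => by simp [Phase.Holds, hph])
      · exact h.congr S rfl (hsame _ fun i => by simp [Phase.Holds, hph])
  | tryLock a i0 =>
    simp only [localStep, hop, hph]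
    split
    · exact h.congr S rfl (hsame _ fun i => by simp [Phase.Holds, hph])
    · rename_i hl
      have hno : ∀ t, ¬ (c.thread t).phase.Holds i0 := fun t ht => hl (h.locked t i0 ht)
      refine ⟨fun t i hi => ?_, fun t t' i hi hi' => ?_, fun i hi => ?_⟩
      · by_cases ht : t = s
        · subst ht
          have : i0 = i := by simpa [Phase.Holds] using hi
          simp [this]
        · simp only [Function.update_of_ne ht] at hi
          by_cases hii : i = i0
          · subst hii; simp
          · simpa [Function.update_of_ne hii] using h.locked t i hi
      · by_cases ht : t = s <;> by_cases ht' : t' = s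
        · rw [ht, ht']
        · subst ht
          have : i0 = i := by simpa [Phase.Holds] using hi
          subst this
          simp only [Function.update_of_ne ht'] at hi'
          exact absurd hi' (hno t')
        · subst ht'
          have : i0 = i := by simpa [Phase.Holds] using hi'
          subst this
          simp only [Function.update_of_ne ht] at hi
          exact absurd hi (hno t)
        · simp only [Function.update_of_ne ht, Function.update_of_ne ht'] at hi hi'
          exact h.unique t t' i hi hi'
      · by_cases hii : i = i0
        · exact ⟨s, by simp [Phase.Holds, hii]⟩
        · simp only [Function.update_of_ne hii] at hi
          obtain ⟨t, ht⟩ := h.holder i hi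
          have hts : t ≠ s := by
            rintro rfl
            rw [hph] at ht
            exact ht
          exact ⟨t, by simpa [Function.update_of_ne hts] using ht⟩
  | critical i0 =>
    cases op <;> simp only [localStep, hop, hph]
    · exact h.congr S rfl (hsame _ fun i => by simp [Phase.Holds, hph])
    · exact h.congr S rfl (hsame _ fun i => by simp [Phase.Holds, hph])
  | unlock i0 =>
    simp only [localStep, hop, hph]
    have hs : (c.thread s).phase.Holds i0 := by rw [hph]; rfl
    refine ⟨fun t i hi => ?_, fun t t' i hi hi' => ?_, fun i hi => ?_⟩
    · by_cases ht : t = s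
      · subst ht; simp [Phase.Holds] at hi
      · simp only [Function.update_of_ne ht] at hi
        have hii : i ≠ i0 := by
          rintro rfl
          exact ht (h.unique t s i hi hs)
        simpa [Function.update_of_ne hii] using h.locked t i hi
    · by_cases ht : t = s
      · subst ht; simp [Phase.Holds] at hi
      by_cases ht' : t' = s
      · subst ht'; simp [Phase.Holds] at hi'
      simp only [Function.update_of_ne ht, Function.update_of_ne ht'] at hi hi'
      exact h.unique t t' i hi hi'
    · by_cases hii : i = i0
      · subst hii; simp at hi
      · simp only [Function.update_of_ne hii] at hi
        obtain ⟨t, ht⟩ := h.holder i hi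
        have hts : t ≠ s := by
          rintro rfl
          rw [hph] at ht
          exact hii ht.symm
        exact ⟨t, by simpa [Function.update_of_ne hts] using ht⟩

theorem lockInv_config (ω : Draws p m) (n : ℕ) : S.LockInv (S.config ω n) := by
  induction n with
  | zero => exact ⟨fun _ _ h => h.elim, fun _ _ _ h => h.elim, fun i h => by cases h⟩
  | succ n ih => rw [config_succ]; exact S.lockInv_step ω _ ih

/-- A thread holds at most one lock, so sending a locked queue to its holder is injective. -/
theorem card_locked_le {c : Config S.Q p m} (h : S.LockInv c) :
    (Finset.univ.filter fun i => c.locked i = true).card ≤ p := by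
  classical
  rcases isEmpty_or_nonempty (Fin p) with hp | hp
  · rw [Finset.filter_eq_empty_iff.2 fun i _ hi => ?_]
    · simp
    · exact hp.elim (h.holder i hi).choose
  choose! f hf using h.holder
  calc _ ≤ (Finset.univ : Finset (Fin p)).card := by
        refine Finset.card_le_card_of_injOn f (fun _ _ => Finset.mem_univ _) ?_
        intro i hi i' hi' e
        have h1 := hf i (by simpa using hi)
        have h2 := hf i' (by simpa using hi')
        rw [e] at h1
        cases hph : (c.thread (f i')).phase <;> rw [hph] at h1 h2 <;>
          simp only [Phase.Holds] at h1 h2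
        · exact h1.symm.trans h2
        · exact h1.symm.trans h2
    _ = p := by simp

/-- The queue that a thread chooses is one of its candidates. -/
def Candidates (ω : Draws p m) (t : Fin p) (th : Thread E m) : Prop :=
  match th.phase with
  | .select a j b => j < S.d ∧ ∀ r, b = some r → ∃ j' < S.d, r.1 = ω (t, th.done, a, j')
  | .tryLock a i => ∃ j' < S.d, i = ω (t, th.done, a, j')
  | _ => True

/-- The choice among the candidates depends on queue contents and is biased. Membership among the
candidates is all that is retained of it, and this suffices for union bounds. -/
theorem candidates_config (hd : 0 < S.d) (ω : Draws p m) (n : ℕ) (t : Fin p) :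
    S.Candidates ω t ((S.config ω n).thread t) := by
  induction n with
  | zero => exact ⟨hd, fun r h => by cases h⟩
  | succ n ih =>
    rw [config_succ]
    set c := S.config ω n
    by_cases ht : t = S.actor ω n
    swap
    · rw [S.step_thread_of_ne ht]; exact ih
    rw [← ht]
    by_cases hop : (S.ops t)[(c.thread t).done]? = none
    · rw [S.step_of_none hop]; exact ih
    obtain ⟨op, hop⟩ := Option.ne_none_iff_exists'.1 hop
    rw [step_fst]
    simp only [Function.update_self]
    cases hph : (c.thread t).phase with
    | select a j b =>
      unfold Candidates at ih
      rw [hph] at ih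
      cases op with
      | insert e =>
        simp only [localStep, hop, hph]
        exact ⟨j, ih.1, rfl⟩
      | delete =>
        simp only [localStep, hop, hph]
        split
        · refine ⟨by assumption, fun r hr => ?_⟩
          simp only [Option.some.injEq] at hr
          rw [← hr]
          split
          · exact ⟨j, ih.1, rfl⟩
          · split
            · exact ⟨j, ih.1, rfl⟩
            · exact ih.2 _ rfl
        · simp only [Candidates]
          split
          · exact ⟨j, ih.1, rfl⟩
          · split
            · exact ⟨j, ih.1, rfl⟩
            · exact ih.2 _ rfl
    | tryLock a i =>
      simp only [localStep, hop, hph]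
      split
      · exact ⟨hd, fun r h => by cases h⟩
      · trivial
    | critical i => cases op <;> simp only [localStep, hop, hph] <;> trivial
    | unlock i =>
      simp only [localStep, hop, hph]
      exact ⟨hd, fun r h => by cases h⟩

/-- The number of steps that thread `t` spends within the internal queue if it performs the next
step. -/
def queueCost (c : Config S.Q p m) (t : Fin p) : ℕ :=
  match (S.ops t)[(c.thread t).done]?, (c.thread t).phase with
  | some (.insert e), .critical i => (S.Q.insert e (c.queue i)).2
  | some .delete, .critical i => (S.Q.deleteMin (c.queue i)).2
  | _, _ => 0

/-- The contention at the lock that thread `t` holds. -/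
def heldContention (c : Config S.Q p m) (t : Fin p) : ℕ :=
  match (c.thread t).phase with
  | .critical i => contention c t i
  | .unlock i => contention c t i
  | _ => 0

/-- The sum over all candidates dominates the contention at the chosen one without reference to the
minima that were read. Candidates not yet drawn may be included as well. -/
theorem cost_le_of_attempting (hd : 0 < S.d) (hQ : ∀ q, (S.Q.findMin q).2 ≤ 1) {ω : Draws p m}
    {t : Fin p} {k a n : ℕ} (h : S.StepOf ω t k n)
    (ha : Attempting k a ((S.config ω n).thread t).view) :
    S.cost ω n ≤ 2 + ∑ j ∈ Finset.range S.d,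
      contention (S.config ω n) t (ω (t, k, a, j)) := by
  have hcand := S.candidates_config hd ω n t
  unfold cost
  rw [h.1]
  set c := S.config ω n
  obtain rfl : (c.thread t).done = k := h.2
  have hle : ∀ i, (∃ j' < S.d, i = ω (t, (c.thread t).done, a, j')) →
      contention c t i ≤ ∑ j ∈ Finset.range S.d, contention c t (ω (t, (c.thread t).done, a, j)) := by
    rintro _ ⟨j', hj', rfl⟩
    exact Finset.single_le_sum (f := fun j => contention c t (ω (t, (c.thread t).done, a, j)))
      (fun _ _ => Nat.zero_le _) (Finset.mem_range.2 hj')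
  by_cases hop : (S.ops t)[(c.thread t).done]? = none
  · rw [S.step_of_none hop]; exact Nat.zero_le _
  obtain ⟨op, hop⟩ := Option.ne_none_iff_exists'.1 hop
  obtain ⟨-, ⟨j, hj⟩ | hj⟩ := ha
  · cases hph : (c.thread t).phase <;> simp only [Thread.view, hph, Phase.view, reduceCtorEq] at hj
    rename_i a1 j1 b1
    simp only [PhaseView.select.injEq] at hj
    obtain ⟨rfl, rfl⟩ := hj
    unfold Candidates at hcand
    rw [hph] at hcand
    cases op with
    | insert e =>
      simp only [step, hop, hph]
      have := hle (ω (t, (c.thread t).done, a1, j1)) ⟨j1, hcand.1, rfl⟩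
      omega
    | delete =>
      simp only [step, hop, hph]
      have hf := hQ (c.queue (ω (t, (c.thread t).done, a1, j1)))
      split
      · simp only; omega
      · simp only
        refine Nat.add_le_add (by omega) (hle _ ?_)
        split
        · exact ⟨j1, hcand.1, rfl⟩
        · split
          · exact ⟨j1, hcand.1, rfl⟩
          · exact hcand.2 _ rfl
  · cases hph : (c.thread t).phase <;> simp only [Thread.view, hph, Phase.view, reduceCtorEq] at hj
    rename_i a1 i1
    simp only [PhaseView.tryLock.injEq] at hj
    subst hj
    unfold Candidates at hcand
    rw [hph] at hcand
    have := hle _ hcand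
    simp only [step, hop, hph]
    split <;> simp only <;> omega

theorem cost_le_of_holds {ω : Draws p m} {t : Fin p} {k n : ℕ} (h : S.StepOf ω t k n)
    (ha : ∃ i, ((S.config ω n).thread t).phase.Holds i) :
    S.cost ω n ≤ S.queueCost (S.config ω n) t + (1 + S.heldContention (S.config ω n) t) := by
  unfold cost
  rw [h.1]
  set c := S.config ω n
  by_cases hop : (S.ops t)[(c.thread t).done]? = none
  · rw [S.step_of_none hop]; exact Nat.zero_le _
  obtain ⟨op, hop⟩ := Option.ne_none_iff_exists'.1 hop
  obtain ⟨i, hi⟩ := ha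
  cases hph : (c.thread t).phase <;> rw [hph] at hi <;> simp only [Phase.Holds] at hi
  · cases op <;> simp only [step, hop, hph, queueCost, heldContention] <;> omega
  · simp only [step, hop, hph, heldContention]
    omega

theorem attempting_or_holds (th : Thread E m) :
    (∃ a, Attempting th.done a th.view) ∨ ∃ i, th.phase.Holds i := by
  cases hph : th.phase with
  | select a j b => exact Or.inl ⟨a, rfl, Or.inl ⟨j, by simp [Thread.view, hph, Phase.view]⟩⟩
  | tryLock a i => exact Or.inl ⟨a, rfl, Or.inr (by simp [Thread.view, hph, Phase.view])⟩
  | critical i => exact Or.inr ⟨i, rfl⟩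
  | unlock i => exact Or.inr ⟨i, rfl⟩

/-- An attempt of the operation begins only after the preceding attempt has failed. -/
theorem exists_failed_of_attempting {ω : Draws p m} {t : Fin p} {k a n : ℕ}
    (h : Attempting k (a + 1) ((S.config ω n).thread t).view) :
    ∃ n', S.Active ω t k n' ∧ ∃ i, ((S.config ω n').thread t).phase = .tryLock a i ∧
      (S.config ω n').locked i = true := by
  induction n with
  | zero =>
    obtain ⟨-, ⟨j, hj⟩ | hj⟩ := h <;> simp [Thread.view, config, exec, init, Phase.view] at hj
  | succ n ih =>
    rw [config_succ] at h
    set c := S.config ω n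
    by_cases ht : t = S.actor ω n
    swap
    · rw [S.step_thread_of_ne ht] at h; exact ih h
    rw [← ht] at h
    by_cases hop0 : (S.ops t)[(c.thread t).done]? = none
    · rw [S.step_of_none hop0] at h; exact ih h
    obtain ⟨op, hop⟩ := Option.ne_none_iff_exists'.1 hop0
    rw [step_fst] at h
    simp only [Function.update_self] at h
    cases hph : (c.thread t).phase with
    | select a' j b =>
      refine ih ?_
      cases op with
      | insert e =>
        simp only [localStep, hop, hph, Attempting, Thread.view, Phase.view, reduceCtorEq,
          exists_const, false_or, PhaseView.tryLock.injEq] at h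
        exact ⟨h.1, Or.inl ⟨j, by simp [Thread.view, hph, Phase.view, h.2]⟩⟩
      | delete =>
        simp only [localStep, hop, hph] at h
        split at h
        · simp only [Attempting, Thread.view, Phase.view, reduceCtorEq, or_false,
            PhaseView.select.injEq] at h
          obtain ⟨h1, j', h2, -⟩ := h
          exact ⟨h1, Or.inl ⟨j, by simp [Thread.view, hph, Phase.view, h2]⟩⟩
        · simp only [Attempting, Thread.view, Phase.view, reduceCtorEq,
            exists_const, false_or, PhaseView.tryLock.injEq] at h
          exact ⟨h.1, Or.inl ⟨j, by simp [Thread.view, hph, Phase.view, h.2]⟩⟩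
    | tryLock a' i =>
      simp only [localStep, hop, hph] at h
      split at h
      · rename_i hl
        simp only [Attempting, Thread.view, Phase.view, reduceCtorEq, or_false,
          PhaseView.select.injEq] at h
        obtain ⟨h1, j', h2, -⟩ := h
        have : a' = a := by omega
        subst this
        exact ⟨n, ⟨⟨ht.symm, h1⟩, by rw [← h1]; exact hop0⟩, i, hph, hl⟩
      · simp [Attempting, Thread.view, Phase.view] at h
    | critical i =>
      cases op <;> simp [localStep, hop, hph, Attempting, Thread.view, Phase.view] at h
    | unlock i => simp [localStep, hop, hph, Attempting, Thread.view, Phase.view] at h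

end System

end MultiQueue

/-! ### Indicators; the number of attempts and the contention at their candidates. -/

open Classical in
/-- The indicator of a proposition. -/
noncomputable def ind (P : Prop) : ℝ≥0∞ := if P then 1 else 0

theorem ind_of {P : Prop} (h : P) : ind P = 1 := if_pos h

theorem ind_of_not {P : Prop} (h : ¬ P) : ind P = 0 := if_neg h

theorem ind_mono {P Q : Prop} (h : P → Q) : ind P ≤ ind Q := by
  by_cases hP : P
  · rw [ind_of hP, ind_of (h hP)]
  · rw [ind_of_not hP]; exact zero_le

theorem ind_le_one (P : Prop) : ind P ≤ 1 := by
  unfold ind; split <;> simp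

theorem tsum_ind_le {ι : Type*} {P : ι → Prop} (h : ∀ i j, P i → P j → i = j) :
    ∑' i, ind (P i) ≤ ind (∃ i, P i) := by
  by_cases hP : ∃ i, P i
  · obtain ⟨i, hi⟩ := hP
    rw [tsum_eq_single i fun j hj => ind_of_not fun hj' => hj (h _ _ hj' hi), ind_of hi,
      ind_of ⟨i, hi⟩]
  · have : ∀ i, ind (P i) = 0 := fun i => ind_of_not fun hi => hP ⟨i, hi⟩
    simp [this]

namespace MultiQueue

variable {E : Type u} {p m : ℕ}

/-- Every thread has a pending write to at most one lock, so the sets counted for different queues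
are disjoint. -/
theorem sum_contention_le {Q : InternalPQ E} (c : Config Q p m) (t : Fin p) :
    ∑ i, contention c t i ≤ p := by
  classical
  unfold contention
  rw [← Finset.card_biUnion]
  · exact (Finset.card_le_univ _).trans (by simp)
  · intro i _ i' _ hii
    rw [Function.onFun, Finset.disjoint_left]
    intro t' h1 h2
    simp only [Finset.mem_filter, Finset.mem_univ, true_and] at h1 h2
    apply hii
    cases hph : (c.thread t').phase <;> simp_all [Phase.writesLock]

/-- The thread's own pending write is not counted, so its hidden choice does not influence the
contention that it meets. -/
theorem contention_congr {Q : InternalPQ E} {c c' : Config Q p m} {t : Fin p}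
    (h : ∀ t', t' ≠ t → c.thread t' = c'.thread t') (i : Fin m) :
    contention c t i = contention c' t i := by
  unfold contention
  congr 1
  ext t'
  simp only [Finset.mem_filter, Finset.mem_univ, true_and]
  constructor <;> rintro ⟨h1, h2⟩
  · exact ⟨h1, by rwa [← h t' h1]⟩
  · exact ⟨h1, by rwa [h t' h1]⟩

namespace System

variable (S : System E p m)

/-- Thread `t` executes a step of attempt `a` of its `k`-th operation. -/
def Att (ω : Draws p m) (t : Fin p) (k a n : ℕ) : Prop :=
  S.Active ω t k n ∧ Attempting k a ((S.config ω n).thread t).view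

/-- Thread `t` makes the lock attempt of attempt `a` of its `k`-th operation. -/
def Try (ω : Draws p m) (t : Fin p) (k a n : ℕ) : Prop :=
  S.Active ω t k n ∧ ((S.config ω n).thread t).view = (k, .tryLock a)

/-- Thread `t` executes a step of its `k`-th operation while it holds a lock. -/
def Own (ω : Draws p m) (t : Fin p) (k n : ℕ) : Prop :=
  S.Active ω t k n ∧ ∃ i, ((S.config ω n).thread t).phase.Holds i

/-- Attempt `a` of the `k`-th operation of thread `t` takes place. -/
def Reach (ω : Draws p m) (t : Fin p) (k a : ℕ) : Prop :=
  ∃ n, Attempting k a ((S.config ω n).thread t).view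

/-- The probability bound for the failure of an attempt. -/
noncomputable def failBound (p m d : ℕ) : ℝ≥0∞ := 1 - (1 - (p : ℝ≥0∞) * (m : ℝ≥0∞)⁻¹) ^ d

/-- An attempt passes through at most `d` selection states and one lock attempt, each at most once.
-/
theorem tsum_att_le (hd : 0 < S.d) (ω : Draws p m) (t : Fin p) (k a : ℕ) :
    ∑' n, ind (S.Att ω t k a n) ≤ (S.d + 1) * ind (S.Reach ω t k a) := by
  have h1 : ∀ n, ind (S.Att ω t k a n) ≤
      ∑ j ∈ Finset.range S.d, ind (S.Active ω t k n ∧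
        ((S.config ω n).thread t).view = (k, .select a j)) + ind (S.Try ω t k a n) := by
    intro n
    by_cases h : S.Att ω t k a n
    swap
    · rw [ind_of_not h]; exact zero_le
    obtain ⟨hA, hk, ⟨j, hj⟩ | hj⟩ := h
    · have hjd : j < S.d := by
        have := S.candidates_config hd ω n t
        unfold Candidates at this
        cases hph : ((S.config ω n).thread t).phase <;>
          simp only [Thread.view, hph, Phase.view, reduceCtorEq, PhaseView.select.injEq] at hj
        rw [hph] at this
        rw [← hj.2]
        exact this.1
      refine le_trans (ind_le_one _) (le_trans ?_ le_self_add)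
      rw [← ind_of (P := S.Active ω t k n ∧ ((S.config ω n).thread t).view = (k, .select a j))
        ⟨hA, Prod.ext hk hj⟩]
      exact Finset.single_le_sum (f := fun j => ind (S.Active ω t k n ∧
        ((S.config ω n).thread t).view = (k, .select a j))) (fun _ _ => zero_le)
        (Finset.mem_range.2 hjd)
    · refine le_trans (ind_le_one _) (le_trans ?_ le_add_self)
      rw [← ind_of (P := S.Try ω t k a n) ⟨hA, Prod.ext hk hj⟩]
  have h2 : ∀ v : PhaseView m, (v = .tryLock a ∨ ∃ j, v = .select a j) →
      ∑' n, ind (S.Active ω t k n ∧ ((S.config ω n).thread t).view = (k, v))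
        ≤ ind (S.Reach ω t k a) := by
    intro v hv
    refine (tsum_ind_le fun n n' h h' => S.active_unique h.1 h'.1 (by rw [h.2, h'.2])).trans ?_
    refine ind_mono ?_
    rintro ⟨n, -, h⟩
    refine ⟨n, ?_⟩
    rw [h]
    rcases hv with rfl | ⟨j, rfl⟩
    · exact ⟨rfl, Or.inr rfl⟩
    · exact ⟨rfl, Or.inl ⟨j, rfl⟩⟩
  calc _ ≤ ∑' n, (∑ j ∈ Finset.range S.d, ind (S.Active ω t k n ∧
        ((S.config ω n).thread t).view = (k, .select a j)) + ind (S.Try ω t k a n)) :=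
        ENNReal.tsum_le_tsum h1
    _ = ∑ j ∈ Finset.range S.d, ∑' n, ind (S.Active ω t k n ∧
        ((S.config ω n).thread t).view = (k, .select a j)) + ∑' n, ind (S.Try ω t k a n) := by
        rw [ENNReal.tsum_add, Summable.tsum_finsetSum fun _ _ => ENNReal.summable]
    _ ≤ ∑ j ∈ Finset.range S.d, ind (S.Reach ω t k a) + ind (S.Reach ω t k a) :=
        add_le_add (Finset.sum_le_sum fun j _ => h2 _ (Or.inr ⟨j, rfl⟩)) (h2 _ (Or.inl rfl))
    _ = _ := by simp [add_mul]

theorem tsum_own_le (ω : Draws p m) (t : Fin p) (k : ℕ) : ∑' n, ind (S.Own ω t k n) ≤ 2 := by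
  have h1 : ∀ n, ind (S.Own ω t k n) ≤
      ind (S.Active ω t k n ∧ ∃ i, ((S.config ω n).thread t).phase = .critical i)
      + ind (S.Active ω t k n ∧ ∃ i, ((S.config ω n).thread t).phase = .unlock i) := by
    intro n
    by_cases h : S.Own ω t k n
    swap
    · rw [ind_of_not h]; exact zero_le
    obtain ⟨hA, i, hi⟩ := h
    cases hph : ((S.config ω n).thread t).phase <;> rw [hph] at hi <;>
      simp only [Phase.Holds] at hi
    · refine (ind_le_one _).trans (le_trans ?_ le_self_add)
      rw [ind_of ⟨hA, _, rfl⟩]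
    · refine (ind_le_one _).trans (le_trans ?_ le_add_self)
      rw [ind_of ⟨hA, _, rfl⟩]
  refine (ENNReal.tsum_le_tsum h1).trans ?_
  rw [ENNReal.tsum_add, ← one_add_one_eq_two]
  refine add_le_add ?_ ?_ <;>
  · refine (tsum_ind_le ?_).trans (ind_le_one _)
    rintro n n' ⟨h1, i, hi⟩ ⟨h2, i', hi'⟩
    refine S.active_unique h1 h2 ?_
    have e1 : ((S.config ω n).thread t).done = k := h1.1.2
    have e2 : ((S.config ω n').thread t).done = k := h2.1.2
    simp [Thread.view, hi, hi', e1, e2, Phase.view, viewRank]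

/-- Events that are visible to the scheduler do not change when the choices of an attempt are
drawn again before its lock attempt. -/
theorem active_update {t s : Fin p} {k k' a n : ℕ} {X : Type*} (R : Config S.Q p m → Prop)
    (G : Config S.Q p m → X)
    (hR : ∀ c c', S.AgreeOff t k a c c' → (R c ↔ R c') ∧ G c = G c')
    (hv : ∀ c, R c → viewRank (c.thread t).view ≤ viewRank (k, (.tryLock a : PhaseView m)))
    (ω : Draws p m) (j : ℕ) (i : Fin m) (f : Prop → X → ℝ≥0∞) (hf : ∀ x x', f False x = f False x') :
    f (S.Active (Function.update ω (t, k, a, j) i) s k' n ∧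
        R (S.config (Function.update ω (t, k, a, j) i) n))
        (G (S.config (Function.update ω (t, k, a, j) i) n))
      = f (S.Active ω s k' n ∧ R (S.config ω n)) (G (S.config ω n)) := by
  -- The actor is a function of the history, so activity is visible and may enter the invariant
  -- quantity.
  refine S.update_congr (fun c h => f (((S.sched h = s ∧ (c.thread s).done = k') ∧
    (S.ops s)[k']? ≠ none) ∧ R c) (G c)) (f False (G (S.config ω n))) ?_ ?_ ω j i
  · intro c c' h hA
    have h1 : (c.thread s).done = (c'.thread s).done := by
      by_cases hs : s = t
      · subst hs; exact congrArg Prod.fst hA.view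
      · rw [hA.thread s hs]
    simp only [h1, (hR c c' hA).2, (hR c c' hA).1]
  · intro c h hlt
    have : ¬ R c := fun hr => absurd (hv c hr) (not_le.2 hlt)
    simp only [this, and_false]
    exact hf _ _

theorem inv_mul_sum_contention_le (c : Config S.Q p m) (t : Fin p) :
    (m : ℝ≥0∞)⁻¹ * ∑ i, (contention c t i : ℝ≥0∞) ≤ (p : ℝ≥0∞) * (m : ℝ≥0∞)⁻¹ := by
  rw [mul_comm]
  gcongr
  exact_mod_cast sum_contention_le c t

theorem finDep_draws (t : Fin p) (k a r : ℕ) :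
    FinDep fun (ω : Draws p m) (j : Fin r) => ω (t, k, a, j) := by
  classical
  refine ⟨(Finset.range r).image fun j => (t, k, a, j), fun ω ω' h => ?_⟩
  funext j
  exact h _ (Finset.mem_image.2 ⟨j, Finset.mem_range.2 j.2, rfl⟩)

variable [NeZero m]

theorem finDep_config (n : ℕ) {X : Type*} (F : Config S.Q p m → Fin p → X) :
    FinDep fun ω : Draws p m => F (S.config ω n) (S.actor ω n) :=
  S.finDep_exec_comp n fun r => F r.1 (S.sched r.2)

theorem finDep_active (n : ℕ) (t : Fin p) (k : ℕ) (R : Config S.Q p m → Prop) :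
    FinDep fun ω : Draws p m => (S.Active ω t k n ∧ R (S.config ω n)) :=
  S.finDep_config n fun c s => ((s = t ∧ (c.thread t).done = k) ∧ (S.ops t)[k]? ≠ none) ∧ R c

/-- The expected contention at a candidate of the current attempt. -/
theorem lintegral_att_contention_le (t : Fin p) (k a n j : ℕ) :
    ∫⁻ ω, ind (S.Att ω t k a n) * contention (S.config ω n) t (ω (t, k, a, j)) ∂(drawLaw p m)
      ≤ (p : ℝ≥0∞) * (m : ℝ≥0∞)⁻¹ * ∫⁻ ω, ind (S.Att ω t k a n) ∂(drawLaw p m) := by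
  have hatt : FinDep fun ω : Draws p m => ind (S.Att ω t k a n) :=
    (S.finDep_active n t k fun c => Attempting k a (c.thread t).view).comp ind
  rw [lintegral_draw (t, k, a, j)
    (fun i ω => ind (S.Att ω t k a n) * contention (S.config ω n) t i), ← lintegral_const_mul _
    hatt.measurable]
  · refine lintegral_mono fun ω => ?_
    simp only
    rw [← Finset.mul_sum, mul_left_comm, mul_comm (_ * _) (ind _)]
    exact mul_le_mul' le_rfl (S.inv_mul_sum_contention_le _ t)
  · intro i
    refine (FinDep.comp₂ hatt (S.finDep_config n fun c _ => contention c t i)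
      fun x (y : ℕ) => x * (y : ℝ≥0∞)).measurable
  · intro i i' ω
    refine S.active_update (fun c => Attempting k a (c.thread t).view)
      (fun c => contention c t i) ?_ ?_ ω j i' (fun P x => ind P * (x : ℝ≥0∞)) ?_
    · intro c c' h
      rw [h.view]
      exact ⟨Iff.rfl, contention_congr h.thread i⟩
    · rintro c ⟨hk, ⟨j, hj⟩ | hj⟩
      · rw [show (c.thread t).view = (k, .select a j) from Prod.ext hk hj]
        simp [viewRank, Prod.Lex.toLex_le_toLex]
      · rw [show (c.thread t).view = (k, .tryLock a) from Prod.ext hk hj]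
    · intro x x'
      simp [ind_of_not]

/-- At most `p` of the `m` queues are locked; the right-hand side is the probability that a uniform
queue is free. -/
theorem one_sub_le_inv_mul_card {c : Config S.Q p m} (h : S.LockInv c) :
    1 - (p : ℝ≥0∞) * (m : ℝ≥0∞)⁻¹ ≤ (m : ℝ≥0∞)⁻¹ * ∑ i, ind (c.locked i = false) := by
  have hm : (m : ℝ≥0∞) ≠ 0 := by exact_mod_cast NeZero.ne m
  rw [tsub_le_iff_right, mul_comm (p : ℝ≥0∞), ← mul_add,
    ← ENNReal.inv_mul_cancel hm (by simp)]
  refine mul_le_mul' le_rfl ?_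
  have h1 : ∑ i, ind (c.locked i = false)
      = ((Finset.univ.filter fun i => c.locked i = false).card : ℝ≥0∞) := by
    rw [Finset.card_filter, Nat.cast_sum]
    refine Finset.sum_congr rfl fun i _ => ?_
    by_cases hi : c.locked i = false <;> simp [ind, hi]
  have h2 := S.card_locked_le h
  have h3 := Finset.card_filter_add_card_filter_not (s := (Finset.univ : Finset (Fin m)))
    (fun i => c.locked i = true)
  simp only [Bool.not_eq_true, Finset.card_univ, Fintype.card_fin] at h3
  rw [h1]
  exact_mod_cast (by omega : m ≤ (Finset.univ.filter fun i => c.locked i = false).card + p)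

/-- All of the first `r` candidates of a lock attempt are unlocked with probability at least
`(1 - p / m) ^ r`. -/
theorem pow_mul_lintegral_try_le (t : Fin p) (k a n r : ℕ) :
    (1 - (p : ℝ≥0∞) * (m : ℝ≥0∞)⁻¹) ^ r * ∫⁻ ω, ind (S.Try ω t k a n) ∂(drawLaw p m)
      ≤ ∫⁻ ω, ind (S.Try ω t k a n ∧
        ∀ j < r, (S.config ω n).locked (ω (t, k, a, j)) = false) ∂(drawLaw p m) := by
  induction r with
  | zero => simp
  | succ r ih =>
    have hfin : ∀ Z : (Fin m → Bool) → Prop, FinDep fun ω : Draws p m =>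
        ind ((S.Try ω t k a n ∧ ∀ j < r, (S.config ω n).locked (ω (t, k, a, j)) = false) ∧
          Z (S.config ω n).locked) := fun Z =>
      ((S.finDep_config n fun c s => (((s = t ∧ (c.thread t).done = k) ∧ (S.ops t)[k]? ≠ none) ∧
        (c.thread t).view = (k, .tryLock a), c.locked)).comp₂ (finDep_draws t k a r)
        fun x v => (x.1 ∧ ∀ j (h : j < r), x.2 (v ⟨j, h⟩) = false) ∧ Z x.2).comp ind
    have hr := lintegral_draw (t, k, a, r) (fun i ω => ind ((S.Try ω t k a n ∧
      ∀ j < r, (S.config ω n).locked (ω (t, k, a, j)) = false) ∧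
      (S.config ω n).locked i = false)) (fun i => (hfin fun l => l i = false).measurable) ?_
    · have e : ∀ ω, ind (S.Try ω t k a n ∧
          ∀ j < r + 1, (S.config ω n).locked (ω (t, k, a, j)) = false)
          = ind ((S.Try ω t k a n ∧
          ∀ j < r, (S.config ω n).locked (ω (t, k, a, j)) = false) ∧
          (S.config ω n).locked (ω (t, k, a, r)) = false) := by
        intro ω
        congr 1
        rw [Nat.forall_lt_succ_right, and_assoc]
      simp only [e]
      rw [hr, pow_succ', mul_assoc]
      refine (mul_le_mul' le_rfl ih).trans ?_
      have hg : FinDep fun ω : Draws p m => ind (S.Try ω t k a n ∧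
          ∀ j < r, (S.config ω n).locked (ω (t, k, a, j)) = false) := by
        simpa using hfin fun _ => True
      rw [← lintegral_const_mul _ hg.measurable]
      refine lintegral_mono fun ω => ?_
      have hand : ∀ P Q : Prop, ind (P ∧ Q) = ind P * ind Q := fun P Q => by
        by_cases hP : P <;> by_cases hQ : Q <;> simp [ind, hP, hQ]
      simp only
      simp only [hand _ (Config.locked _ _ = false)]
      rw [← Finset.mul_sum, mul_left_comm, mul_comm (_ - _)]
      exact mul_le_mul' le_rfl (S.one_sub_le_inv_mul_card (S.lockInv_config ω n))
    · intro i i' ω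
      -- Redrawing candidate `r` leaves the earlier candidates alone, so the `r` conditions already
      -- imposed do not depend on it.
      have hz : ∀ j < r, Function.update ω (t, k, a, r) i' (t, k, a, j) = ω (t, k, a, j) := by
        intro j hj
        refine Function.update_of_ne ?_ _ _
        simp only [ne_eq, Prod.mk.injEq, true_and]
        omega
      have key := S.active_update (s := t) (k' := k) (n := n)
        (fun c => (c.thread t).view = (k, .tryLock a))
        (fun c => c.locked) (t := t) (k := k) (a := a) ?_ ?_ ω r i'
        (fun P l => ind ((P ∧ ∀ j < r, l (ω (t, k, a, j)) = false) ∧ l i = false)) ?_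
      · refine Eq.trans ?_ key
        refine congrArg ind (propext ?_)
        refine and_congr_left' (and_congr_right fun _ => forall₂_congr fun j hj => ?_)
        rw [hz j hj]
      · intro c c' h
        rw [h.view]
        exact ⟨Iff.rfl, h.locked⟩
      · intro c h
        rw [h]
      · intro x x'
        simp

/-- A lock attempt fails with probability at most `1 - (1 - p / m) ^ d`. -/
theorem lintegral_fail_le (hd : 0 < S.d) (t : Fin p) (k a n : ℕ) :
    ∫⁻ ω, ind (S.Active ω t k n ∧ ∃ i, ((S.config ω n).thread t).phase = .tryLock a i ∧
        (S.config ω n).locked i = true) ∂(drawLaw p m)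
      ≤ failBound p m S.d * ∫⁻ ω, ind (S.Try ω t k a n) ∂(drawLaw p m) := by
  have htry : FinDep fun ω : Draws p m => ind (S.Try ω t k a n) :=
    (S.finDep_active n t k fun c => (c.thread t).view = (k, .tryLock a)).comp ind
  have hfail : FinDep fun ω : Draws p m => ind (S.Active ω t k n ∧
      ∃ i, ((S.config ω n).thread t).phase = .tryLock a i ∧ (S.config ω n).locked i = true) :=
    (S.finDep_active n t k fun c => ∃ i, (c.thread t).phase = .tryLock a i ∧
      c.locked i = true).comp ind
  have hT : ∫⁻ ω, ind (S.Try ω t k a n) ∂(drawLaw p m) ≠ ⊤ := by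
    refine ne_top_of_le_ne_top (b := 1) (by simp) ?_
    calc _ ≤ ∫⁻ _, 1 ∂(drawLaw p m) := lintegral_mono fun ω => ind_le_one _
      _ = 1 := by simp
  unfold failBound
  rw [ENNReal.sub_mul fun _ _ => hT, one_mul]
  refine ENNReal.le_sub_of_add_le_right ?_ ?_
  · exact ENNReal.mul_ne_top (ENNReal.pow_ne_top (by simp)) hT
  -- Failure and freedom of all `d` candidates are disjoint events within the lock attempt, since
  -- the chosen queue is a candidate.
  refine (add_le_add le_rfl (S.pow_mul_lintegral_try_le t k a n S.d)).trans ?_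
  rw [← lintegral_add_left hfail.measurable]
  refine lintegral_mono fun ω => ?_
  simp only
  by_cases h : S.Active ω t k n ∧
      ∃ i, ((S.config ω n).thread t).phase = .tryLock a i ∧ (S.config ω n).locked i = true
  · obtain ⟨hA, i, hi, hl⟩ := h
    rw [ind_of_not (P := S.Try ω t k a n ∧ _), add_zero]
    · refine ind_mono fun _ => ⟨hA, Prod.ext hA.1.2 ?_⟩
      simp [Thread.view, hi, Phase.view]
    · rintro ⟨-, h2⟩
      have hc := S.candidates_config hd ω n t
      unfold Candidates at hc
      rw [hi] at hc
      obtain ⟨j, hj, rfl⟩ := hc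
      have := h2 j hj
      rw [← hA.1.2, hl] at this
      cases this
  · rw [ind_of_not h, zero_add]
    exact ind_mono And.left

/-- Attempt `a + 1` requires a failed lock attempt `a`. The failure bound holds at each fixed time;
summing over time loses nothing because the lock attempt happens at most once. -/
theorem lintegral_reach_le (hd : 0 < S.d) (t : Fin p) (k a : ℕ) :
    ∫⁻ ω, ind (S.Reach ω t k a) ∂(drawLaw p m) ≤ failBound p m S.d ^ a := by
  induction a with
  | zero =>
    calc _ ≤ ∫⁻ _, 1 ∂(drawLaw p m) := lintegral_mono fun ω => ind_le_one _
      _ = _ := by simp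
  | succ a ih =>
    have htry : ∀ n, FinDep fun ω : Draws p m => ind (S.Try ω t k a n) := fun n =>
      (S.finDep_active n t k fun c => (c.thread t).view = (k, .tryLock a)).comp ind
    have hfail : ∀ n, FinDep fun ω : Draws p m => ind (S.Active ω t k n ∧
        ∃ i, ((S.config ω n).thread t).phase = .tryLock a i ∧ (S.config ω n).locked i = true) :=
      fun n => (S.finDep_active n t k fun c => ∃ i, (c.thread t).phase = .tryLock a i ∧
        c.locked i = true).comp ind
    calc _ ≤ ∫⁻ ω, ∑' n, ind (S.Active ω t k n ∧
          ∃ i, ((S.config ω n).thread t).phase = .tryLock a i ∧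
            (S.config ω n).locked i = true) ∂(drawLaw p m) := by
          refine lintegral_mono fun ω => ?_
          by_cases h : S.Reach ω t k (a + 1)
          · obtain ⟨n, hn⟩ := h
            obtain ⟨n', hn'⟩ := S.exists_failed_of_attempting hn
            refine (ind_le_one _).trans ?_
            rw [← ind_of hn']
            exact ENNReal.le_tsum n'
          · simp only [ind_of_not h]; exact zero_le
      _ ≤ ∑' n, failBound p m S.d * ∫⁻ ω, ind (S.Try ω t k a n) ∂(drawLaw p m) := by
          rw [lintegral_tsum fun n => (hfail n).measurable.aemeasurable]
          exact ENNReal.tsum_le_tsum fun n => S.lintegral_fail_le hd t k a n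
      _ = failBound p m S.d * ∫⁻ ω, ∑' n, ind (S.Try ω t k a n) ∂(drawLaw p m) := by
          rw [ENNReal.tsum_mul_left, lintegral_tsum fun n => (htry n).measurable.aemeasurable]
      _ ≤ failBound p m S.d * ∫⁻ ω, ind (S.Reach ω t k a) ∂(drawLaw p m) := by
          refine mul_le_mul' le_rfl (lintegral_mono fun ω => ?_)
          refine (tsum_ind_le fun n n' h h' =>
            S.active_unique h.1 h'.1 (by rw [h.2, h'.2])).trans (ind_mono ?_)
          rintro ⟨n, -, h⟩
          exact ⟨n, by rw [h]; exact ⟨rfl, Or.inr rfl⟩⟩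
      _ ≤ _ := by
          rw [pow_succ']
          exact mul_le_mul' le_rfl ih

end System

end MultiQueue

/-! ### Contention at a held lock, and the total overhead. -/

namespace MultiQueue

variable {E : Type u} {p m : ℕ}

namespace System

variable (S : System E p m)

/-- The expected contention at a lock that a thread holds is due to hidden lock attempts. -/
theorem own_contention_le (hd : 0 < S.d) (ω : Draws p m) (t : Fin p) (k n : ℕ) :
    ind (S.Own ω t k n) * S.heldContention (S.config ω n) t ≤
      ∑ t', ∑' z : ℕ × ℕ, ∑ j ∈ Finset.range S.d, ind (S.Active ω t k n ∧
        (t' ≠ t ∧ ((S.config ω n).thread t').view = (z.1, .tryLock z.2)) ∧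
        ((S.config ω n).thread t).phase.Holds (ω (t', z.1, z.2, j))) := by
  classical
  by_cases h : S.Own ω t k n
  swap
  · rw [ind_of_not h, zero_mul]; exact zero_le
  obtain ⟨hA, i, hi⟩ := h
  have hcon : S.heldContention (S.config ω n) t = contention (S.config ω n) t i := by
    unfold heldContention
    cases hph : ((S.config ω n).thread t).phase <;> rw [hph] at hi <;>
      simp only [Phase.Holds] at hi <;> simp [hi]
  rw [hcon, contention, Finset.card_filter, Nat.cast_sum]
  refine (mul_le_mul' (ind_le_one _) le_rfl).trans ?_
  rw [one_mul]
  refine Finset.sum_le_sum fun t' _ => ?_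
  split
  swap
  · simp
  rename_i hw
  obtain ⟨hne, hw⟩ := hw
  cases hph : ((S.config ω n).thread t').phase <;> rw [hph] at hw <;>
    simp only [Phase.writesLock, beq_iff_eq, Bool.false_eq_true] at hw
  · rename_i a' i'
    subst hw
    have hc := S.candidates_config hd ω n t'
    unfold Candidates at hc
    rw [hph] at hc
    obtain ⟨j, hj, hij⟩ := hc
    refine le_trans ?_ (ENNReal.le_tsum (((S.config ω n).thread t').done, a'))
    refine le_trans ?_ (Finset.single_le_sum (f := fun j => ind (S.Active ω t k n ∧
        (t' ≠ t ∧ ((S.config ω n).thread t').view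
          = (((S.config ω n).thread t').done, .tryLock a')) ∧
        ((S.config ω n).thread t).phase.Holds
          (ω (t', ((S.config ω n).thread t').done, a', j)))) (fun _ _ => zero_le)
        (Finset.mem_range.2 hj))
    rw [ind_of]
    · simp
    · refine ⟨hA, ⟨hne, by simp [Thread.view, hph, Phase.view]⟩, ?_⟩
      rw [← hij]
      exact hi
  -- A pending unlock of the same queue would make a second holder, against the lock invariant.
  · rename_i i'
    exact absurd ((S.lockInv_config ω n).unique t' t i (by rw [hph]; exact hw) hi) hne

theorem sum_ind_holds_le (th : Thread E m) : ∑ i, ind (th.phase.Holds i) ≤ 1 := by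
  rw [← tsum_fintype (L := .unconditional _)]
  refine (tsum_ind_le fun i i' h h' => ?_).trans (ind_le_one _)
  cases hph : th.phase <;> rw [hph] at h h' <;> simp only [Phase.Holds] at h h'
  · exact h.symm.trans h'
  · exact h.symm.trans h'

variable [NeZero m]

/-- The averaging is over the hidden candidates of the competing thread `t'`, not over those of `t`.
A candidate of `t'` hits the held queue with probability `1/m`; there are `d` candidates and at most
`p` competitors. -/
theorem lintegral_own_contention_le (hd : 0 < S.d) (t : Fin p) (k n : ℕ) :
    ∫⁻ ω, ind (S.Own ω t k n) * S.heldContention (S.config ω n) t ∂(drawLaw p m)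
      ≤ S.d * ((p : ℝ≥0∞) * (m : ℝ≥0∞)⁻¹) * ∫⁻ ω, ind (S.Own ω t k n) ∂(drawLaw p m) := by
  have hand : ∀ P Q : Prop, ind (P ∧ Q) = ind P * ind Q := fun P Q => by
    by_cases hP : P <;> by_cases hQ : Q <;> simp [ind, hP, hQ]
  have hown : FinDep fun ω : Draws p m => ind (S.Own ω t k n) :=
    (S.finDep_active n t k fun c => ∃ i, (c.thread t).phase.Holds i).comp ind
  have hvis : ∀ (t' : Fin p) (z : ℕ × ℕ), FinDep fun ω : Draws p m => ind (S.Own ω t k n ∧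
      ((S.config ω n).thread t').view = (z.1, .tryLock z.2)) := fun t' z =>
    (S.finDep_config n fun c s => (((s = t ∧ (c.thread t).done = k) ∧ (S.ops t)[k]? ≠ none) ∧
      ∃ i, (c.thread t).phase.Holds i) ∧ (c.thread t').view = (z.1, .tryLock z.2)).comp ind
  have hF : ∀ (t' : Fin p) (z : ℕ × ℕ) (i : Fin m), FinDep fun ω : Draws p m =>
      ind (S.Active ω t k n ∧
        (t' ≠ t ∧ ((S.config ω n).thread t').view = (z.1, .tryLock z.2)) ∧
        ((S.config ω n).thread t).phase.Holds i) := fun t' z i =>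
    (S.finDep_active n t k fun c => (t' ≠ t ∧ (c.thread t').view = (z.1, .tryLock z.2)) ∧
      (c.thread t).phase.Holds i).comp ind
  have hFz : ∀ (t' : Fin p) (z : ℕ × ℕ) (j : ℕ), FinDep fun ω : Draws p m =>
      ind (S.Active ω t k n ∧
        (t' ≠ t ∧ ((S.config ω n).thread t').view = (z.1, .tryLock z.2)) ∧
        ((S.config ω n).thread t).phase.Holds (ω (t', z.1, z.2, j))) := fun t' z j =>
    ((S.finDep_config n fun c s => (c, s)).comp₂ (FinDep.draw (t', z.1, z.2, j))
      fun x i => ((x.2 = t ∧ (x.1.thread t).done = k) ∧ (S.ops t)[k]? ≠ none) ∧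
        (t' ≠ t ∧ (x.1.thread t').view = (z.1, .tryLock z.2)) ∧
        (x.1.thread t).phase.Holds i).comp ind
  have key : ∀ (t' : Fin p) (z : ℕ × ℕ) (j : ℕ), ∫⁻ ω, ind (S.Active ω t k n ∧
        (t' ≠ t ∧ ((S.config ω n).thread t').view = (z.1, .tryLock z.2)) ∧
        ((S.config ω n).thread t).phase.Holds (ω (t', z.1, z.2, j))) ∂(drawLaw p m)
      ≤ (m : ℝ≥0∞)⁻¹ * ∫⁻ ω, ind (S.Own ω t k n ∧
      ((S.config ω n).thread t').view = (z.1, .tryLock z.2)) ∂(drawLaw p m) := by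
    intro t' z j
    rw [lintegral_draw (t', z.1, z.2, j) (fun i ω => ind (S.Active ω t k n ∧
        (t' ≠ t ∧ ((S.config ω n).thread t').view = (z.1, .tryLock z.2)) ∧
        ((S.config ω n).thread t).phase.Holds i)) (fun i => (hF t' z i).measurable),
      ← lintegral_const_mul _ (hvis t' z).measurable]
    · refine lintegral_mono fun ω => ?_
      refine mul_le_mul' le_rfl ?_
      simp only [hand, Own]
      by_cases hA : S.Active ω t k n
      swap
      · simp [ind_of_not hA]
      by_cases hv : ((S.config ω n).thread t').view = (z.1, .tryLock z.2)
      swap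
      · simp [ind_of_not hv]
      by_cases hh : ∃ i, ((S.config ω n).thread t).phase.Holds i
      · rw [← Finset.mul_sum, ← Finset.mul_sum, ind_of hA, ind_of hv, ind_of hh]
        simp only [one_mul, mul_one]
        exact (mul_le_mul' (ind_le_one _) (sum_ind_holds_le _)).trans (by simp)
      · simp only [not_exists] at hh
        simp [ind_of_not (hh _)]
    · intro i i' ω
      refine S.active_update (fun c => (t' ≠ t ∧ (c.thread t').view = (z.1, .tryLock z.2)) ∧
        (c.thread t).phase.Holds i) (fun _ => ()) ?_ ?_ ω j i' (fun P _ => ind P) ?_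
      · intro c c' h
        refine ⟨?_, rfl⟩
        rw [h.view, and_assoc, and_assoc]
        refine and_congr_right fun hne => ?_
        -- Since `t` differs from `t'`, redrawing for `t'` does not affect which lock `t` holds.
        rw [h.thread t hne.symm]
      · rintro c ⟨⟨-, h⟩, -⟩
        rw [h]
      · intro _ _; rfl
  calc _ ≤ ∫⁻ ω, ∑ t', ∑' z : ℕ × ℕ, ∑ j ∈ Finset.range S.d, ind (S.Active ω t k n ∧
        (t' ≠ t ∧ ((S.config ω n).thread t').view = (z.1, .tryLock z.2)) ∧
        ((S.config ω n).thread t).phase.Holds (ω (t', z.1, z.2, j))) ∂(drawLaw p m) :=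
        lintegral_mono fun ω => S.own_contention_le hd ω t k n
    _ = ∑ t', ∑' z : ℕ × ℕ, ∑ j ∈ Finset.range S.d, ∫⁻ ω, ind (S.Active ω t k n ∧
        (t' ≠ t ∧ ((S.config ω n).thread t').view = (z.1, .tryLock z.2)) ∧
        ((S.config ω n).thread t).phase.Holds (ω (t', z.1, z.2, j))) ∂(drawLaw p m) := by
        rw [lintegral_finsetSum _ fun t' _ => Measurable.tsum fun z =>
          Finset.measurable_sum _ fun j _ => (hFz t' z j).measurable]
        refine Finset.sum_congr rfl fun t' _ => ?_
        rw [lintegral_tsum fun z =>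
          (Finset.measurable_sum _ fun j _ => (hFz t' z j).measurable).aemeasurable]
        refine tsum_congr fun z => ?_
        rw [lintegral_finsetSum _ fun j _ => (hFz t' z j).measurable]
    _ ≤ ∑ t' : Fin p, ∑' z : ℕ × ℕ, ∑ j ∈ Finset.range S.d, (m : ℝ≥0∞)⁻¹ *
          ∫⁻ ω, ind (S.Own ω t k n ∧
          ((S.config ω n).thread t').view = (z.1, .tryLock z.2)) ∂(drawLaw p m) := by
        refine Finset.sum_le_sum fun t' _ => ENNReal.tsum_le_tsum fun z =>
          Finset.sum_le_sum fun j _ => key t' z j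
    _ ≤ ∑ t' : Fin p, S.d * ((m : ℝ≥0∞)⁻¹ * ∫⁻ ω, ind (S.Own ω t k n) ∂(drawLaw p m)) := by
        refine Finset.sum_le_sum fun t' _ => ?_
        simp only [Finset.sum_const, Finset.card_range, nsmul_eq_mul]
        rw [ENNReal.tsum_mul_left, ENNReal.tsum_mul_left,
          ← lintegral_tsum fun z => (hvis t' z).measurable.aemeasurable]
        refine mul_le_mul' le_rfl (mul_le_mul' le_rfl (lintegral_mono fun ω => ?_))
        -- At any time `t'` is in one operation and one attempt, so the sum over `z` costs no extra
        -- factor.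
        refine (tsum_ind_le ?_).trans (ind_mono fun ⟨_, h, _⟩ => h)
        rintro z z' ⟨-, h⟩ ⟨-, h'⟩
        rw [h] at h'
        simp only [Prod.mk.injEq, PhaseView.tryLock.injEq] at h'
        exact Prod.ext h'.1 h'.2
    _ = _ := by
        rw [Finset.sum_const, Finset.card_univ, Fintype.card_fin, nsmul_eq_mul]
        ring

/-- The bound on the expected time of an operation outside the internal queues. -/
noncomputable def overhead (p m d : ℕ) : ℝ≥0∞ :=
  (2 + d * ((p : ℝ≥0∞) * (m : ℝ≥0∞)⁻¹)) * (d + 1) * (1 - failBound p m d)⁻¹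
    + 2 * (1 + d * ((p : ℝ≥0∞) * (m : ℝ≥0∞)⁻¹))

/-- The expected time of an operation is bounded by a constant plus the expected time that it
spends within the internal queue. -/
theorem lintegral_opTime_le (hd : 0 < S.d) (hQ : ∀ q, (S.Q.findMin q).2 ≤ 1) (t : Fin p) (k : ℕ) :
    ∫⁻ ω, S.opTime t k ω ∂(drawLaw p m) ≤ overhead p m S.d +
      ∫⁻ ω, ∑' n, ind (S.Active ω t k n) * S.queueCost (S.config ω n) t ∂(drawLaw p m) := by
  set A : ℕ → Draws p m → ℝ≥0∞ := fun n ω => ∑' a, ind (S.Att ω t k a n) *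
    (2 + ∑ j ∈ Finset.range S.d, (contention (S.config ω n) t (ω (t, k, a, j)) : ℝ≥0∞)) with hA
  set O : ℕ → Draws p m → ℝ≥0∞ := fun n ω => ind (S.Own ω t k n) *
    (1 + S.heldContention (S.config ω n) t) with hO
  have hatt : ∀ a n, FinDep fun ω : Draws p m => ind (S.Att ω t k a n) := fun a n =>
    (S.finDep_active n t k fun c => Attempting k a (c.thread t).view).comp ind
  have hown : ∀ n, FinDep fun ω : Draws p m => ind (S.Own ω t k n) := fun n =>
    (S.finDep_active n t k fun c => ∃ i, (c.thread t).phase.Holds i).comp ind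
  have hattc : ∀ a n j, FinDep fun ω : Draws p m => ind (S.Att ω t k a n) *
      (contention (S.config ω n) t (ω (t, k, a, j)) : ℝ≥0∞) := fun a n j =>
    (hatt a n).comp₂ ((S.finDep_config n fun c _ => c).comp₂ (FinDep.draw (t, k, a, j))
      fun c i => contention c t i) fun x (y : ℕ) => x * (y : ℝ≥0∞)
  have hownc : ∀ n, FinDep fun ω : Draws p m => ind (S.Own ω t k n) *
      (S.heldContention (S.config ω n) t : ℝ≥0∞) := fun n =>
    (hown n).comp₂ (S.finDep_config n fun c _ => S.heldContention c t)
      fun x (y : ℕ) => x * (y : ℝ≥0∞)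
  have eA : ∀ a n ω, ind (S.Att ω t k a n) *
      (2 + ∑ j ∈ Finset.range S.d, (contention (S.config ω n) t (ω (t, k, a, j)) : ℝ≥0∞))
      = ind (S.Att ω t k a n) * 2 + ∑ j ∈ Finset.range S.d, ind (S.Att ω t k a n) *
        (contention (S.config ω n) t (ω (t, k, a, j)) : ℝ≥0∞) := by
    intro a n ω
    rw [mul_add, Finset.mul_sum]
  have hAm : ∀ a n, Measurable fun ω => ind (S.Att ω t k a n) *
      (2 + ∑ j ∈ Finset.range S.d, (contention (S.config ω n) t (ω (t, k, a, j)) : ℝ≥0∞)) := by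
    intro a n
    simp only [eA]
    exact ((hatt a n).measurable.mul_const 2).add
      (Finset.measurable_sum _ fun j _ => (hattc a n j).measurable)
  have hOm : ∀ n, Measurable (O n) := by
    intro n
    simp only [hO, mul_add, mul_one]
    exact (hown n).measurable.add (hownc n).measurable
  have hAint : ∫⁻ ω, ∑' n, A n ω ∂(drawLaw p m) ≤
      (2 + S.d * ((p : ℝ≥0∞) * (m : ℝ≥0∞)⁻¹)) * (S.d + 1) * (1 - failBound p m S.d)⁻¹ := by
    have h1 : ∀ a n, ∫⁻ ω, ind (S.Att ω t k a n) * (2 + ∑ j ∈ Finset.range S.d,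
        (contention (S.config ω n) t (ω (t, k, a, j)) : ℝ≥0∞)) ∂(drawLaw p m) ≤
        (2 + S.d * ((p : ℝ≥0∞) * (m : ℝ≥0∞)⁻¹)) *
          ∫⁻ ω, ind (S.Att ω t k a n) ∂(drawLaw p m) := by
      intro a n
      simp only [eA]
      rw [lintegral_add_left ((hatt a n).measurable.mul_const 2),
        lintegral_mul_const _ (hatt a n).measurable,
        lintegral_finsetSum _ fun j _ => (hattc a n j).measurable, add_mul, mul_comm _ 2]
      refine add_le_add le_rfl ?_
      refine (Finset.sum_le_sum fun j _ => S.lintegral_att_contention_le t k a n j).trans ?_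
      rw [Finset.sum_const, Finset.card_range, nsmul_eq_mul, mul_assoc _ (_ * _)]
    calc _ = ∑' a, ∑' n, ∫⁻ ω, ind (S.Att ω t k a n) * (2 + ∑ j ∈ Finset.range S.d,
        (contention (S.config ω n) t (ω (t, k, a, j)) : ℝ≥0∞)) ∂(drawLaw p m) := by
          rw [lintegral_tsum fun n => (Measurable.tsum fun a => hAm a n).aemeasurable,
            ENNReal.tsum_comm]
          refine tsum_congr fun n => ?_
          rw [← lintegral_tsum fun a => (hAm a n).aemeasurable]
      _ ≤ ∑' a, (2 + S.d * ((p : ℝ≥0∞) * (m : ℝ≥0∞)⁻¹)) *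
          ∫⁻ ω, ∑' n, ind (S.Att ω t k a n) ∂(drawLaw p m) := by
          refine ENNReal.tsum_le_tsum fun a => ?_
          rw [lintegral_tsum fun n => (hatt a n).measurable.aemeasurable, ← ENNReal.tsum_mul_left]
          exact ENNReal.tsum_le_tsum fun n => h1 a n
      _ ≤ ∑' a, (2 + S.d * ((p : ℝ≥0∞) * (m : ℝ≥0∞)⁻¹)) *
          ((S.d + 1) * failBound p m S.d ^ a) := by
          refine ENNReal.tsum_le_tsum fun a => mul_le_mul' le_rfl ?_
          calc _ ≤ ∫⁻ ω, (S.d + 1) * ind (S.Reach ω t k a) ∂(drawLaw p m) :=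
                lintegral_mono fun ω => S.tsum_att_le hd ω t k a
            _ = (S.d + 1) * ∫⁻ ω, ind (S.Reach ω t k a) ∂(drawLaw p m) :=
                lintegral_const_mul' _ _ (by finiteness)
            _ ≤ _ := mul_le_mul' le_rfl (S.lintegral_reach_le hd t k a)
      _ = _ := by
          rw [ENNReal.tsum_mul_left, ENNReal.tsum_mul_left, ENNReal.tsum_geometric, mul_assoc]
  have hOint : ∫⁻ ω, ∑' n, O n ω ∂(drawLaw p m) ≤
      2 * (1 + S.d * ((p : ℝ≥0∞) * (m : ℝ≥0∞)⁻¹)) := by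
    calc _ = ∑' n, ∫⁻ ω, O n ω ∂(drawLaw p m) :=
          lintegral_tsum fun n => (hOm n).aemeasurable
      _ ≤ ∑' n, (1 + S.d * ((p : ℝ≥0∞) * (m : ℝ≥0∞)⁻¹)) *
          ∫⁻ ω, ind (S.Own ω t k n) ∂(drawLaw p m) := by
          refine ENNReal.tsum_le_tsum fun n => ?_
          simp only [hO, mul_add, mul_one]
          rw [lintegral_add_left (hown n).measurable, add_mul, one_mul]
          exact add_le_add le_rfl (S.lintegral_own_contention_le hd t k n)
      _ = (1 + S.d * ((p : ℝ≥0∞) * (m : ℝ≥0∞)⁻¹)) *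
          ∫⁻ ω, ∑' n, ind (S.Own ω t k n) ∂(drawLaw p m) := by
          rw [ENNReal.tsum_mul_left, lintegral_tsum fun n => (hown n).measurable.aemeasurable]
      _ ≤ (1 + S.d * ((p : ℝ≥0∞) * (m : ℝ≥0∞)⁻¹)) * ∫⁻ _, 2 ∂(drawLaw p m) :=
          mul_le_mul' le_rfl (lintegral_mono fun ω => S.tsum_own_le ω t k)
      _ = _ := by simp [mul_comm]
  have hpt : ∀ ω, S.opTime t k ω ≤ (∑' n, A n ω + ∑' n, O n ω) +
      ∑' n, ind (S.Active ω t k n) * S.queueCost (S.config ω n) t := by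
    intro ω
    rw [← ENNReal.tsum_add, ← ENNReal.tsum_add]
    refine ENNReal.tsum_le_tsum fun n => ?_
    split
    swap
    · exact zero_le
    rename_i hstep
    by_cases hact : S.Active ω t k n
    swap
    · rw [S.cost_eq_zero hstep hact]; simp
    -- An active step belongs to an attempt, which is paid by `A`, or is made under a lock, which is
    -- paid by `O` and the cost of the queue access.
    rcases attempting_or_holds ((S.config ω n).thread t) with ⟨a, ha⟩ | hh
    · rw [hstep.2] at ha
      refine le_trans ?_ (le_trans le_self_add le_self_add)
      refine le_trans ?_ (ENNReal.le_tsum a)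
      rw [ind_of (P := S.Att ω t k a n) ⟨hact, ha⟩, one_mul]
      exact_mod_cast S.cost_le_of_attempting hd hQ hstep ha
    · rw [ind_of hact, one_mul, hO]
      simp only
      rw [ind_of (P := S.Own ω t k n) ⟨hact, hh⟩, one_mul, add_comm]
      refine le_trans ?_ (add_le_add le_rfl le_add_self)
      exact_mod_cast S.cost_le_of_holds hstep hh
  calc _ ≤ ∫⁻ ω, (∑' n, A n ω + ∑' n, O n ω) +
      ∑' n, ind (S.Active ω t k n) * S.queueCost (S.config ω n) t ∂(drawLaw p m) :=
        lintegral_mono hpt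
    _ = _ := by
        have hmA : Measurable fun ω => ∑' n, A n ω :=
          Measurable.tsum fun n => Measurable.tsum fun a => hAm a n
        have hmAO : Measurable fun ω => ∑' n, A n ω + ∑' n, O n ω :=
          hmA.add (Measurable.tsum hOm)
        rw [lintegral_add_left hmAO, lintegral_add_left hmA]
    _ ≤ _ := add_le_add (add_le_add hAint hOint) le_rfl

end System

end MultiQueue

/-! ### Cost of van Emde Boas trees. -/

namespace VEB

/-- The summary is updated only if the cluster was empty, and then the insertion into the cluster is
this cheap case. Thus only one recursive call is expensive. -/
theorem insert_cost_of_minMax_eq_none {k : ℕ} (x : ℕ) (q : VEB k) (h : q.minMax = none) :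
    (insert x q).2 = 1 := by
  cases q with
  | leaf mm => cases (h : mm = none); simp only [insert]
  | node mm s c => cases (h : mm = none); simp only [insert]

theorem insert_cost_le {k : ℕ} (x : ℕ) (q : VEB k) : (insert x q).2 ≤ 2 * k + 1 := by
  induction q generalizing x with
  | leaf mm => rcases mm with _ | ⟨lo, hi⟩ <;> simp [insert]
  | @node k mm s c ihs ihc =>
    rcases mm with _ | ⟨lo, hi⟩
    · simp [insert]
    · simp only [insert]
      split
      · simp
      · simp only
        have h1 := ihc (max lo x / 2 ^ 2 ^ k) (max lo x % 2 ^ 2 ^ k)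
        have h2 := ihs (max lo x / 2 ^ 2 ^ k)
        split
        · rename_i h
          rw [insert_cost_of_minMax_eq_none _ _ h]
          omega
        · simp only
          omega

/-- A branch with recursive calls stores a new minimum, so a tree that is empty afterwards made
none. Hence the summary is changed only after a cheap deletion in the cluster. -/
theorem deleteMin_cost_of_minMax_eq_none {k : ℕ} (q : VEB k)
    (h : (deleteMin q).1.minMax = none) : (deleteMin q).2 = 1 := by
  cases q with
  | leaf mm => rcases mm with _ | ⟨lo, hi⟩ <;> simp [deleteMin]
  | node mm s c =>
    rcases mm with _ | ⟨lo, hi⟩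
    · simp [deleteMin]
    · simp only [deleteMin] at h ⊢
      split
      · rfl
      · rename_i h1
        simp only [h1] at h
        split
        · rfl
        · rename_i h2
          simp only [h2] at h
          exact absurd h (Option.some_ne_none _)

theorem deleteMin_cost_le {k : ℕ} (q : VEB k) : (deleteMin q).2 ≤ 2 * k + 1 := by
  induction q with
  | leaf mm => rcases mm with _ | ⟨lo, hi⟩ <;> simp [deleteMin]
  | @node k mm s c ihs ihc =>
    rcases mm with _ | ⟨lo, hi⟩
    · simp [deleteMin]
    · simp only [deleteMin]
      split
      · simp
      · rename_i h _ _
        split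
        · simp
        · simp only
          have h1 := ihc h
          split
          · rename_i h2
            rw [deleteMin_cost_of_minMax_eq_none _ h2]
            omega
          · simp only
            omega

variable {E : Type u} {U : ℕ}

theorem Queue.insert_cost_le (key : E → Fin U) (e : E) (q : Queue E U) :
    (q.insert key e).2 ≤ 2 * height U + 2 := by
  simp only [Queue.insert]
  split
  · have := VEB.insert_cost_le (key e : ℕ) q.tree
    omega
  · simp

theorem Queue.deleteMin_cost_le (q : Queue E U) : q.deleteMin.2 ≤ 2 * height U + 2 := by
  simp only [Queue.deleteMin]
  split
  · simp
  · split
    · simp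
    · simp only
      split
      · have := VEB.deleteMin_cost_le q.tree
        omega
      · simp

theorem clog_two_le (x : ℝ) (n : ℕ) (hx : 1 ≤ x) (hn : (n : ℝ) ≤ x) :
    (Nat.clog 2 n : ℝ) ≤ Real.logb 2 x + 1 := by
  have h0 : 0 ≤ Real.logb 2 x := Real.logb_nonneg (by norm_num) hx
  have h1 : Nat.clog 2 n ≤ ⌈Real.logb 2 x⌉₊ := by
    rw [Nat.clog_le_iff_le_pow (by norm_num)]
    have : (n : ℝ) ≤ ((2 ^ ⌈Real.logb 2 x⌉₊ : ℕ) : ℝ) := by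
      refine hn.trans ?_
      push_cast
      rw [← Real.rpow_natCast, ← Real.logb_le_iff_le_rpow (by norm_num) (by linarith)]
      exact Nat.le_ceil _
    exact_mod_cast this
  calc (Nat.clog 2 n : ℝ) ≤ ⌈Real.logb 2 x⌉₊ := by exact_mod_cast h1
    _ ≤ _ := (Nat.ceil_lt_add_one h0).le

theorem one_le_logb_logb {U : ℕ} (hU : 4 ≤ U) : 1 ≤ Real.logb 2 (Real.logb 2 U) := by
  have hU' : (4 : ℝ) ≤ U := by exact_mod_cast hU
  have h2 : 2 ≤ Real.logb 2 U := by
    rw [Real.le_logb_iff_rpow_le (by norm_num) (by linarith)]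
    norm_num
    exact hU
  rw [Real.le_logb_iff_rpow_le (by norm_num) (by linarith)]
  simpa using h2

/-- The inner rounding gives at most `logb 2 U + 1`, hence at most twice `logb 2 U`. This factor and
the outer rounding each add one after the second logarithm, and the double logarithm is at least
one. -/
theorem height_le {U : ℕ} (hU : 4 ≤ U) :
    (height U : ℝ) ≤ 3 * Real.logb 2 (Real.logb 2 U) := by
  have hU' : (4 : ℝ) ≤ U := by exact_mod_cast hU
  have h2 : 2 ≤ Real.logb 2 U := by
    rw [Real.le_logb_iff_rpow_le (by norm_num) (by linarith)]
    norm_num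
    exact hU
  have h1 := one_le_logb_logb hU
  have h3 : (Nat.clog 2 U : ℝ) ≤ 2 * Real.logb 2 U := by
    have := clog_two_le U U (by linarith) le_rfl
    linarith
  have h4 := clog_two_le _ _ (by linarith) h3
  rw [Real.logb_mul (by norm_num) (by linarith), Real.logb_self_eq_one (by norm_num)] at h4
  unfold height
  linarith

end VEB

/-! ### Worst-case cost of binary heaps. -/

namespace BinaryHeap

variable {E : Type u} (lt : E → E → Prop) [DecidableRel lt]

/-- Moving to the parent halves the one-based index `i + 1`. -/
theorem siftUp_cost_le (a : ℕ → Option E) (i : ℕ) :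
    (siftUp lt a i).2 ≤ Nat.log 2 (i + 1) + 1 := by
  induction i using Nat.strong_induction_on generalizing a with
  | _ i ih =>
    unfold siftUp
    split
    · simp
    · rename_i hi
      split
      · simp only
        have := ih ((i - 1) / 2) (by omega) (swapCells a i ((i - 1) / 2))
        have h2 : (i - 1) / 2 + 1 = (i + 1) / 2 := by omega
        rw [h2] at this
        have h3 := Nat.log_div_base 2 (i + 1)
        have h4 : 0 < Nat.log 2 (i + 1) := Nat.log_pos (by norm_num) (by omega)
        omega
      · simp

/-- Moving to a child at least halves `n / (i + 1)`. -/
theorem siftDown_cost_le (n : ℕ) (a : ℕ → Option E) (i : ℕ) :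
    (siftDown lt n a i).2 ≤ Nat.log 2 (n / (i + 1)) + 1 := by
  induction hk : n - i using Nat.strong_induction_on generalizing a i with
  | _ k ih =>
    unfold siftDown
    split
    · rename_i hi
      split
      · simp only
        have hc : 2 * i + 1 ≤ minChild lt a i := by unfold minChild; split <;> omega
        have := ih (n - minChild lt a i) (by omega) (swapCells a i (minChild lt a i)) _ rfl
        have h2 : n / (minChild lt a i + 1) ≤ n / (i + 1) / 2 := by
          rw [Nat.div_div_eq_div_mul]
          exact Nat.div_le_div_left (by omega) (by omega)
        have h3 := Nat.log_mono_right (b := 2) h2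
        rw [Nat.log_div_base] at h3
        have h4 : 0 < Nat.log 2 (n / (i + 1)) :=
          Nat.log_pos (by norm_num) ((Nat.le_div_iff_mul_le (by omega)).2 (by omega))
        omega
      · simp
    · simp

theorem insert_cost_le (e : E) (q : BinaryHeap E) :
    (insert lt e q).2 ≤ Nat.log 2 (q.size + 2) + 2 := by
  have h := siftUp_cost_le lt (Function.update q.cell q.size (some e)) q.size
  have h2 : Nat.log 2 (q.size + 1) ≤ Nat.log 2 (q.size + 2) := Nat.log_mono_right (by omega)
  simp only [insert]
  omega

theorem deleteMin_cost_le (q : BinaryHeap E) :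
    (deleteMin lt q).2 ≤ Nat.log 2 (q.size + 2) + 2 := by
  simp only [deleteMin]
  split
  · simp
  · have h := siftDown_cost_le lt (q.size - 1)
      (Function.update (Function.update q.cell 0 (q.cell (q.size - 1))) (q.size - 1) none) 0
    have h2 : Nat.log 2 ((q.size - 1) / (0 + 1)) ≤ Nat.log 2 (q.size + 2) :=
      Nat.log_mono_right (by rw [zero_add, Nat.div_one]; omega)
    simp only
    omega

end BinaryHeap

/-! ### The weak order with a greatest element `⊥`. -/

section WeakOrder

variable {E : Type u} (lt : E → E → Prop) [IsStrictWeakOrder E lt]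

/-- Transitivity of incomparability makes the negated reverse order transitive, that is, a total
preorder. -/
theorem not_lt_trans_of_weak {a b c : E} (h : ¬ lt b a) (h' : ¬ lt c b) : ¬ lt c a := by
  intro hca
  by_cases hbc : lt b c
  · exact h (_root_.trans hbc hca)
  by_cases hab : lt a b
  · exact h' (_root_.trans hca hab)
  exact (IsStrictWeakOrder.incomp_trans c b a ⟨h', hbc⟩ ⟨h, hab⟩).1 hca

/-- `u` is at most `v` in the order of `E ∪ {⊥}`. -/
def optLe (u v : Option E) : Prop := ¬ optLt lt v u

variable {lt}

theorem optLe_trans {u v w : Option E} (h : optLe lt u v) (h' : optLe lt v w) : optLe lt u w := by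
  rcases u with _ | u <;> rcases v with _ | v <;> rcases w with _ | w <;>
    simp_all [optLe, optLt]
  exact not_lt_trans_of_weak lt h h'

theorem optLe_of_optLt {u v : Option E} (h : optLt lt u v) : optLe lt u v := by
  rcases u with _ | u <;> rcases v with _ | v <;> simp_all [optLe, optLt]
  exact fun h' => irrefl_of lt _ (_root_.trans h h')

omit [IsStrictWeakOrder E lt] in
theorem optLe_none (u : Option E) : optLe lt u none := by
  rcases u with _ | u <;> simp [optLe, optLt]

theorem optLe_refl (u : Option E) : optLe lt u u := by
  rcases u with _ | u <;> simp [optLe, optLt, irrefl_of lt]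

omit [IsStrictWeakOrder E lt] in
theorem not_none_optLe_some (e : E) : ¬ optLe lt none (some e) := by simp [optLe, optLt]

end WeakOrder

/-! ### Insertion into a binary heap in random order. -/

namespace BinaryHeap

variable {E : Type u} {lt : E → E → Prop} [IsStrictWeakOrder E lt] [DecidableRel lt]

/-- The heap property may only fail between cell `i` and its parent. -/
structure HeapExcept (lt : E → E → Prop) (a : ℕ → Option E) (i : ℕ) : Prop where
  parent : ∀ j, 1 ≤ j → j ≠ i → optLe lt (a ((j - 1) / 2)) (a j)
  grandparent : ∀ j, 1 ≤ j → (j - 1) / 2 = i → 1 ≤ i → optLe lt (a ((i - 1) / 2)) (a j)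

theorem swapCells_left (a : ℕ → Option E) {i j : ℕ} (h : i ≠ j) : swapCells a i j i = a j := by
  simp [swapCells, Function.update_of_ne h]

theorem swapCells_right (a : ℕ → Option E) (i j : ℕ) : swapCells a i j j = a i := by
  simp [swapCells]

theorem swapCells_of_ne (a : ℕ → Option E) {i j l : ℕ} (h : l ≠ i) (h' : l ≠ j) :
    swapCells a i j l = a l := by
  simp [swapCells, Function.update_of_ne h, Function.update_of_ne h']

-- The `grandparent` condition is what keeps the invariant alive: after the swap the children of `i`
-- lie below the former parent.
omit [DecidableRel lt] in
theorem HeapExcept.swap {a : ℕ → Option E} {i : ℕ} (h : HeapExcept lt a i) (hi : i ≠ 0)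
    (hlt : optLt lt (a i) (a ((i - 1) / 2))) :
    HeapExcept lt (swapCells a i ((i - 1) / 2)) ((i - 1) / 2) := by
  obtain ⟨q, hq⟩ : ∃ q, (i - 1) / 2 = q := ⟨_, rfl⟩
  rw [hq] at hlt ⊢
  have hqi : i ≠ q := by omega
  constructor
  · intro j hj hjq
    by_cases hji : j = i
    · subst hji
      rw [hq, swapCells_right, swapCells_left _ hqi]
      exact optLe_of_optLt hlt
    rw [swapCells_of_ne a hji hjq]
    by_cases h1 : (j - 1) / 2 = i
    · rw [h1, swapCells_left _ hqi, ← hq]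
      exact h.grandparent j hj h1 (by omega)
    by_cases h2 : (j - 1) / 2 = q
    · rw [h2, swapCells_right]
      refine optLe_trans (optLe_of_optLt hlt) ?_
      have := h.parent j hj hji
      rwa [h2] at this
    rw [swapCells_of_ne a h1 h2]
    exact h.parent j hj hji
  · intro j hj hjq hq1
    rw [swapCells_of_ne a (by omega) (by omega)]
    have h1 := h.parent q hq1 (by omega)
    by_cases hji : j = i
    · subst hji
      rwa [swapCells_left _ hqi]
    rw [swapCells_of_ne a hji (by omega)]
    have h2 := h.parent j hj hji
    rw [hjq] at h2
    exact optLe_trans h1 h2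

omit [IsStrictWeakOrder E lt] in
theorem siftUp_of_lt {a : ℕ → Option E} {i : ℕ} (hi : i ≠ 0)
    (hlt : optLt lt (a i) (a ((i - 1) / 2))) :
    siftUp lt a i = ((siftUp lt (swapCells a i ((i - 1) / 2)) ((i - 1) / 2)).1,
      (siftUp lt (swapCells a i ((i - 1) / 2)) ((i - 1) / 2)).2 + 1) := by
  rw [siftUp, dif_neg hi, if_pos hlt]

omit [IsStrictWeakOrder E lt] in
theorem siftUp_of_not_lt {a : ℕ → Option E} {i : ℕ}
    (h : i = 0 ∨ ¬ optLt lt (a i) (a ((i - 1) / 2))) : siftUp lt a i = (a, 1) := by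
  rw [siftUp]
  split
  · rfl
  · rw [if_neg (by tauto)]

/-- Induction along the path of `siftUp`. -/
theorem siftUp_induction (lt : E → E → Prop) {P : (ℕ → Option E) → ℕ → Prop}
    (halt : ∀ a i, (i = 0 ∨ ¬ optLt lt (a i) (a ((i - 1) / 2))) → P a i)
    (step : ∀ a i, i ≠ 0 → optLt lt (a i) (a ((i - 1) / 2)) →
      P (swapCells a i ((i - 1) / 2)) ((i - 1) / 2) → P a i) (a : ℕ → Option E) (i : ℕ) :
    P a i := by
  induction i using Nat.strong_induction_on generalizing a with
  | _ i ih =>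
    by_cases h : i = 0 ∨ ¬ optLt lt (a i) (a ((i - 1) / 2))
    · exact halt a i h
    · push Not at h
      exact step a i h.1 h.2 (ih _ (by omega) _)

theorem siftUp_isHeap (a : ℕ → Option E) (i : ℕ) (h : HeapExcept lt a i) :
    ∀ j, 1 ≤ j → optLe lt ((siftUp lt a i).1 ((j - 1) / 2)) ((siftUp lt a i).1 j) := by
  induction a, i using siftUp_induction lt with
  | halt a i hs =>
    rw [siftUp_of_not_lt hs]
    intro j hj
    by_cases hji : j = i
    · subst hji
      rcases hs with hs | hs
      · omega
      · exact hs
    · exact h.parent j hj hji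
  | step a i hi hlt ih =>
    rw [siftUp_of_lt hi hlt]
    exact ih (h.swap hi hlt)

omit [IsStrictWeakOrder E lt] in
theorem siftUp_of_gt (a : ℕ → Option E) (i : ℕ) : ∀ j, i < j → (siftUp lt a i).1 j = a j := by
  induction a, i using siftUp_induction lt with
  | halt a i hs => rw [siftUp_of_not_lt hs]; exact fun _ _ => rfl
  | step a i hi hlt ih =>
    rw [siftUp_of_lt hi hlt]
    intro j hj
    rw [ih j (by omega), swapCells_of_ne a (by omega) (by omega)]

/-- Sifting up shifts the passed ancestors one level down along the path. Every passed cell receives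
something smaller, except the starting cell, which may receive its parent's content. -/
theorem siftUp_le (a : ℕ → Option E) (i : ℕ) (h : HeapExcept lt a i) :
    (∀ j, j ≠ i → optLe lt ((siftUp lt a i).1 j) (a j)) ∧
      ((siftUp lt a i).1 i = a i ∨ 1 ≤ i ∧ (siftUp lt a i).1 i = a ((i - 1) / 2)) := by
  induction a, i using siftUp_induction lt with
  | halt a i hs =>
    rw [siftUp_of_not_lt hs]
    exact ⟨fun _ _ => optLe_refl _, Or.inl rfl⟩
  | step a i hi hlt ih =>
    obtain ⟨h1, h2⟩ := ih (h.swap hi hlt)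
    rw [siftUp_of_lt hi hlt]
    obtain ⟨q, hq⟩ : ∃ q, (i - 1) / 2 = q := ⟨_, rfl⟩
    rw [hq] at h1 h2 hlt ⊢
    refine ⟨fun j hj => ?_, Or.inr ⟨by omega, ?_⟩⟩
    · by_cases hjq : j = q
      · subst hjq
        rcases h2 with h2 | ⟨h2, h3⟩
        · rw [h2, swapCells_right]
          exact optLe_of_optLt hlt
        · rw [h3, swapCells_of_ne a (by omega) (by omega)]
          exact h.parent j h2 (by omega)
      · have := h1 j hjq
        rwa [swapCells_of_ne a hj hjq] at this
    · rw [siftUp_of_gt _ _ i (by omega), swapCells_left _ (by omega)]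

-- In one-based numbering the ancestors of `q + 1` are the quotients `(q + 1) / 2 ^ r`. The heap
-- property is needed only up to cell `q`, so the lemma applies above a cell that still violates it.
omit [DecidableRel lt] in
theorem ancestor_le (a : ℕ → Option E) (r q w : ℕ)
    (h : ∀ j, 1 ≤ j → j ≤ q → optLe lt (a ((j - 1) / 2)) (a j)) (hw : w + 1 = (q + 1) / 2 ^ r) :
    optLe lt (a w) (a q) := by
  induction r generalizing q with
  | zero =>
    simp only [pow_zero, Nat.div_one, Nat.add_right_cancel_iff] at hw
    rw [hw]; exact optLe_refl _
  | succ r ih =>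
    rcases Nat.eq_zero_or_pos q with rfl | hq
    · rw [Nat.div_eq_of_lt (by simp)] at hw
      omega
    · refine optLe_trans (ih ((q - 1) / 2) (fun j hj hjq => h j hj (by omega)) ?_) (h q hq le_rfl)
      rw [hw, pow_succ', ← Nat.div_div_eq_div_mul]
      congr 1
      omega

/-- Sifting up an element `≤ e` from a cell below `w` brings an element `≤ e` to `w` if the
parent of `w` holds such an element already. -/
theorem siftUp_ancestor_le (e : Option E) (a : ℕ → Option E) (i : ℕ) (h : HeapExcept lt a i)
    (hi : optLe lt (a i) e) (r w : ℕ) (hw : w + 1 = (i + 1) / 2 ^ r)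
    (hp : w = 0 ∨ optLe lt (a ((w - 1) / 2)) e) : optLe lt ((siftUp lt a i).1 w) e := by
  induction a, i using siftUp_induction lt generalizing r with
  | halt a i hs =>
    rw [siftUp_of_not_lt hs]
    rcases r with _ | r
    · obtain rfl : w = i := by simpa using hw
      exact hi
    rcases Nat.eq_zero_or_pos i with rfl | hi0
    · rw [Nat.div_eq_of_lt (by simp)] at hw
      omega
    rcases hs with hs | hs
    · omega
    refine optLe_trans (ancestor_le a r ((i - 1) / 2) w
      (fun j hj hjq => h.parent j hj (by omega)) ?_) (optLe_trans hs hi)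
    rw [hw, pow_succ', ← Nat.div_div_eq_div_mul]
    congr 1
    omega
  | step a i hi0 hlt ih =>
    rcases r with _ | r
    · obtain rfl : w = i := by simpa using hw
      rcases (siftUp_le a w h).2 with h1 | ⟨-, h1⟩
      · rw [h1]; exact hi
      · rw [h1]; exact hp.resolve_left hi0
    have hw' : w + 1 = ((i - 1) / 2 + 1) / 2 ^ r := by
      rw [hw, pow_succ', ← Nat.div_div_eq_div_mul]
      congr 1
      omega
    have hwq : w + 1 ≤ (i - 1) / 2 + 1 := hw' ▸ Nat.div_le_self _ _
    rw [siftUp_of_lt hi0 hlt]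
    refine ih (h.swap hi0 hlt) (by rwa [swapCells_right]) r hw' ?_
    by_cases hw0 : w = 0
    · exact Or.inl hw0
    · rw [swapCells_of_ne a (by omega) (by omega)]
      exact hp

omit [IsStrictWeakOrder E lt] in
/-- An element that rises `r` levels is smaller than its ancestors up to that level. -/
theorem lt_of_lt_siftUp_cost (a : ℕ → Option E) (i r : ℕ) (hr : 1 ≤ r)
    (h : r < (siftUp lt a i).2) :
    1 ≤ (i + 1) / 2 ^ r ∧ optLt lt (a i) (a ((i + 1) / 2 ^ r - 1)) := by
  induction a, i using siftUp_induction lt generalizing r with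
  | halt a i hs => rw [siftUp_of_not_lt hs] at h; simp only at h; omega
  | step a i hi hlt ih =>
    rw [siftUp_of_lt hi hlt] at h
    simp only at h
    have hq : (i + 1) / 2 = (i - 1) / 2 + 1 := by omega
    obtain ⟨r, rfl⟩ : ∃ r', r = r' + 1 := ⟨r - 1, by omega⟩
    rcases Nat.eq_zero_or_pos r with rfl | hr0
    · simp only [zero_add, pow_one, hq]
      exact ⟨by omega, hlt⟩
    · obtain ⟨h1, h2⟩ := ih r hr0 (by omega)
      have hdiv : (i + 1) / 2 ^ (r + 1) = ((i - 1) / 2 + 1) / 2 ^ r := by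
        rw [pow_succ', ← Nat.div_div_eq_div_mul, hq]
      have h3 : ((i - 1) / 2 + 1) / 2 ^ r ≤ ((i - 1) / 2 + 1) / 2 :=
        Nat.div_le_div_left (by simpa using Nat.pow_le_pow_right (n := 2) (by norm_num) hr0)
          (by norm_num)
      rw [swapCells_right, swapCells_of_ne a (by omega) (by omega)] at h2
      rw [hdiv]
      exact ⟨h1, h2⟩

variable (lt) in
/-- The heap that is built by inserting `y 0, …, y (n - 1)` one by one. -/
def heapOf (y : ℕ → E) : ℕ → BinaryHeap E
  | 0 => ⟨0, fun _ => none⟩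
  | n + 1 => (insert lt (y n) (heapOf y n)).1

omit [IsStrictWeakOrder E lt] in
theorem heapOf_size (y : ℕ → E) (n : ℕ) : (heapOf lt y n).size = n := by
  induction n with
  | zero => rfl
  | succ n ih => simp only [heapOf, insert, ih]

omit [IsStrictWeakOrder E lt] in
theorem heapOf_cell_succ (y : ℕ → E) (n : ℕ) : (heapOf lt y (n + 1)).cell =
    (siftUp lt (Function.update (heapOf lt y n).cell n (some (y n))) n).1 := by
  simp only [heapOf, insert, heapOf_size]

omit [IsStrictWeakOrder E lt] in
theorem heapOf_cell_of_le (y : ℕ → E) (n : ℕ) : ∀ j, n ≤ j → (heapOf lt y n).cell j = none := by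
  induction n with
  | zero => exact fun _ _ => rfl
  | succ n ih =>
    intro j hj
    rw [heapOf_cell_succ, siftUp_of_gt _ _ j (by omega), Function.update_of_ne (by omega),
      ih j (by omega)]

-- All cells from `n` on hold `⊥`, which is greatest, so the new element can conflict only with its
-- parent.
omit [IsStrictWeakOrder E lt] [DecidableRel lt] in
theorem heapExcept_update {a : ℕ → Option E} {n : ℕ} (f : E)
    (h : ∀ j, 1 ≤ j → optLe lt (a ((j - 1) / 2)) (a j)) (hn : ∀ j, n ≤ j → a j = none) :
    HeapExcept lt (Function.update a n (some f)) n := by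
  constructor
  · intro j hj hjn
    rw [Function.update_of_ne hjn]
    by_cases h1 : (j - 1) / 2 = n
    · rw [hn j (by omega)]; exact optLe_none _
    · rw [Function.update_of_ne h1]; exact h j hj
  · intro j hj hjn hn1
    rw [Function.update_of_ne (by omega : j ≠ n), hn j (by omega)]
    exact optLe_none _

theorem heapOf_isHeap (y : ℕ → E) (n : ℕ) :
    ∀ j, 1 ≤ j → optLe lt ((heapOf lt y n).cell ((j - 1) / 2)) ((heapOf lt y n).cell j) := by
  induction n with
  | zero => exact fun _ _ => optLe_none _
  | succ n ih =>
    rw [heapOf_cell_succ]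
    exact siftUp_isHeap _ _ (heapExcept_update _ ih (heapOf_cell_of_le y n))

/-- Cell `v - 1` of the heap with `n` elements holds an element that is at most `e`. -/
def Filled (lt : E → E → Prop) [DecidableRel lt] (y : ℕ → E) (e : E) (n v : ℕ) : Prop :=
  optLe lt ((heapOf lt y n).cell (v - 1)) (some e)

/-- The new cell `n` was empty and hence not filled; all other cells can only decrease. -/
theorem Filled.succ {y : ℕ → E} {e : E} {n v : ℕ} (h : Filled lt y e n v) :
    Filled lt y e (n + 1) v := by
  unfold Filled at *
  have hv : v - 1 ≠ n := by
    intro hv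
    rw [heapOf_cell_of_le y n _ hv.ge] at h
    exact not_none_optLe_some e h
  rw [heapOf_cell_succ]
  have h1 := (siftUp_le (lt := lt) _ _ (heapExcept_update (y n) (heapOf_isHeap y n)
    (heapOf_cell_of_le y n))).1 _ hv
  rw [Function.update_of_ne hv] at h1
  exact optLe_trans h1 h

theorem Filled.mono {y : ℕ → E} {e : E} {n n' v : ℕ} (h : Filled lt y e n v) (hn : n ≤ n') :
    Filled lt y e n' v := by
  induction n', hn using Nat.le_induction with
  | base => exact h
  | succ n' _ ih => exact ih.succ

/-- The new element stops below the cell, in it, or above it. The cell is then bounded by the heap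
order, holds the element itself, or inherits the parent's former content, which is why the parent
must be filled already. -/
theorem Filled.insert {y : ℕ → E} {e : E} {n v l : ℕ} (hv : 1 ≤ v) (hvn : (n + 1) / 2 ^ l = v)
    (hy : ¬ lt e (y n)) (hp : v = 1 ∨ Filled lt y e n (v / 2)) : Filled lt y e (n + 1) v := by
  unfold Filled at *
  rw [heapOf_cell_succ]
  refine siftUp_ancestor_le _ _ _ (heapExcept_update (y n) (heapOf_isHeap y n)
    (heapOf_cell_of_le y n)) (by simpa [optLe, optLt] using hy) l (v - 1) (by omega) ?_
  rcases hp with rfl | hp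
  · exact Or.inl rfl
  by_cases hv1 : v = 1
  · left; omega
  have hle : v ≤ n + 1 := hvn ▸ Nat.div_le_self _ _
  have e1 : (v - 1 - 1) / 2 = v / 2 - 1 := by omega
  rw [e1, Function.update_of_ne (by omega)]
  exact Or.inr hp

/-- Among the insertions `n` with `(n + 1) / 2 ^ l = v`, that is, those into level `l` of the
subtree of cell `v - 1`, there are two of elements at most `e`. -/
def TwoSmall (lt : E → E → Prop) (y : ℕ → E) (e : E) (v l : ℕ) : Prop :=
  ∃ n₁ n₂, n₁ < n₂ ∧ (n₁ + 1) / 2 ^ l = v ∧ (n₂ + 1) / 2 ^ l = v ∧ ¬ lt e (y n₁) ∧ ¬ lt e (y n₂)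

/-- The first small insertion below `v` fills the parent `v / 2`, and the second fills `v`. The
first one needs `v / 4` to be filled before it, which is the same claim two generations up for the
level that is completed just in time: level `l + 1` below `v / 4` lies one heap level above level
`l` below `v`. The block sizes therefore double with each recursion. -/
theorem filled_of_twoSmall {y : ℕ → E} {e : E} (v l : ℕ) (hv : 1 ≤ v)
    (h : ∀ g, 1 ≤ v / 4 ^ g → TwoSmall lt y e (v / 4 ^ g) (l + g)) (n : ℕ)
    (hn : (v + 1) * 2 ^ l ≤ n + 1) : Filled lt y e n v := by
  induction v using Nat.strong_induction_on generalizing l n with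
  | _ v ih =>
    obtain ⟨n₁, n₂, hlt, h1, h2, hy1, hy2⟩ := by simpa using h 0 (by simpa using hv)
    have hpos : 0 < 2 ^ l := by positivity
    have hn2 : n₂ + 1 ≤ n := by
      have := Nat.lt_mul_of_div_lt (show (n₂ + 1) / 2 ^ l < v + 1 by omega) hpos
      rw [mul_comm] at this
      nlinarith
    have hn1 : v * 2 ^ l ≤ n₁ + 1 := by
      rw [← h1]; exact Nat.div_mul_le_self _ _
    refine Filled.mono (Filled.insert hv h2 hy2 ?_) hn2
    by_cases hv1 : v = 1
    · exact Or.inl hv1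
    right
    have h3 : (n₁ + 1) / 2 ^ (l + 1) = v / 2 := by
      rw [pow_succ, ← Nat.div_div_eq_div_mul, h1]
    refine Filled.mono (Filled.insert (by omega) h3 hy1 ?_) hlt
    by_cases hv4 : v < 4
    · left; omega
    right
    rw [Nat.div_div_eq_div_mul]
    refine ih (v / 4) (by omega) (l + 1) (by omega) (fun g hg => ?_) n₁ ?_
    · rw [Nat.div_div_eq_div_mul, ← pow_succ'] at hg ⊢
      have := h (g + 1) hg
      rwa [show l + 1 + g = l + (g + 1) by ring]
    -- The block of `v / 4` ends before that of `v` begins because `2 * (v / 4 + 1) ≤ v` for `v ≥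
    -- 4`.
    · refine le_trans ?_ hn1
      rw [pow_succ, ← mul_assoc, mul_right_comm]
      exact Nat.mul_le_mul_right _ (by omega)

/-- An element that rises more than `j` levels is preceded in some level of the subtree of some
ancestor by at most one element that is not larger. -/
theorem exists_not_twoSmall (y : ℕ → E) (s j : ℕ)
    (h : j + 1 < (siftUp lt (Function.update (heapOf lt y s).cell s (some (y s))) s).2) :
    ∃ g, 1 ≤ (s + 1) / 2 ^ (j + 1) / 4 ^ g ∧
      ¬ TwoSmall lt y (y s) ((s + 1) / 2 ^ (j + 1) / 4 ^ g) (j + g) := by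
  by_contra! hcon
  obtain ⟨h1, h2⟩ := lt_of_lt_siftUp_cost _ s (j + 1) (by omega) h
  have hle := Nat.div_mul_le_self (s + 1) (2 ^ (j + 1))
  -- For the ancestor `v` that lies `j + 1` levels up, level `j` of its subtree is complete before
  -- insertion `s`, since `(v + 1) * 2 ^ j ≤ v * 2 ^ (j + 1) ≤ s + 1`.
  have hF := filled_of_twoSmall ((s + 1) / 2 ^ (j + 1)) j h1 hcon s (by
    refine le_trans ?_ hle
    generalize (s + 1) / 2 ^ (j + 1) = v at h1
    rw [pow_succ, ← mul_assoc, mul_right_comm]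
    exact Nat.mul_le_mul_right _ (by omega))
  have hpow : 2 ≤ 2 ^ (j + 1) := by
    simpa using Nat.pow_le_pow_right (n := 2) (by norm_num) (by omega : 1 ≤ j + 1)
  have hlt : (s + 1) / 2 ^ (j + 1) - 1 < s := by
    have : (s + 1) / 2 ^ (j + 1) ≤ (s + 1) / 2 := Nat.div_le_div_left hpow (by norm_num)
    omega
  rw [Function.update_self, Function.update_of_ne hlt.ne] at h2
  exact hF h2

-- The insertions into level `l` below `v` form an interval of times; the shift by one converts
-- between cells and one-based numbers.
omit [IsStrictWeakOrder E lt] in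
theorem card_le_one_of_not_twoSmall {ι : Type*} [DecidableEq ι] (z : ι → E) (π : ℕ → ι) (e : E)
    {v l : ℕ} (hv : 1 ≤ v) (h : ¬ TwoSmall lt (fun n => z (π n)) e v l) :
    (((Finset.Ico (v * 2 ^ l - 1) ((v + 1) * 2 ^ l - 1)).image π).filter
      fun b => ¬ lt e (z b)).card ≤ 1 := by
  by_contra hcard
  obtain ⟨b₁, b₂, h1, h2, hne⟩ := Finset.one_lt_card_iff.1 (not_le.1 hcard)
  simp only [Finset.mem_filter, Finset.mem_image, Finset.mem_Ico] at h1 h2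
  obtain ⟨⟨n₁, hn1, rfl⟩, hz1⟩ := h1
  obtain ⟨⟨n₂, hn2, rfl⟩, hz2⟩ := h2
  have hdiv : ∀ n, v * 2 ^ l - 1 ≤ n ∧ n < (v + 1) * 2 ^ l - 1 → (n + 1) / 2 ^ l = v := by
    intro n hn
    rw [Nat.div_eq_iff (by positivity)]
    have : (v + 1) * 2 ^ l = v * 2 ^ l + 2 ^ l := by ring
    have : 0 < 2 ^ l := by positivity
    have : 0 < v * 2 ^ l := by positivity
    omega
  rcases lt_trichotomy n₁ n₂ with hlt | heq | hlt
  · exact h ⟨n₁, n₂, hlt, hdiv _ hn1, hdiv _ hn2, hz1, hz2⟩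
  · exact hne (by rw [heq])
  · exact h ⟨n₂, n₁, hlt, hdiv _ hn2, hdiv _ hn1, hz2, hz1⟩

/-- In a weakly ordered finite family at most two members have at most one other member that is
not larger. -/
theorem card_low_rank_le {ι : Type*} [DecidableEq ι] (z : ι → E) (B : Finset ι) :
    (B.filter fun b => ((B.erase b).filter fun b' => ¬ lt (z b) (z b')).card ≤ 1).card ≤ 2 := by
  by_contra hcard
  obtain ⟨b₁, b₂, b₃, h1, h2, h3, h12, h13, h23⟩ := Finset.two_lt_card_iff.1 (not_le.1 hcard)
  simp only [Finset.mem_filter] at h1 h2 h3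
  have key : ∀ b c c', ((B.erase b).filter fun b' => ¬ lt (z b) (z b')).card ≤ 1 → c ∈ B →
      c' ∈ B → b ≠ c → b ≠ c' → c ≠ c' → ¬ lt (z b) (z c) → ¬ lt (z b) (z c') → False := by
    intro b c c' hb hc hc' hbc hbc' hcc' hl hl'
    refine absurd hb (not_le.2 (Finset.one_lt_card_iff.2 ⟨c, c', ?_, ?_, hcc'⟩))
    · simp [hc, hbc.symm, hl]
    · simp [hc', hbc'.symm, hl']
  have tot : ∀ a b : E, ¬ lt a b ∨ ¬ lt b a := fun a b => by
    by_contra! h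
    exact irrefl_of lt a (_root_.trans h.1 h.2)
  -- A largest one of three such members would have the other two not above it.
  rcases tot (z b₁) (z b₂) with h | h
  · rcases tot (z b₁) (z b₃) with h' | h'
    · exact key b₁ b₂ b₃ h1.2 h2.1 h3.1 h12 h13 h23 h h'
    · exact key b₃ b₁ b₂ h3.2 h1.1 h2.1 h13.symm h23.symm h12 h' (not_lt_trans_of_weak lt h h')
  · rcases tot (z b₂) (z b₃) with h' | h'
    · exact key b₂ b₁ b₃ h2.2 h1.1 h3.1 h12.symm h23 h13 h h'
    · exact key b₃ b₂ b₁ h3.2 h2.1 h1.1 h23.symm h13.symm h12.symm h'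
        (not_lt_trans_of_weak lt h h')

/-- In a random order, the probability that at most one element of `B` is not larger than a given
other element is at most `2 / (|B| + 1)`. -/
theorem card_perm_low_rank_le {ι : Type*} [DecidableEq ι] [Fintype ι] (x : ι → E) (B : Finset ι)
    {e₀ : ι} (he : e₀ ∉ B) :
    (Finset.univ.filter fun σ : Equiv.Perm ι =>
      (B.filter fun b => ¬ lt (x (σ e₀)) (x (σ b))).card ≤ 1).card * (B.card + 1)
      ≤ 2 * Fintype.card (Equiv.Perm ι) := by
  set low : Equiv.Perm ι → ι → Prop := fun σ b₀ =>
    ((((Insert.insert e₀ B).erase b₀).filter fun b => ¬ lt (x (σ b₀)) (x (σ b))).card ≤ 1) with hlow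
  have hsymm : ∀ b₀ ∈ Insert.insert e₀ B, (Finset.univ.filter fun σ => low σ b₀).card
      = (Finset.univ.filter fun σ => low σ e₀).card := by
    intro b₀ hb₀
    -- Composition with a transposition exchanges the roles of `e₀` and `b₀`, so all members of the
    -- block together with `e₀` are equally likely to be low. Double counting with at most two low
    -- members per permutation finishes the proof.
    refine Finset.card_equiv (Equiv.mulRight (Equiv.swap e₀ b₀)) fun σ => ?_
    simp only [Finset.mem_filter, Finset.mem_univ, true_and, hlow, Equiv.coe_mulRight,
      Equiv.Perm.mul_apply, Equiv.swap_apply_left]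
    have : (((Insert.insert e₀ B).erase b₀).filter fun b => ¬ lt (x (σ b₀)) (x (σ b))).card
        = (((Insert.insert e₀ B).erase e₀).filter fun b =>
          ¬ lt (x (σ b₀)) (x (σ (Equiv.swap e₀ b₀ b)))).card := by
      refine Finset.card_equiv (Equiv.swap e₀ b₀) fun b => ?_
      simp only [Finset.mem_filter, Finset.mem_erase, Equiv.swap_apply_self]
      refine and_congr_left' ?_
      have h1 : Equiv.swap e₀ b₀ b ≠ e₀ ↔ b ≠ b₀ := by
        rw [ne_eq, Equiv.swap_apply_eq_iff, Equiv.swap_apply_left]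
      rw [h1]
      refine and_congr_right fun hb => ?_
      by_cases hbe : b = e₀
      · subst hbe
        rw [Equiv.swap_apply_left]
        exact ⟨fun _ => hb₀, fun _ => Finset.mem_insert_self _ _⟩
      · rw [Equiv.swap_apply_of_ne_of_ne hbe hb]
    rw [this]
  have herase : (Insert.insert e₀ B).erase e₀ = B := Finset.erase_insert he
  have hcount : ∑ b₀ ∈ Insert.insert e₀ B, (Finset.univ.filter fun σ => low σ b₀).card
      = ∑ σ : Equiv.Perm ι, ((Insert.insert e₀ B).filter fun b₀ => low σ b₀).card := by
    simp only [Finset.card_filter]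
    exact Finset.sum_comm
  have h1 : ∑ b₀ ∈ Insert.insert e₀ B, (Finset.univ.filter fun σ => low σ b₀).card
      = (Finset.univ.filter fun σ : Equiv.Perm ι =>
      (B.filter fun b => ¬ lt (x (σ e₀)) (x (σ b))).card ≤ 1).card * (B.card + 1) := by
    rw [Finset.sum_congr rfl hsymm, Finset.sum_const, Finset.card_insert_of_notMem he, smul_eq_mul,
      mul_comm]
    simp only [hlow, herase]
  rw [← h1, hcount]
  calc _ ≤ ∑ σ : Equiv.Perm ι, 2 :=
        Finset.sum_le_sum fun σ _ => card_low_rank_le (fun i => x (σ i)) _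
    _ = _ := by simp [mul_comm]

/-- Inserting elements in random order into a binary heap takes constant expected time. -/
theorem sum_insert_cost_le {ι : Type*} [DecidableEq ι] [Fintype ι] (x : ι → E) (π : ℕ → ι) (s : ℕ)
    (hπ : Set.InjOn π (Set.Iic s)) :
    ∑ σ : Equiv.Perm ι, ((insert lt (x (σ (π s))) (heapOf lt (fun n => x (σ (π n))) s)).2 : ℝ)
      ≤ 10 * Fintype.card (Equiv.Perm ι) := by
  set P : ℝ := ((Fintype.card (Equiv.Perm ι) : ℕ) : ℝ) with hP
  set cost : Equiv.Perm ι → ℕ := fun σ => (siftUp lt (Function.update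
    (heapOf lt (fun n => x (σ (π n))) s).cell s (some (x (σ (π s))))) s).2 with hcost
  have hins : ∀ σ : Equiv.Perm ι, (insert lt (x (σ (π s)))
      (heapOf lt (fun n => x (σ (π n))) s)).2 = cost σ + 1 := by
    intro σ
    simp only [insert, heapOf_size, hcost]
  -- A crude cutoff that makes the sums over `j` and `g` finite; the geometric bounds are uniform in
  -- it.
  set N := s + 2
  have hcostN : ∀ σ, cost σ ≤ N := by
    intro σ
    have h1 := siftUp_cost_le lt (Function.update
      (heapOf lt (fun n => x (σ (π n))) s).cell s (some (x (σ (π s))))) s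
    have h2 := Nat.log_le_self 2 (s + 1)
    simp only [hcost]
    omega
  set v : ℕ → ℕ → ℕ := fun j g => (s + 1) / 2 ^ (j + 1) / 4 ^ g
  set bad : ℕ → ℕ → Equiv.Perm ι → Prop := fun j g σ => 1 ≤ v j g ∧
    ¬ TwoSmall lt (fun n => x (σ (π n))) (x (σ (π s))) (v j g) (j + g) with hbad
  classical
  have hsum : ∀ σ, (cost σ : ℝ) ≤ 1 + ∑ j ∈ Finset.range N, ∑ g ∈ Finset.range N,
      if bad j g σ then (1 : ℝ) else 0 := by
    intro σ
    have h1 : cost σ ≤ 1 + ((Finset.range N).filter fun j => j + 1 < cost σ).card := by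
      have : Finset.range (cost σ - 1) ⊆ (Finset.range N).filter fun j => j + 1 < cost σ := by
        intro j hj
        have := hcostN σ
        simp only [Finset.mem_range, Finset.mem_filter] at hj ⊢
        omega
      have := Finset.card_le_card this
      simp only [Finset.card_range] at this
      omega
    calc (cost σ : ℝ) ≤ 1 + (((Finset.range N).filter fun j => j + 1 < cost σ).card : ℝ) := by
          exact_mod_cast h1
      _ ≤ _ := by
          rw [Finset.card_filter, Nat.cast_sum]
          gcongr with j hj
          split
          · rename_i hj
            obtain ⟨g, hg1, hg2⟩ := exists_not_twoSmall (lt := lt) (fun n => x (σ (π n))) s j hj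
            -- For larger `g` the quotient by `4 ^ g` vanishes and there is no ancestor left.
            have hgN : g ∈ Finset.range N := by
              rw [Finset.mem_range]
              by_contra hgN
              have h3 : g < 4 ^ g := Nat.lt_pow_self (by norm_num)
              have h4 : (s + 1) / 2 ^ (j + 1) ≤ s + 1 := Nat.div_le_self _ _
              rw [Nat.div_eq_of_lt (by omega)] at hg1
              omega
            refine le_trans ?_ (Finset.single_le_sum (f := fun g => if bad j g σ then (1 : ℝ) else 0)
              (fun g _ => by positivity) hgN)
            rw [if_pos ⟨hg1, hg2⟩]
            simp
          · simp only [Nat.cast_zero]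
            positivity
  have hprob : ∀ j g, ((Finset.univ.filter fun σ => bad j g σ).card : ℝ)
      ≤ 2 * (1 / 2) ^ j * (1 / 2) ^ g * P := by
    intro j g
    by_cases hvjg : 1 ≤ v j g
    swap
    · rw [Finset.filter_eq_empty_iff.2 fun σ _ h => hvjg h.1]
      simp only [Finset.card_empty, Nat.cast_zero]
      positivity
    set I := Finset.Ico (v j g * 2 ^ (j + g) - 1) ((v j g + 1) * 2 ^ (j + g) - 1) with hI
    -- The block precedes `s`, because `v + 1 ≤ 2 * v` and `2 ^ g ≤ 4 ^ g`. Hence `π s` is not among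
    -- its indices.
    have hIs : ∀ n ∈ I, n < s := by
      intro n hn
      simp only [hI, Finset.mem_Ico] at hn
      have h1 : v j g * 4 ^ g * 2 ^ (j + 1) ≤ s + 1 :=
        (Nat.mul_le_mul_right _ (Nat.div_mul_le_self _ _)).trans (Nat.div_mul_le_self _ _)
      have h2 : (v j g + 1) * 2 ^ (j + g) ≤ v j g * 4 ^ g * 2 ^ (j + 1) := by
        have h3 : 2 ^ g ≤ 4 ^ g := Nat.pow_le_pow_left (by norm_num) g
        calc (v j g + 1) * 2 ^ (j + g) ≤ (2 * v j g) * (2 ^ j * 2 ^ g) := by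
              rw [pow_add]; exact Nat.mul_le_mul_right _ (by omega)
          _ ≤ (2 * v j g) * (2 ^ j * 4 ^ g) := by gcongr
          _ = _ := by ring
      omega
    have hinj : Set.InjOn π I := hπ.mono fun n hn => (hIs n hn).le
    have hcard : (I.image π).card = 2 ^ (j + g) := by
      rw [Finset.card_image_of_injOn hinj, hI, Nat.card_Ico]
      have : (v j g + 1) * 2 ^ (j + g) = v j g * 2 ^ (j + g) + 2 ^ (j + g) := by ring
      have : 0 < v j g * 2 ^ (j + g) := by positivity
      generalize 2 ^ (j + g) = w at *
      omega
    have hnot : π s ∉ I.image π := by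
      simp only [Finset.mem_image, not_exists, not_and]
      intro n hn hns
      have := hIs n hn
      have := hπ this.le (Set.mem_Iic.2 le_rfl) hns
      omega
    have h1 := card_perm_low_rank_le (lt := lt) x (I.image π) hnot
    rw [hcard] at h1
    have h2 : (Finset.univ.filter fun σ => bad j g σ).card ≤
        (Finset.univ.filter fun σ : Equiv.Perm ι =>
          ((I.image π).filter fun b => ¬ lt (x (σ (π s))) (x (σ b))).card ≤ 1).card := by
      refine Finset.card_le_card fun σ hσ => ?_
      simp only [Finset.mem_filter, Finset.mem_univ, true_and] at hσ ⊢
      exact card_le_one_of_not_twoSmall (fun i => x (σ i)) π _ hvjg hσ.2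
    have h3 : ((Finset.univ.filter fun σ => bad j g σ).card : ℝ) * 2 ^ (j + g) ≤ 2 * P := by
      rw [hP]
      exact_mod_cast ((Nat.mul_le_mul h2 (Nat.le_succ _)).trans h1)
    calc _ = ((Finset.univ.filter fun σ => bad j g σ).card : ℝ) * 2 ^ (j + g)
          * ((1 / 2) ^ j * (1 / 2) ^ g) := by
          rw [← pow_add, mul_assoc, ← mul_pow]; norm_num
      _ ≤ 2 * P * ((1 / 2) ^ j * (1 / 2) ^ g) := by gcongr
      _ = _ := by ring
  have hgeo : ∑ j ∈ Finset.range N, ((1 : ℝ) / 2) ^ j ≤ 2 := sum_geometric_two_le N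
  have hgeo0 : 0 ≤ ∑ j ∈ Finset.range N, ((1 : ℝ) / 2) ^ j := by positivity
  calc _ = ∑ σ : Equiv.Perm ι, ((cost σ : ℝ) + 1) := by
        refine Finset.sum_congr rfl fun σ _ => ?_
        rw [hins σ]; push_cast; rfl
    _ ≤ ∑ σ : Equiv.Perm ι, (2 + ∑ j ∈ Finset.range N, ∑ g ∈ Finset.range N,
        if bad j g σ then (1 : ℝ) else 0) :=
        Finset.sum_le_sum fun σ _ => by linarith [hsum σ]
    _ = 2 * P + ∑ j ∈ Finset.range N, ∑ g ∈ Finset.range N,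
        ((Finset.univ.filter fun σ => bad j g σ).card : ℝ) := by
        rw [Finset.sum_add_distrib, Finset.sum_comm]
        congr 1
        · simp [hP, mul_comm]
        · refine Finset.sum_congr rfl fun j _ => ?_
          rw [Finset.sum_comm]
          refine Finset.sum_congr rfl fun g _ => ?_
          rw [Finset.card_filter]
          push_cast
          rfl
    _ ≤ 2 * P + ∑ j ∈ Finset.range N, ∑ g ∈ Finset.range N,
        2 * (1 / 2) ^ j * (1 / 2) ^ g * P := by
        gcongr with j _ g _
        exact hprob j g
    _ = 2 * P + 2 * P * ((∑ j ∈ Finset.range N, ((1 : ℝ) / 2) ^ j)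
        * ∑ g ∈ Finset.range N, ((1 : ℝ) / 2) ^ g) := by
        rw [Finset.sum_mul_sum, Finset.mul_sum]
        congr 1
        refine Finset.sum_congr rfl fun j _ => ?_
        rw [Finset.mul_sum]
        refine Finset.sum_congr rfl fun g _ => ?_
        ring
    -- Two for the fixed costs of the insertion, and `2 * 2 * 2` from the two geometric series with
    -- the factor of the rank bound.
    _ ≤ 2 * P + 2 * P * (2 * 2) := by gcongr
    _ = _ := by ring

end BinaryHeap

/-! ### The single access of an operation to its internal queue. -/

namespace MultiQueue

variable {E : Type u} {p m : ℕ}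

namespace System

variable (S : System E p m)

theorem tsum_critical_le (ω : Draws p m) (t : Fin p) (k : ℕ) :
    ∑' n, ind (S.Active ω t k n ∧ ∃ i, ((S.config ω n).thread t).phase = .critical i) ≤ 1 := by
  refine (tsum_ind_le ?_).trans (ind_le_one _)
  rintro n n' ⟨h1, i, hi⟩ ⟨h2, i', hi'⟩
  refine S.active_unique h1 h2 ?_
  have e1 : ((S.config ω n).thread t).done = k := h1.1.2
  have e2 : ((S.config ω n').thread t).done = k := h2.1.2
  simp [Thread.view, hi, hi', e1, e2, Phase.view, viewRank]

theorem queueCost_eq_zero {c : Config S.Q p m} {t : Fin p}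
    (h : ¬ ∃ i, (c.thread t).phase = .critical i) : S.queueCost c t = 0 := by
  unfold queueCost
  split
  · rename_i hph; exact absurd ⟨_, hph⟩ h
  · rename_i hph; exact absurd ⟨_, hph⟩ h
  · rfl

/-- An operation accesses the internal queue only once. -/
theorem tsum_queueCost_le {ω : Draws p m} {t : Fin p} {k : ℕ} (L : ℝ≥0∞)
    (h : ∀ n, S.Active ω t k n → (∃ i, ((S.config ω n).thread t).phase = .critical i) →
      (S.queueCost (S.config ω n) t : ℝ≥0∞) ≤ L) :
    ∑' n, ind (S.Active ω t k n) * S.queueCost (S.config ω n) t ≤ L := by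
  calc _ ≤ ∑' n, ind (S.Active ω t k n ∧
        ∃ i, ((S.config ω n).thread t).phase = .critical i) * L := by
        refine ENNReal.tsum_le_tsum fun n => ?_
        by_cases hA : S.Active ω t k n
        swap
        · rw [ind_of_not hA, zero_mul]; exact zero_le
        by_cases hc : ∃ i, ((S.config ω n).thread t).phase = .critical i
        · rw [ind_of hA, ind_of ⟨hA, hc⟩, one_mul, one_mul]
          exact h n hA hc
        · rw [S.queueCost_eq_zero hc]; simp
    _ ≤ 1 * L := by
        rw [ENNReal.tsum_mul_right]
        exact mul_le_mul' (S.tsum_critical_le ω t k) le_rfl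
    _ = L := one_mul L

theorem measurable_tsum_queueCost [NeZero m] (t : Fin p) (k : ℕ) :
    Measurable fun ω => ∑' n, ind (S.Active ω t k n) * (S.queueCost (S.config ω n) t : ℝ≥0∞) := by
  refine Measurable.tsum fun n => ?_
  have := (FinDep.comp₂ (S.finDep_active n t k fun _ => True)
    (S.finDep_config n fun c _ => S.queueCost c t) fun P (y : ℕ) => ind P * (y : ℝ≥0∞)).measurable
  simpa using this

theorem sizeAtAccess_eq {ω : Draws p m} {t : Fin p} {k n : ℕ} (hA : S.Active ω t k n)
    (hc : ∃ i, ((S.config ω n).thread t).phase = .critical i) :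
    S.sizeAtAccess t k ω = S.numElements (S.config ω n) := by
  classical
  have hex : ∃ n, S.AccessAt ω t k n := ⟨n, hA.1, hc⟩
  unfold sizeAtAccess
  rw [dif_pos hex]
  obtain ⟨h1, i, hi⟩ := Nat.find_spec hex
  obtain ⟨i', hi'⟩ := hc
  have : Nat.find hex = n := by
    refine S.active_unique ⟨h1, hA.2⟩ hA ?_
    have e1 := h1.2
    have e2 := hA.1.2
    simp [Thread.view, hi, hi', e1, e2, Phase.view, viewRank]
  rw [← this]

end System

/-! ### Runs that consist of insertions -/

/-- Queues that record the order of insertions. -/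
def listPQ (I : Type u) : InternalPQ I where
  State := List I
  empty := []
  size := List.length
  insert e q := (q ++ [e], 0)
  deleteMin q := ((q, none), 0)
  findMin _ := (none, 0)

/-- The insertion-only MultiQueue that records the order of insertions. -/
abbrev recordSystem (d : ℕ) (q : Fin p → ℕ) (sched : List (ControlView p m) → Fin p) :
    System (Σ t, Fin (q t)) p m :=
  ⟨listPQ _, fun _ _ => False, fun _ _ => isFalse id, d, insertions id,
    fun h => sched (h.map FullView.control)⟩

/-- The phase without the minimum that was read at the best candidate. -/
def Phase.erase : Phase E m → Phase Unit m
  | .select a j _ => .select a j none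
  | .tryLock a i => .tryLock a i
  | .critical i => .critical i
  | .unlock i => .unlock i

theorem Phase.view_erase (ph : Phase E m) : ph.erase.view = ph.view := by cases ph <;> rfl

theorem insertions_getElem? {q : Fin p → ℕ} (x : (Σ t, Fin (q t)) → E) (t : Fin p) (k : ℕ) :
    (insertions x t)[k]? = if h : k < q t then some (Op.insert (x ⟨t, k, h⟩)) else none := by
  simp [insertions, List.getElem?_ofFn]

variable (lt : E → E → Prop) [DecidableRel lt] {q : Fin p → ℕ} (y : (Σ t, Fin (q t)) → E) (d : ℕ)
  (sched : List (ControlView p m) → Fin p)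

/-- The heap that is built by inserting the elements with the recorded indices. -/
def heapOfList {I : Type*} (y : I → E) (l : List I) : BinaryHeap E :=
  l.foldl (fun h e => (BinaryHeap.insert lt (y e) h).1) ⟨0, fun _ => none⟩

/-- The insertion-only MultiQueue with binary heaps whose scheduler sees only the control
states. -/
abbrev insertSystem : System E p m :=
  ⟨BinaryHeap.pq lt, lt, inferInstance, d, insertions y,
    fun h => sched (h.map FullView.control)⟩

/-- The indices that are recorded for queue `i`. -/
def records (c : Config (listPQ (Σ t, Fin (q t))) p m) (i : Fin m) : List (Σ t, Fin (q t)) :=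
  c.queue i

/-- A configuration with binary heaps that corresponds to a configuration with records. -/
structure Simulates (c : Config (BinaryHeap.pq lt) p m)
    (c' : Config (listPQ (Σ t, Fin (q t))) p m) : Prop where
  locked : c.locked = c'.locked
  done : ∀ t, (c.thread t).done = (c'.thread t).done
  erase : ∀ t, (c.thread t).phase.erase = (c'.thread t).phase.erase
  queue : ∀ i, c.queue i = heapOfList lt y (records c' i)

variable {lt y}

theorem Simulates.control_eq {c : Config (BinaryHeap.pq lt) p m}
    {c' : Config (listPQ (Σ t, Fin (q t))) p m} (h : Simulates lt y c c') :
    c.view.control = c'.view.control := by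
  unfold Config.view
  simp only [h.locked]
  congr 1
  funext t
  rw [h.done t, ← Phase.view_erase, h.erase t, Phase.view_erase]

variable {d sched}

/-- Insertions never read a minimum, so control flow, locks and chosen queues do not depend on the
elements; only the access touches a heap, and there the record grows by the same index. -/
theorem Simulates.step {c : Config (BinaryHeap.pq lt) p m}
    {c' : Config (listPQ (Σ t, Fin (q t))) p m} (h : Simulates lt y c c') (ω : Draws p m)
    (t : Fin p) : Simulates lt y ((insertSystem lt y d sched).step ω t c).1
      ((recordSystem d q sched).step ω t c').1 := by
  have hd := h.done t
  have he := h.erase t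
  by_cases hk : (c.thread t).done < q t
  swap
  · rw [System.step_of_none, System.step_of_none]
    · exact h
    · change (insertions id t)[_]? = none
      rw [insertions_getElem?, dif_neg (by rw [← hd]; exact hk)]
    · change (insertions y t)[_]? = none
      rw [insertions_getElem?, dif_neg hk]
  have hk' : (c'.thread t).done < q t := hd ▸ hk
  have hop : (insertions y t)[(c.thread t).done]?
      = some (Op.insert (y ⟨t, (c.thread t).done, hk⟩)) := by
    rw [insertions_getElem?, dif_pos hk]
  have hop' : (insertions id t)[(c'.thread t).done]?
      = some (Op.insert ⟨t, (c.thread t).done, hk⟩) := by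
    rw [insertions_getElem?, dif_pos hk']
    simp [hd]
  rw [System.step_fst, System.step_fst]
  have hupd : ∀ (th : Thread E m) (th' : Thread (Σ t, Fin (q t)) m), th.done = th'.done →
      th.phase.erase = th'.phase.erase →
      (∀ s, (Function.update c.thread t th s).done = (Function.update c'.thread t th' s).done) ∧
      (∀ s, (Function.update c.thread t th s).phase.erase
        = (Function.update c'.thread t th' s).phase.erase) := by
    intro th th' h1 h2
    constructor <;> intro s <;> by_cases hs : s = t
    · subst hs; simpa using h1
    · simpa [Function.update_of_ne hs] using h.done s
    · subst hs; simpa using h2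
    · simpa [Function.update_of_ne hs] using h.erase s
  cases hph : (c.thread t).phase <;> cases hph' : (c'.thread t).phase <;>
    simp only [hph, hph', Phase.erase, reduceCtorEq, Phase.select.injEq, Phase.tryLock.injEq,
      Phase.critical.injEq, Phase.unlock.injEq, and_true] at he
  · obtain ⟨rfl, rfl⟩ := he
    simp only [System.localStep, hop, hop', hph, hph']
    refine ⟨h.locked, (hupd _ _ ?_ ?_).1, (hupd _ _ ?_ ?_).2, h.queue⟩ <;>
      first | exact hd | simp only [Phase.erase, hd]
  · obtain ⟨rfl, rfl⟩ := he
    simp only [System.localStep, hop, hop', hph, hph', h.locked]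
    split
    · refine ⟨rfl, (hupd _ _ ?_ ?_).1, (hupd _ _ ?_ ?_).2, h.queue⟩ <;> first | exact hd | rfl
    · refine ⟨rfl, (hupd _ _ ?_ ?_).1, (hupd _ _ ?_ ?_).2, h.queue⟩ <;> first | exact hd | rfl
  · subst he
    rename_i i
    simp only [System.localStep, hop, hop', hph, hph']
    refine ⟨h.locked, (hupd _ _ ?_ ?_).1, (hupd _ _ ?_ ?_).2, fun i' => ?_⟩
    · exact hd
    · rfl
    · exact hd
    · rfl
    · by_cases hi : i' = i
      · subst hi
        have e1 : heapOfList lt y (records c' i' ++ [⟨t, (c.thread t).done, hk⟩])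
            = (BinaryHeap.insert lt (y ⟨t, (c.thread t).done, hk⟩)
              (heapOfList lt y (records c' i'))).1 := by
          simp [heapOfList, List.foldl_append]
        simp only [records, Function.update_self]
        exact (congrArg (fun h => (BinaryHeap.insert lt (y ⟨t, (c.thread t).done, hk⟩) h).1)
          (h.queue i')).trans e1.symm
      · simp only [records, Function.update_of_ne hi]
        exact h.queue i'
  · subst he
    simp only [System.localStep, hop, hop', hph, hph', h.locked]
    refine ⟨rfl, (hupd _ _ ?_ ?_).1, (hupd _ _ ?_ ?_).2, h.queue⟩ <;>
      first | exact congrArg (· + 1) hd | rfl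

/-- The scheduler receives the same control history in both systems and so picks the same thread. As
the record system does not involve `y`, the schedule is the same for all assignments of elements. -/
theorem simulates_config (ω : Draws p m) (n : ℕ) :
    Simulates lt y ((insertSystem lt y d sched).config ω n) ((recordSystem d q sched).config ω n) ∧
      ((insertSystem lt y d sched).exec ω n).2.map FullView.control
        = ((recordSystem d q sched).exec ω n).2.map FullView.control := by
  induction n with
  | zero =>
    have h : Simulates lt y ((insertSystem lt y d sched).config ω 0)
        ((recordSystem d q sched).config ω 0) := ⟨rfl, fun _ => rfl, fun _ => rfl, fun _ => rfl⟩
    refine ⟨h, ?_⟩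
    change [_] = [_]
    rw [List.singleton_inj]
    exact h.control_eq
  | succ n ih =>
    obtain ⟨h1, h2⟩ := ih
    have hact : (insertSystem lt y d sched).actor ω n = (recordSystem d q sched).actor ω n :=
      congrArg sched h2
    have h3 : Simulates lt y ((insertSystem lt y d sched).config ω (n + 1))
        ((recordSystem d q sched).config ω (n + 1)) := by
      rw [System.config_succ, System.config_succ, hact]
      exact h1.step ω _
    refine ⟨h3, ?_⟩
    change _ :: _ = _ :: _
    rw [h2]
    congr 1
    exact h3.control_eq

theorem actor_eq (ω : Draws p m) (n : ℕ) :
    (insertSystem lt y d sched).actor ω n = (recordSystem d q sched).actor ω n :=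
  congrArg sched (simulates_config ω n).2

theorem active_iff (ω : Draws p m) (t : Fin p) (k n : ℕ) :
    (insertSystem lt y d sched).Active ω t k n ↔ (recordSystem d q sched).Active ω t k n := by
  unfold System.Active System.StepOf
  rw [actor_eq, (simulates_config ω n).1.done t]
  refine and_congr_right fun _ => not_congr ?_
  change (insertions y t)[k]? = none ↔ (insertions id t)[k]? = none
  rw [insertions_getElem?, insertions_getElem?]
  split <;> simp

/-- The recorded insertions are distinct and have been performed. -/
def RecordInv (c : Config (listPQ (Σ t, Fin (q t))) p m) : Prop :=
  ∀ i, (records c i).Nodup ∧ ∀ e ∈ records c i, (e.2 : ℕ) < (c.thread e.1).done ∨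
    (e.2 : ℕ) = (c.thread e.1).done ∧ ∃ i', (c.thread e.1).phase = .unlock i'

/-- An index is recorded before its operation counts as completed; the alternative with the `unlock`
phase covers this gap and rules out recording the index twice. -/
theorem RecordInv.step {c : Config (listPQ (Σ t, Fin (q t))) p m} (h : RecordInv c)
    (ω : Draws p m) (t : Fin p) : RecordInv ((recordSystem d q sched).step ω t c).1 := by
  by_cases hk : (c.thread t).done < q t
  swap
  · rw [System.step_of_none]
    · exact h
    · change (insertions id t)[_]? = none
      rw [insertions_getElem?, dif_neg hk]
  have hop : (insertions id t)[(c.thread t).done]?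
      = some (Op.insert ⟨t, (c.thread t).done, hk⟩) := by
    rw [insertions_getElem?, dif_pos hk]
    rfl
  rw [System.step_fst]
  have hsame : ∀ (l : Fin m → Bool) (th : Thread (Σ t, Fin (q t)) m),
      (∀ k, (k < (c.thread t).done ∨ k = (c.thread t).done ∧
        ∃ i', (c.thread t).phase = .unlock i') → k < th.done) →
      RecordInv { queue := c.queue, locked := l, thread := Function.update c.thread t th } := by
    intro l th hth i
    refine ⟨(h i).1, fun e he => ?_⟩
    have h1 := (h i).2 e he
    obtain ⟨t', k⟩ := e
    by_cases ht : t' = t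
    · subst ht
      simp only [Function.update_self]
      exact Or.inl (hth _ h1)
    · simpa only [Function.update_of_ne ht] using h1
  cases hph : (c.thread t).phase with
  | select a j b =>
    simp only [System.localStep, hop, hph]
    refine hsame _ _ fun k hk => ?_
    simpa [hph] using hk
  | tryLock a i =>
    simp only [System.localStep, hop, hph]
    split
    · refine hsame _ _ fun k hk => ?_
      simpa [hph] using hk
    · refine hsame _ _ fun k hk => ?_
      simpa [hph] using hk
  | unlock i =>
    simp only [System.localStep, hop, hph]
    refine hsame _ _ fun k hk => ?_
    simp only
    omega
  | critical i =>
    simp only [System.localStep, hop, hph]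
    intro i'
    have hold : ∀ i₁, ∀ e ∈ records c i₁, (e.2 : ℕ) <
        (Function.update c.thread t { c.thread t with phase := .unlock i } e.1).done ∨
        (e.2 : ℕ) = (Function.update c.thread t { c.thread t with phase := .unlock i } e.1).done ∧
        ∃ i', (Function.update c.thread t
          { c.thread t with phase := .unlock i } e.1).phase = .unlock i' := by
      intro i₁ e he
      have h1 := (h i₁).2 e he
      obtain ⟨t', k⟩ := e
      by_cases ht : t' = t
      · subst ht
        simp only [Function.update_self]
        rcases h1 with h1 | ⟨h1, -⟩
        · exact Or.inl h1
        · exact Or.inr ⟨h1, i, rfl⟩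
      · simpa only [Function.update_of_ne ht] using h1
    by_cases hi : i' = i
    swap
    · unfold records
      simp only [Function.update_of_ne hi]
      exact ⟨(h i').1, hold i'⟩
    subst hi
    unfold records
    simp only [Function.update_self]
    change (records c i' ++ [_]).Nodup ∧ ∀ e ∈ records c i' ++ [_], _
    refine ⟨?_, fun e he => ?_⟩
    · refine List.Nodup.append (h i').1 (List.nodup_singleton _) ?_
      rw [List.disjoint_singleton]
      intro he
      rcases (h i').2 _ he with h1 | ⟨-, i'', h1⟩
      · exact lt_irrefl _ h1
      · simp only at h1
        rw [hph] at h1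
        cases h1
    · rcases List.mem_append.1 he with he | he
      · exact hold i' e he
      · rw [List.mem_singleton] at he
        subst he
        right
        simp

theorem recordInv_config (ω : Draws p m) (n : ℕ) :
    RecordInv ((recordSystem d q sched).config ω n) := by
  induction n with
  | zero => exact fun i => ⟨List.nodup_nil, fun e he => by cases he⟩
  | succ n ih => rw [System.config_succ]; exact ih.step ω _

theorem heapOfList_eq {I : Type*} (y : I → E) (l : List I) (f : ℕ → I)
    (hf : ∀ n (h : n < l.length), f n = l[n]) :
    heapOfList lt y l = BinaryHeap.heapOf lt (fun n => y (f n)) l.length := by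
  induction l using List.reverseRecOn with
  | nil => rfl
  | append_singleton l e ih =>
    rw [List.length_append, List.length_singleton, BinaryHeap.heapOf, ← ih fun n h => ?_]
    · rw [hf l.length (by simp)]
      simp [heapOfList, List.foldl_append]
    · rw [hf n (by simp; omega), List.getElem_append_left]

/-- The average time of an insertion within its binary heap over all orders of the elements. -/
theorem sum_tsum_queueCost_le [IsStrictWeakOrder E lt] (x : (Σ t, Fin (q t)) → E) (ω : Draws p m)
    (t : Fin p) (k : ℕ) :
    ∑ σ : Equiv.Perm (Σ t, Fin (q t)),
      ∑' n, ind ((insertSystem lt (x ∘ σ) d sched).Active ω t k n) *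
        ((insertSystem lt (x ∘ σ) d sched).queueCost
          ((insertSystem lt (x ∘ σ) d sched).config ω n) t : ℝ≥0∞)
      ≤ 10 * Fintype.card (Equiv.Perm (Σ t, Fin (q t))) := by
  set R := recordSystem d q sched
  rw [← Summable.tsum_finsetSum fun _ _ => ENNReal.summable]
  have key : ∀ n, R.Active ω t k n → (∃ i, ((R.config ω n).thread t).phase = .critical i) →
      ∑ σ : Equiv.Perm (Σ t, Fin (q t)), ((insertSystem lt (x ∘ σ) d sched).queueCost
          ((insertSystem lt (x ∘ σ) d sched).config ω n) t : ℝ≥0∞)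
      ≤ 10 * Fintype.card (Equiv.Perm (Σ t, Fin (q t))) := by
    rintro n hA ⟨i, hi⟩
    have hk : ((R.config ω n).thread t).done < q t := by
      by_contra hk
      refine hA.2 ?_
      change (insertions id t)[_]? = none
      rw [insertions_getElem?, dif_neg (by rw [← hA.1.2]; exact hk)]
    set e : Σ t, Fin (q t) := ⟨t, ((R.config ω n).thread t).done, hk⟩
    set l := records (R.config ω n) i
    -- `f` lists the insertions into queue `i` with the current one at position `l.length`; the
    -- default value beyond that is irrelevant.
    set f : ℕ → Σ t, Fin (q t) := fun n => (l ++ [e]).getD n e with hf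
    have hnodup : (l ++ [e]).Nodup := by
      refine List.Nodup.append ((recordInv_config ω n) i).1 (List.nodup_singleton _) ?_
      rw [List.disjoint_singleton]
      intro he
      rcases ((recordInv_config ω n) i).2 _ he with h1 | ⟨-, i', h1⟩
      · exact lt_irrefl _ h1
      · have h2 : ((R.config ω n).thread t).phase = .unlock i' := h1
        rw [hi] at h2
        cases h2
    have hfl : ∀ n (h : n < l.length), f n = l[n] := by
      intro n h
      simp only [hf]
      rw [List.getD_eq_getElem _ _ (by simp; omega), List.getElem_append_left h]
    have hfe : f l.length = e := by
      simp only [hf]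
      rw [List.getD_eq_getElem _ _ (by simp)]
      simp
    have hinj : Set.InjOn f (Set.Iic l.length) := by
      intro a ha b hb hab
      simp only [Set.mem_Iic] at ha hb
      simp only [hf] at hab
      rw [List.getD_eq_getElem _ _ (by simp; omega),
        List.getD_eq_getElem _ _ (by simp; omega)] at hab
      exact (List.Nodup.getElem_inj_iff hnodup).1 hab
    have hmain := BinaryHeap.sum_insert_cost_le (lt := lt) x f l.length hinj
    rw [hfe] at hmain
    have hcost : ∀ σ : Equiv.Perm (Σ t, Fin (q t)), (insertSystem lt (x ∘ σ) d sched).queueCost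
          ((insertSystem lt (x ∘ σ) d sched).config ω n) t
        = (BinaryHeap.insert lt (x (σ e))
          (BinaryHeap.heapOf lt (fun n => x (σ (f n))) l.length)).2 := by
      intro σ
      have hsim := (simulates_config (lt := lt) (y := x ∘ σ) (d := d) (sched := sched) ω n).1
      have hph : (((insertSystem lt (x ∘ σ) d sched).config ω n).thread t).phase
          = .critical i := by
        have h1 := hsim.erase t
        rw [hi] at h1
        cases hc : (((insertSystem lt (x ∘ σ) d sched).config ω n).thread t).phase <;>
          rw [hc] at h1 <;> simp only [Phase.erase, reduceCtorEq, Phase.critical.injEq] at h1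
        rw [h1]
      have hop : ((insertSystem lt (x ∘ σ) d sched).ops t)[
          (((insertSystem lt (x ∘ σ) d sched).config ω n).thread t).done]?
          = some (Op.insert (x (σ e))) := by
        rw [hsim.done t]
        change (insertions (x ∘ σ) t)[_]? = _
        rw [insertions_getElem?, dif_pos hk]
        rfl
      unfold System.queueCost
      simp only [hop, hph]
      rw [hsim.queue i]
      change (BinaryHeap.insert lt (x (σ e)) (heapOfList lt (x ∘ σ) l)).2 = _
      rw [heapOfList_eq (lt := lt) (x ∘ σ) l f hfl]
      rfl
    simp only [hcost]
    exact_mod_cast hmain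
  calc _ ≤ ∑' n, ind (R.Active ω t k n ∧ ∃ i, ((R.config ω n).thread t).phase = .critical i) *
        (10 * (Fintype.card (Equiv.Perm (Σ t, Fin (q t))) : ℝ≥0∞)) := by
        refine ENNReal.tsum_le_tsum fun n => ?_
        simp only [active_iff]
        rw [← Finset.mul_sum]
        by_cases hA : R.Active ω t k n
        swap
        · rw [ind_of_not hA, zero_mul]; exact zero_le
        by_cases hc : ∃ i, ((R.config ω n).thread t).phase = .critical i
        · rw [ind_of hA, ind_of ⟨hA, hc⟩, one_mul, one_mul]
          exact key n hA hc
        · rw [Finset.sum_eq_zero fun σ _ => ?_]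
          · rw [mul_zero]; exact zero_le
          rw [System.queueCost_eq_zero]
          · simp
          rintro ⟨i, hi⟩
          have h1 := (simulates_config (lt := lt) (y := x ∘ σ) (d := d) (sched := sched)
            ω n).1.erase t
          rw [hi] at h1
          refine hc ⟨i, ?_⟩
          cases hc : ((R.config ω n).thread t).phase <;>
            rw [hc] at h1 <;> simp only [Phase.erase, reduceCtorEq, Phase.critical.injEq] at h1
          rw [h1]
    _ ≤ _ := by
        rw [ENNReal.tsum_mul_right]
        exact (mul_le_mul' (R.tsum_critical_le ω t k) le_rfl).trans_eq (one_mul _)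

end MultiQueue

/-! ### Constants depending on `c` and `d`, and the three bounds. -/

namespace MultiQueue

/-- The bound `overhead p m d` for `m = c * p`. -/
noncomputable def overheadConst (c : ℝ) (d : ℕ) : ℝ≥0∞ :=
  (2 + d * ENNReal.ofReal c⁻¹) * (d + 1) * ((1 - ENNReal.ofReal c⁻¹) ^ d)⁻¹
    + 2 * (1 + d * ENNReal.ofReal c⁻¹)

/-- `c > 1` leaves a positive fraction of queues unlocked, so the geometric series of attempts
converges. -/
theorem overheadConst_ne_top {c : ℝ} (hc : 1 < c) (d : ℕ) : overheadConst c d ≠ ⊤ := by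
  have h1 : ENNReal.ofReal c⁻¹ < 1 := by
    rw [← ENNReal.ofReal_one, ENNReal.ofReal_lt_ofReal_iff one_pos]
    exact inv_lt_one_of_one_lt₀ hc
  have h2 : ((1 - ENNReal.ofReal c⁻¹) ^ d)⁻¹ ≠ ⊤ :=
    ENNReal.inv_ne_top.2 (pow_ne_zero _ (tsub_pos_of_lt h1).ne')
  unfold overheadConst
  finiteness

/-- The existence of a thread `t` gives `p > 0`, so `p / m` is `c⁻¹`. -/
theorem overhead_eq {c : ℝ} (hc : 1 < c) (d : ℕ) {p m : ℕ} (t : Fin p) (hm : (m : ℝ) = c * p) :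
    System.overhead p m d = overheadConst c d := by
  have hp : 0 < (p : ℝ) := by exact_mod_cast t.pos
  have hm0 : 0 < (m : ℝ) := by rw [hm]; positivity
  have h1 : (p : ℝ≥0∞) * (m : ℝ≥0∞)⁻¹ = ENNReal.ofReal c⁻¹ := by
    rw [← ENNReal.ofReal_natCast p, ← ENNReal.ofReal_natCast m, ← ENNReal.ofReal_inv_of_pos hm0,
      ← ENNReal.ofReal_mul hp.le, hm]
    congr 1
    field_simp
  unfold System.overhead System.failBound overheadConst
  rw [h1, ENNReal.sub_sub_cancel ENNReal.one_ne_top (pow_le_one₀ zero_le tsub_le_self)]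

end MultiQueue

namespace MultiQueue

theorem exists_average_insertion_bound {c : ℝ} (hc : 1 < c) {d : ℕ} (hd : 2 ≤ d) :
    ∃ C : ℝ, 0 < C ∧
      ∀ (p m : ℕ) [NeZero m], (m : ℝ) = c * p →
      ∀ (E : Type u) (lt : E → E → Prop) [IsStrictWeakOrder E lt] [DecidableRel lt]
        (q : Fin p → ℕ) (x : (Σ t, Fin (q t)) → E)
        (sched : List (ControlView p m) → Fin p) (t : Fin p) (k : Fin (q t)),
      (∑ σ : Equiv.Perm (Σ t, Fin (q t)),
          ∫⁻ ω, (heapSystem lt d (insertions (x ∘ σ))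
            (fun h => sched (h.map FullView.control))).opTime t k ω ∂(drawLaw p m))
        / (Fintype.card (Equiv.Perm (Σ t, Fin (q t))) : ℝ≥0∞) ≤ ENNReal.ofReal C := by
  have hK := overheadConst_ne_top hc d
  set K := overheadConst c d
  refine ⟨(K + 10).toReal, ENNReal.toReal_pos (by simp) (by finiteness), ?_⟩
  intro p m _ hm E lt _ _ q x sched t k
  rw [ENNReal.ofReal_toReal (by finiteness)]
  set P := Fintype.card (Equiv.Perm (Σ t, Fin (q t)))
  rw [ENNReal.div_le_iff (by exact_mod_cast Fintype.card_ne_zero) (by simp)]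
  calc _ ≤ ∑ σ : Equiv.Perm (Σ t, Fin (q t)), (K + ∫⁻ ω, ∑' n,
        ind ((insertSystem lt (x ∘ σ) d sched).Active ω t k n) *
        ((insertSystem lt (x ∘ σ) d sched).queueCost
          ((insertSystem lt (x ∘ σ) d sched).config ω n) t : ℝ≥0∞) ∂(drawLaw p m)) := by
        refine Finset.sum_le_sum fun σ _ => ?_
        have h := (insertSystem lt (x ∘ σ) d sched).lintegral_opTime_le
          (lt_of_lt_of_le two_pos hd) (fun _ => le_rfl) t k
        rwa [overhead_eq hc d t hm] at h
    _ ≤ P * K + ∫⁻ _, 10 * (P : ℝ≥0∞) ∂(drawLaw p m) := by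
        rw [Finset.sum_add_distrib, Finset.sum_const, Finset.card_univ, nsmul_eq_mul,
          -- The sum over permutations moves inside the integral: the bound `10` on average holds
          -- for every fixed outcome of the draws.
          ← lintegral_finsetSum _ fun (σ : Equiv.Perm (Σ t, Fin (q t))) _ =>
            (insertSystem lt (x ∘ σ) d sched).measurable_tsum_queueCost t k]
        exact add_le_add le_rfl (lintegral_mono fun ω => sum_tsum_queueCost_le x ω t k)
    _ = (K + 10) * P := by
        simp only [lintegral_const, measure_univ, mul_one]
        ring

/-- One heap is no larger than the whole MultiQueue, and the additive `2` is absorbed since `logb 2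
(N + 2) ≥ 1`. -/
theorem heap_queueCost_le {E : Type u} {p m : ℕ} (lt : E → E → Prop) [DecidableRel lt] (d : ℕ)
    (ops : Fin p → List (Op E)) (sched : List (FullView (BinaryHeap.pq lt) p m) → Fin p)
    (c : Config (BinaryHeap.pq lt) p m) (t : Fin p) :
    ((heapSystem lt d ops sched).queueCost c t : ℝ)
      ≤ 3 * Real.logb 2 (((heapSystem lt d ops sched).numElements c : ℕ) + 2) := by
  set N := (heapSystem lt d ops sched).numElements c
  have h0 : 1 ≤ Real.logb 2 ((N : ℝ) + 2) := by
    rw [Real.le_logb_iff_rpow_le (by norm_num) (by positivity)]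
    have : (0 : ℝ) ≤ N := Nat.cast_nonneg _
    simp only [Real.rpow_one]
    linarith
  have hsize : ∀ i, (c.queue i).size ≤ N := fun i =>
    Finset.single_le_sum (f := fun i => (c.queue i).size) (fun _ _ => Nat.zero_le _)
      (Finset.mem_univ i)
  have hlog : ∀ i, (Nat.log 2 ((c.queue i).size + 2) : ℝ) + 2
      ≤ 3 * Real.logb 2 ((N : ℝ) + 2) := by
    intro i
    have h1 : (Nat.log 2 ((c.queue i).size + 2) : ℝ) ≤ Nat.log 2 (N + 2) := by
      exact_mod_cast Nat.log_mono_right (Nat.add_le_add_right (hsize i) 2)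
    have h2 := Real.natLog_le_logb (N + 2) 2
    push_cast at h2
    linarith
  unfold System.queueCost
  split
  · rename_i e i _ _
    refine le_trans ?_ (hlog i)
    exact_mod_cast BinaryHeap.insert_cost_le lt e (c.queue i)
  · rename_i i _ _
    refine le_trans ?_ (hlog i)
    exact_mod_cast BinaryHeap.deleteMin_cost_le lt (c.queue i)
  · simp only [Nat.cast_zero]
    linarith

theorem exists_heap_bound {c : ℝ} (hc : 1 < c) {d : ℕ} (hd : 2 ≤ d) :
    ∃ C : ℝ, 0 < C ∧
      ∀ (p m : ℕ) [NeZero m], (m : ℝ) = c * p →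
      ∀ (E : Type u) (lt : E → E → Prop) [IsStrictWeakOrder E lt] [DecidableRel lt]
        (ops : Fin p → List (Op E))
        (sched : List (FullView (BinaryHeap.pq lt) p m) → Fin p) (t : Fin p) (k : ℕ),
      ∫⁻ ω, (heapSystem lt d ops sched).opTime t k ω ∂(drawLaw p m)
        ≤ ENNReal.ofReal C * ∫⁻ ω, ENNReal.ofReal (Real.logb 2
            ((heapSystem lt d ops sched).sizeAtAccess t k ω + 2)) ∂(drawLaw p m) := by
  have hK := overheadConst_ne_top hc d
  set K := overheadConst c d
  refine ⟨(K + 3).toReal, ENNReal.toReal_pos (by simp) (by finiteness), ?_⟩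
  intro p m _ hm E lt _ _ ops sched t k
  rw [ENNReal.ofReal_toReal (by finiteness)]
  set S := heapSystem lt d ops sched
  set L : Draws p m → ℝ≥0∞ := fun ω => ENNReal.ofReal (Real.logb 2 (S.sizeAtAccess t k ω + 2))
  have hL : ∀ ω, 1 ≤ L ω := by
    intro ω
    rw [ENNReal.one_le_ofReal, Real.le_logb_iff_rpow_le (by norm_num) (by positivity)]
    have : (0 : ℝ) ≤ S.sizeAtAccess t k ω := Nat.cast_nonneg _
    simp only [Real.rpow_one]
    linarith
  have hcost : ∀ ω, ∑' n, ind (S.Active ω t k n) * (S.queueCost (S.config ω n) t : ℝ≥0∞)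
      ≤ 3 * L ω := by
    intro ω
    refine S.tsum_queueCost_le _ fun n hA hcrit => ?_
    have h1 := heap_queueCost_le lt d ops sched (S.config ω n) t
    have h2 := S.sizeAtAccess_eq hA hcrit
    calc (S.queueCost (S.config ω n) t : ℝ≥0∞)
        = ENNReal.ofReal (S.queueCost (S.config ω n) t : ℝ) := by simp
      _ ≤ ENNReal.ofReal (3 * Real.logb 2 (S.sizeAtAccess t k ω + 2)) := by
          rw [h2]; exact ENNReal.ofReal_le_ofReal h1
      _ = 3 * L ω := by
          rw [ENNReal.ofReal_mul (by norm_num)]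
          simp [L]
  calc _ ≤ K + ∫⁻ ω, ∑' n, ind (S.Active ω t k n) *
        (S.queueCost (S.config ω n) t : ℝ≥0∞) ∂(drawLaw p m) := by
        have h := S.lintegral_opTime_le (lt_of_lt_of_le two_pos hd) (fun _ => le_rfl) t k
        rwa [show S.d = d from rfl, overhead_eq hc d t hm] at h
    _ ≤ K * ∫⁻ ω, L ω ∂(drawLaw p m) + ∫⁻ ω, 3 * L ω ∂(drawLaw p m) := by
        refine add_le_add ?_ (lintegral_mono hcost)
        calc K = K * ∫⁻ _, 1 ∂(drawLaw p m) := by simp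
          _ ≤ _ := mul_le_mul' le_rfl (lintegral_mono hL)
    _ = (K + 3) * ∫⁻ ω, L ω ∂(drawLaw p m) := by
        rw [lintegral_const_mul' _ _ (by finiteness), add_mul]

theorem exists_veb_bound {c : ℝ} (hc : 1 < c) {d : ℕ} (hd : 2 ≤ d) :
    ∃ C : ℝ, 0 < C ∧
      ∀ (p m : ℕ) [NeZero m], (m : ℝ) = c * p →
      ∀ (U : ℕ), 4 ≤ U →
      ∀ (E : Type u) (key : E → Fin U) (ops : Fin p → List (Op E))
        (sched : List (FullView (VEB.pq key) p m) → Fin p) (t : Fin p) (k : ℕ),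
      ∫⁻ ω, (vebSystem key d ops sched).opTime t k ω ∂(drawLaw p m)
        ≤ ENNReal.ofReal (C * Real.logb 2 (Real.logb 2 U)) := by
  have hK := overheadConst_ne_top hc d
  set K := overheadConst c d
  refine ⟨(K + 8).toReal, ENNReal.toReal_pos (by simp) (by finiteness), ?_⟩
  intro p m _ hm U hU E key ops sched t k
  rw [ENNReal.ofReal_mul ENNReal.toReal_nonneg, ENNReal.ofReal_toReal (by finiteness)]
  set S := vebSystem key d ops sched
  set L := ENNReal.ofReal (Real.logb 2 (Real.logb 2 U))
  have hlog := VEB.one_le_logb_logb hU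
  have hL : 1 ≤ L := ENNReal.one_le_ofReal.2 hlog
  -- With `L ≥ 1`, the height bound gives `2 * (3 * L) + 2 ≤ 8 * L`.
  have hbound : ∀ n : ℕ, n ≤ 2 * VEB.height U + 2 → (n : ℝ≥0∞) ≤ 8 * L := by
    intro n hn
    have h1 := VEB.height_le hU
    have h2 : (n : ℝ) ≤ 2 * VEB.height U + 2 := by exact_mod_cast hn
    calc (n : ℝ≥0∞) = ENNReal.ofReal (n : ℝ) := by simp
      _ ≤ ENNReal.ofReal (8 * Real.logb 2 (Real.logb 2 U)) :=
          ENNReal.ofReal_le_ofReal (by linarith)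
      _ = 8 * L := by
          rw [ENNReal.ofReal_mul (by norm_num)]
          simp [L]
  have hcost : ∀ ω, ∑' n, ind (S.Active ω t k n) * (S.queueCost (S.config ω n) t : ℝ≥0∞)
      ≤ 8 * L := by
    intro ω
    refine S.tsum_queueCost_le _ fun n _ _ => hbound _ ?_
    unfold System.queueCost
    split
    · exact VEB.Queue.insert_cost_le key _ _
    · exact VEB.Queue.deleteMin_cost_le _
    · exact Nat.zero_le _
  have hfind : ∀ q, (S.Q.findMin q).2 ≤ 1 := by
    intro q
    change (VEB.Queue.findMin q).2 ≤ 1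
    unfold VEB.Queue.findMin
    split <;> exact le_rfl
  calc _ ≤ K + ∫⁻ ω, ∑' n, ind (S.Active ω t k n) *
        (S.queueCost (S.config ω n) t : ℝ≥0∞) ∂(drawLaw p m) := by
        have h := S.lintegral_opTime_le (lt_of_lt_of_le two_pos hd) hfind t k
        rwa [show S.d = d from rfl, overhead_eq hc d t hm] at h
    _ ≤ K * L + ∫⁻ _, 8 * L ∂(drawLaw p m) := by
        refine add_le_add ?_ (lintegral_mono hcost)
        calc K = K * 1 := (mul_one K).symm
          _ ≤ _ := mul_le_mul' le_rfl hL
    _ = (K + 8) * L := by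
        simp only [lintegral_const, measure_univ, mul_one, add_mul]

end MultiQueue

theorem mainTheorem2 (c : ℝ) (hc : 1 < c) (d : ℕ) (hd : 2 ≤ d) :
    -- binary heaps: constant average insertion time, that is, for elements in random order
    (∃ C : ℝ, 0 < C ∧
      ∀ (p m : ℕ) [NeZero m], (m : ℝ) = c * p →
      ∀ (E : Type u) (lt : E → E → Prop) [IsStrictWeakOrder E lt] [DecidableRel lt]
        (q : Fin p → ℕ) (x : (Σ t, Fin (q t)) → E)
        (sched : List (MultiQueue.ControlView p m) → Fin p) (t : Fin p) (k : Fin (q t)),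
      (∑ σ : Equiv.Perm (Σ t, Fin (q t)),
          ∫⁻ ω, (MultiQueue.heapSystem lt d (MultiQueue.insertions (x ∘ σ))
            (fun h => sched (h.map MultiQueue.FullView.control))).opTime t k ω
            ∂(MultiQueue.drawLaw p m))
        / (Fintype.card (Equiv.Perm (Σ t, Fin (q t))) : ℝ≥0∞) ≤ ENNReal.ofReal C) ∧
    -- binary heaps: logarithmic expected time for worst-case operation sequences
    (∃ C : ℝ, 0 < C ∧
      ∀ (p m : ℕ) [NeZero m], (m : ℝ) = c * p →
      ∀ (E : Type u) (lt : E → E → Prop) [IsStrictWeakOrder E lt] [DecidableRel lt]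
        (ops : Fin p → List (MultiQueue.Op E))
        (sched : List (MultiQueue.FullView (BinaryHeap.pq lt) p m) → Fin p) (t : Fin p) (k : ℕ),
      ∫⁻ ω, (MultiQueue.heapSystem lt d ops sched).opTime t k ω ∂(MultiQueue.drawLaw p m)
        ≤ ENNReal.ofReal C * ∫⁻ ω, ENNReal.ofReal (Real.logb 2
            ((MultiQueue.heapSystem lt d ops sched).sizeAtAccess t k ω + 2))
              ∂(MultiQueue.drawLaw p m)) ∧
    -- van Emde Boas trees
    (∃ C : ℝ, 0 < C ∧
      ∀ (p m : ℕ) [NeZero m], (m : ℝ) = c * p →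
      ∀ (U : ℕ), 4 ≤ U →
      ∀ (E : Type u) (key : E → Fin U) (ops : Fin p → List (MultiQueue.Op E))
        (sched : List (MultiQueue.FullView (VEB.pq key) p m) → Fin p) (t : Fin p) (k : ℕ),
      ∫⁻ ω, (MultiQueue.vebSystem key d ops sched).opTime t k ω ∂(MultiQueue.drawLaw p m)
        ≤ ENNReal.ofReal (C * Real.logb 2 (Real.logb 2 U))) :=
  ⟨MultiQueue.exists_average_insertion_bound hc hd, MultiQueue.exists_heap_bound hc hd,
    MultiQueue.exists_veb_bound hc hd⟩
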